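/- Let $d\ge 3$, $p,q\in[1,\infty]$ (with $1/\infty=0$), $R,L,\sigma>0$ and $T\ge 1$. Write $q\wedge 2=\min(q,2)$, $\|\cdot\|_p$ for the $\ell_p$-norm on $\mathbb R^d$, and $$\mathrm b_q(d)=\frac1{d+1}\cdot\begin{cases} q\,d^{1/q} & \text{if } q\in[1,\log d),\\ e\log d & \text{if } q\ge \log d.\end{cases}$$ Assumptions. (1) $\Theta\subset\mathbb R^d$ is compact and convex. (2) $V:\Theta\to\mathbb R$ is convex, lower semicontinuous and $1$-strongly convex with respect to $\|\cdot\|_p$, i.e. $V(x')\ge V(x)+\langle w,x'-x\rangle+\tfrac12\|x-x'\|_p^2$ for all $x,x'\in\Theta$ and every subgradient $w\in\partial V(x)$; and $\sup_\Theta V-\inf_\Theta V\le R^2$. (3) $f_1,f_2,\dots:\mathbb R^d\to\mathbb R$ is a fixed sequence of convex functions with $|f_t(x)-f_t(x')|\le L\|x-x'\|_q$ for all $x,x'\in\mathbb R^d$. (4) $\zeta_1,\zeta_2,\dots$ are independent and uniformly distributed (normalized surface measure) on the unit $\ell_1$-sphere $\{x\in\mathbb R^d:\|x\|_1=1\}$.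 (5) The noises $\xi_t',\xi_t''$ are real random variables with $\mathbb E[(\xi_t')^2]\le\sigma^2$ and $\mathbb E[(\xi_t'')^2]\le\sigma^2$ for all $t$, and the family $(\xi_t',\xi_t'')_{t\ge1}$ is independent of $(\zeta_t)_{t\ge1}$. Algorithm. Put $z_1=0$ and, for $t=1,2,\dots$, $$x_t=\operatorname*{argmax}_{x\in\Theta}\{\eta\langle z_t,x\rangle-V(x)\},\qquad y_t'=f_t(x_t+h\zeta_t)+\xi_t',\qquad y_t''=f_t(x_t-h\zeta_t)+\xi_t'',$$ $$g_t=\frac d{2h}(y_t'-y_t'')\operatorname{sign}(\zeta_t),\qquad z_{t+1}=z_t-g_t,$$ where $\operatorname{sign}$ acts component-wise with $\operatorname{sign}(0)=1$, and the parameters are $$\eta=\frac{R}{\sqrt{TL}}\left(\frac{\sigma\,\mathrm b_q(d)}{2\sqrt2\,R}\sqrt{T d^{4-\frac2p}}+6(1+\sqrt2)^2L\,d^{1+\frac2{q\wedge2}-\frac2p}\right)^{-1/2},\qquad h=\left(\frac{\sqrt2R\sigma}{L\,\mathrm b_q(d)}\right)^{1/2}T^{-1/4}d^{1-\frac1{2p}}.$$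 Then, for every $x\in\Theta$, $$\mathbb E\left[\sum_{t=1}^T\big(f_t(x_t)-f_t(x)\big)\right]\le 11.9\,RL\sqrt{T d^{1+\frac2{q\wedge2}-\frac2p}}+2.4\sqrt{RL\sigma}\;T^{3/4}\cdot\begin{cases}\sqrt{q\,d^{1+\frac1q-\frac1p}} & \text{if } q\in[1,\log d),\\ \sqrt{e\log(d)\,d^{1-\frac1p}} & \text{if } q\ge\log d.\end{cases}$$ -/

import Mathlib

open MeasureTheory ProbabilityTheory

noncomputable section

namespace ZeroOrder

/-- The space `ℝ^d` with its Euclidean structure. -/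
abbrev Vec (d : ℕ) : Type := EuclideanSpace ℝ (Fin d)

/-- The `ℓ_p`-norm of a vector of `ℝ^d`, for `p ∈ [1, ∞]`. -/
def ellNorm {d : ℕ} (p : ENNReal) (x : Vec d) : ℝ :=
  ‖(WithLp.toLp p (WithLp.ofLp x) : PiLp p (fun _ : Fin d => ℝ))‖

/-- The reciprocal `1 / p` as a real number, with `1 / ∞ = 0`. -/
def recip (p : ENNReal) : ℝ := (p⁻¹).toReal

/-- The unit sphere of the `ℓ_1`-norm. -/
def l1Sphere (d : ℕ) : Set (Vec d) := {x | ellNorm 1 x = 1}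

/-- The surface measure of `ℝ^d`: the `(d-1)`-dimensional Hausdorff measure of the
Euclidean metric. -/
def surfaceMeasure (d : ℕ) : Measure (Vec d) := Measure.hausdorffMeasure ((d : ℝ) - 1)

/-- The component-wise sign, with the value `1` at `0`. -/
def signVec {d : ℕ} (x : Vec d) : Vec d :=
  WithLp.toLp 2 (fun i => if 0 ≤ x i then (1 : ℝ) else -1)

/-- `w` is a subgradient at `x` of the function `V : Θ → ℝ`. -/
def IsSubgradient {d : ℕ} (Θ : Set (Vec d)) (V : Vec d → ℝ) (x w : Vec d) : Prop :=
  ∀ y ∈ Θ, V x + inner ℝ w (y - x) ≤ V y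

/-- `V` is convex, and `1`-strongly convex with respect to the `ℓ_p`-norm, on `Θ`. -/
def StronglyConvexLp {d : ℕ} (p : ENNReal) (Θ : Set (Vec d)) (V : Vec d → ℝ) : Prop :=
  ConvexOn ℝ Θ V ∧
    ∀ x ∈ Θ, ∀ x' ∈ Θ, ∀ w : Vec d, IsSubgradient Θ V x w →
      V x + inner ℝ w (x' - x) + 1 / 2 * ellNorm p (x - x') ^ 2 ≤ V x'

/-- `x ∈ argmax_{y ∈ Θ} {⟨θ, y⟩ - V y}`. -/
def IsArgmax {d : ℕ} (Θ : Set (Vec d)) (V : Vec d → ℝ) (θ x : Vec d) : Prop :=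
  x ∈ Θ ∧ ∀ y ∈ Θ, inner ℝ θ y - V y ≤ inner ℝ θ x - V x

/-- The point `argmax_{x ∈ Θ} {⟨θ, x⟩ - V x}` (it exists and is unique when `Θ` is compact and
nonempty and `V` is lower semicontinuous and strongly convex on `Θ`). -/
def argmaxPoint {d : ℕ} (Θ : Set (Vec d)) (V : Vec d → ℝ) (θ : Vec d) : Vec d :=
  Classical.epsilon (IsArgmax Θ V θ)

/-- The `ℓ_1`-gradient estimate `(d / (2h)) (y' - y'') sign ζ` at the point `x`, computed from the
noisy values `y' = f (x + h ζ) + ξ'` and `y'' = f (x - h ζ) + ξ''`. -/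
def gradEstimate {d : ℕ} (f : Vec d → ℝ) (h : ℝ) (x ζ : Vec d) (ξ' ξ'' : ℝ) : Vec d :=
  ((d : ℝ) / (2 * h) * ((f (x + h • ζ) + ξ') - (f (x - h • ζ) + ξ''))) • signVec ζ

/-- The dual variable `z_t` of zero-order `ℓ_1`-randomized online dual averaging: `z = 0` at the
first round, and `z_{t+1} = z_t - g_t`, where `g_t` is the gradient estimate at the point
`x_t = argmax_{x ∈ Θ} {η_t ⟨z_t, x⟩ - V x}`. Rounds are numbered from `0`; `ζ`, `ξ'`, `ξ''` are the
realized randomization and noises. -/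
def dualVar {d : ℕ} (Θ : Set (Vec d)) (V : Vec d → ℝ) (η h : ℕ → ℝ) (f : ℕ → Vec d → ℝ)
    (ζ : ℕ → Vec d) (ξ' ξ'' : ℕ → ℝ) : ℕ → Vec d
  | 0 => 0
  | t + 1 =>
    dualVar Θ V η h f ζ ξ' ξ'' t -
      gradEstimate (f t) (h t) (argmaxPoint Θ V (η t • dualVar Θ V η h f ζ ξ' ξ'' t))
        (ζ t) (ξ' t) (ξ'' t)

/-- The output `x_t` of the algorithm at round `t`. -/
def output {d : ℕ} (Θ : Set (Vec d)) (V : Vec d → ℝ) (η h : ℕ → ℝ) (f : ℕ → Vec d → ℝ)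
    (ζ : ℕ → Vec d) (ξ' ξ'' : ℕ → ℝ) (t : ℕ) : Vec d :=
  argmaxPoint Θ V (η t • dualVar Θ V η h f ζ ξ' ξ'' t)

/-- The sequence `b_q(d)`. -/
def bias (q : ENNReal) (d : ℕ) : ℝ :=
  1 / ((d : ℝ) + 1) *
    (if q < ENNReal.ofReal (Real.log d) then q.toReal * (d : ℝ) ^ recip q
      else Real.exp 1 * Real.log d)

/-- The step size `η` for adversarial noise. For the value of `h` below it equals
`(R / √T) (d^(4-2/p) σ² / (2h²) + 6 (1+√2)² L² d^(1+2/(q∧2)-2/p))^(-1/2)`. -/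
def noisyStep (p q : ENNReal) (d T : ℕ) (R L σ : ℝ) : ℝ :=
  R / √(T * L) *
    (σ * bias q d / (2 * √2 * R) * √(T * (d : ℝ) ^ (4 - 2 * recip p)) +
      6 * (1 + √2) ^ 2 * L * (d : ℝ) ^ (1 + 2 * recip (min q 2) - 2 * recip p)) ^ (-(1 / 2) : ℝ)

/-- The discretization parameter `h` for adversarial noise. -/
def noisyDiscr (p q : ENNReal) (d T : ℕ) (R L σ : ℝ) : ℝ :=
  (√2 * R * σ / (L * bias q d)) ^ (1 / 2 : ℝ) * (T : ℝ) ^ (-(1 / 4) : ℝ) *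
    (d : ℝ) ^ (1 - recip p / 2)

/-- The regret `∑_t (f_t(x_t) - f_t(x))` over `T` rounds against the fixed action `x`. -/
def regret {d : ℕ} (f : ℕ → Vec d → ℝ) (xs : ℕ → Vec d) (T : ℕ) (x : Vec d) : ℝ :=
  ∑ t ∈ Finset.range T, (f t (xs t) - f t x)

end ZeroOrder

end

open ZeroOrder

/-!
The algorithm is dual averaging run with the randomized gradients `g_t = c_t • signVec ζ_t`, where
`c_t = d / (2h) (y_t' - y_t'')`. Three facts combine.

*Dual averaging* (`dualAveraging_regret`). Since `‖signVec ζ‖_∞ ≤ 1`, the square of the norm of `g_t`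
dual to `‖·‖_p` is at most `d^(2-2/p) c_t²`, and pathwise the linearized regret
`∑ ⟪g_t, x_t - x⟫` is at most `R²/η + (η/2) d^(2-2/p) ∑ c_t²`.

*Bias* (`sub_sub_bias_le_integral`). By the divergence theorem on the `ℓ_1`-ball, `(d/h) f(x + hζ)
signVec ζ` is in mean the gradient of the average of `f` over `x + h B`, `B` the unit `ℓ_1`-ball;
this average lies between `f` and `f + L h E‖U‖_q` with `U` uniform on `B`, and
`E‖U‖_q = d/(d+1) E‖ζ‖_q ≤ b_q(d)`. For convex Lipschitz `f`, only an inequality for the increments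
is needed, and the divergence theorem is replaced by integration by parts against a Lipschitz cut-off
of the ball, whose width tends to `0` (`integral_ball_sub_le_sphere`). The symmetry of the sphere
cancels the noise, which is independent of `ζ_t`.

*Variance* (`integral_sq_estimate_le`). The difference `f(x + hζ) - f(x - hζ)` is an odd Lipschitz
function of `ζ`, and its second moment is bounded by a Poincaré inequality on the `ℓ_1`-sphere
(`integral_sphereLaw_sq_le`). For a vector `W` of independent Laplace variables, `W / ‖W‖_1` is
uniform on the sphere and independent of `‖W‖_1`, so the inequality follows from that for the Laplace
distribution (`poincare_laplace`), applied to the extension of the function that is homogeneous of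
degree one. The Laplace inequality tensorizes (Efron–Stein) a one-dimensional Hardy inequality. The
same representation yields the bound on `E‖ζ‖_q` by Jensen's inequality.

The uniform distribution on the sphere is given through the Hausdorff measure. It enters only via
polar coordinates for the `ℓ_1`-norm (`map_polar`): on each orthant the sphere lies in an affine
hyperplane, where the measure induced by the cones is translation invariant, hence a multiple of the
Hausdorff measure.

The randomization `ζ_t` of a round is independent of the earlier history and of the noise
(`indepFun_dualVar`), so that the one-round estimates may be integrated out (`integral_round_le`);
`tuned_bound` inserts the values of `η` and `h`.
-/

namespace ZeroOrder

/-! ### `ℓ_p`-norms -/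

theorem recip_eq (p : ENNReal) : recip p = 1 / p.toReal := by
  rw [recip, ENNReal.toReal_inv, one_div]

theorem ellNorm_top {d : ℕ} (x : Vec d) : ellNorm ⊤ x = ⨆ i, |x i| := by
  rw [ellNorm, PiLp.norm_eq_ciSup]; simp

theorem ellNorm_eq_sum {d : ℕ} {p : ENNReal} (hp : 1 ≤ p) (hp' : p ≠ ⊤) (x : Vec d) :
    ellNorm p x = (∑ i, |x i| ^ p.toReal) ^ (1 / p.toReal) := by
  have h0 : 0 < p.toReal := ENNReal.toReal_pos (by positivity) hp'
  rw [ellNorm, PiLp.norm_eq_sum h0]; simp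

theorem ellNorm_one {d : ℕ} (x : Vec d) : ellNorm 1 x = ∑ i, |x i| := by
  rw [ellNorm_eq_sum le_rfl ENNReal.one_ne_top]; simp

theorem ellNorm_two {d : ℕ} (x : Vec d) : ellNorm 2 x = ‖x‖ := rfl

section
variable {d : ℕ} (p : ENNReal) [Fact (1 ≤ p)]

theorem ellNorm_nonneg (x : Vec d) : 0 ≤ ellNorm p x := norm_nonneg _

theorem ellNorm_add_le (x y : Vec d) : ellNorm p (x + y) ≤ ellNorm p x + ellNorm p y := by
  simpa [ellNorm] using norm_add_le (WithLp.toLp p (WithLp.ofLp x)) (WithLp.toLp p (WithLp.ofLp y))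

theorem ellNorm_smul (c : ℝ) (x : Vec d) : ellNorm p (c • x) = |c| * ellNorm p x := by
  simpa [ellNorm] using norm_smul c (WithLp.toLp p (WithLp.ofLp x))

theorem ellNorm_neg (x : Vec d) : ellNorm p (-x) = ellNorm p x := by
  simpa using ellNorm_smul p (-1) x

theorem continuous_ellNorm : Continuous (ellNorm p : Vec d → ℝ) := by
  unfold ellNorm
  exact continuous_norm.comp ((PiLp.continuous_toLp p _).comp (PiLp.continuous_ofLp 2 _))

theorem abs_apply_le_ellNorm (x : Vec d) (i : Fin d) : |x i| ≤ ellNorm p x := by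
  simpa [ellNorm] using PiLp.norm_apply_le (WithLp.toLp p (WithLp.ofLp x)) i

end

/-- The `ℓ_p`-norms decrease in `p`. -/
theorem ellNorm_anti {d : ℕ} {r q : ENNReal} (hr : 1 ≤ r) (hrq : r ≤ q) (x : Vec d) :
    ellNorm q x ≤ ellNorm r x := by
  have : Fact (1 ≤ r) := ⟨hr⟩
  have : Fact (1 ≤ q) := ⟨hr.trans hrq⟩
  rcases eq_or_ne q ⊤ with rfl | hq
  · rw [ellNorm_top]
    exact Real.iSup_le (abs_apply_le_ellNorm r x) (ellNorm_nonneg r x)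
  have hr' : r ≠ ⊤ := ne_top_of_le_ne_top hq hrq
  have hr0 : 0 < r.toReal := ENNReal.toReal_pos (by positivity) hr'
  have hq0 : 0 < q.toReal := ENNReal.toReal_pos (by have := hr.trans hrq; positivity) hq
  have hle : r.toReal ≤ q.toReal := ENNReal.toReal_mono hq hrq
  set N := ellNorm r x with hN
  have hN0 : 0 ≤ N := ellNorm_nonneg r x
  have hNr : ∑ i, |x i| ^ r.toReal = N ^ r.toReal := by
    rw [hN, ellNorm_eq_sum hr hr', ← Real.rpow_mul (by positivity), one_div_mul_cancel hr0.ne',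
      Real.rpow_one]
  rw [ellNorm_eq_sum (hr.trans hrq) hq]
  have key : ∑ i, |x i| ^ q.toReal ≤ N ^ q.toReal := by
    calc ∑ i, |x i| ^ q.toReal ≤ ∑ i, |x i| ^ r.toReal * N ^ (q.toReal - r.toReal) := by
          refine Finset.sum_le_sum fun i _ => ?_
          rw [show q.toReal = r.toReal + (q.toReal - r.toReal) by ring,
            Real.rpow_add_of_nonneg (abs_nonneg _) hr0.le (by linarith)]
          rw [show r.toReal + (q.toReal - r.toReal) - r.toReal = q.toReal - r.toReal by ring]
          exact mul_le_mul_of_nonneg_left (Real.rpow_le_rpow (abs_nonneg _)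
            (abs_apply_le_ellNorm r x i) (by linarith)) (by positivity)
      _ = N ^ q.toReal := by
          rw [← Finset.sum_mul, hNr, ← Real.rpow_add_of_nonneg hN0 hr0.le (by linarith)]
          congr 1; ring
  calc (∑ i, |x i| ^ q.toReal) ^ (1 / q.toReal) ≤ (N ^ q.toReal) ^ (1 / q.toReal) :=
        Real.rpow_le_rpow (by positivity) key (by positivity)
    _ = N := by rw [← Real.rpow_mul hN0, mul_one_div_cancel hq0.ne', Real.rpow_one]

/-- Power mean inequality: `‖x‖_r ≤ d^(1/r - 1/q) ‖x‖_q` for `r ≤ q`. -/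
theorem ellNorm_le_mul {d : ℕ} {r q : ENNReal} (hr : 1 ≤ r) (hrq : r ≤ q) (x : Vec d) :
    ellNorm r x ≤ (d : ℝ) ^ (recip r - recip q) * ellNorm q x := by
  have : Fact (1 ≤ r) := ⟨hr⟩
  have : Fact (1 ≤ q) := ⟨hr.trans hrq⟩
  rcases eq_or_ne r ⊤ with rfl | hr'
  · obtain rfl : q = ⊤ := top_le_iff.1 hrq
    simp
  have hr0 : 0 < r.toReal := ENNReal.toReal_pos (by positivity) hr'
  set N := ellNorm q x with hN
  have hN0 : 0 ≤ N := ellNorm_nonneg q x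
  have main : ∑ i, |x i| ^ r.toReal ≤ (d : ℝ) ^ (1 - r.toReal * recip q) * N ^ r.toReal := by
    rcases eq_or_ne q ⊤ with rfl | hq
    · calc ∑ i, |x i| ^ r.toReal ≤ ∑ _i : Fin d, N ^ r.toReal :=
            Finset.sum_le_sum fun i _ => Real.rpow_le_rpow (abs_nonneg _)
              (abs_apply_le_ellNorm ⊤ x i) hr0.le
        _ = _ := by simp [recip]
    have hq0 : 0 < q.toReal := ENNReal.toReal_pos (by have := hr.trans hrq; positivity) hq
    have hle : r.toReal ≤ q.toReal := ENNReal.toReal_mono hq hrq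
    have h1 := Real.rpow_sum_le_const_mul_sum_rpow Finset.univ (fun i => |x i| ^ r.toReal)
      (p := q.toReal / r.toReal) ((one_le_div hr0).2 hle)
    have e1 : ∀ i, |(|x i| ^ r.toReal)| = |x i| ^ r.toReal := fun i => abs_of_nonneg (by positivity)
    have e2 : ∀ i, (|x i| ^ r.toReal) ^ (q.toReal / r.toReal) = |x i| ^ q.toReal := fun i => by
      rw [← Real.rpow_mul (abs_nonneg _), mul_div_cancel₀ _ hr0.ne']
    simp only [e1, e2, Finset.card_univ, Fintype.card_fin] at h1
    have h2 := Real.rpow_le_rpow (by positivity) h1 (z := r.toReal / q.toReal) (by positivity)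
    rw [← Real.rpow_mul (by positivity), div_mul_div_comm, mul_comm q.toReal,
      div_self (by positivity), Real.rpow_one,
      Real.mul_rpow (by positivity) (by positivity), ← Real.rpow_mul (by positivity)] at h2
    refine h2.trans_eq ?_
    congr 1
    · congr 1; rw [recip_eq]; field_simp
    · rw [hN, ellNorm_eq_sum (hr.trans hrq) hq, ← Real.rpow_mul (by positivity)]
      congr 1; field_simp
  rw [ellNorm_eq_sum hr hr']
  calc _ ≤ ((d : ℝ) ^ (1 - r.toReal * recip q) * N ^ r.toReal) ^ (1 / r.toReal) :=
        Real.rpow_le_rpow (by positivity) main (by positivity)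
    _ = _ := by
        rw [Real.mul_rpow (by positivity) (by positivity), ← Real.rpow_mul (by positivity),
          ← Real.rpow_mul hN0, mul_one_div_cancel hr0.ne', Real.rpow_one, recip_eq r]
        congr 2; field_simp

theorem ellNorm_one_le {d : ℕ} {p : ENNReal} (hp : 1 ≤ p) (x : Vec d) :
    ellNorm 1 x ≤ (d : ℝ) ^ (1 - recip p) * ellNorm p x := by
  simpa [recip] using ellNorm_le_mul le_rfl hp x

/-- Comparison of the `ℓ_q`- and the Euclidean norm. For `q ≥ 2` the constant is `1`. -/
theorem ellNorm_le_norm {d : ℕ} {q : ENNReal} (hq : 1 ≤ q) (x : Vec d) :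
    ellNorm q x ≤ (d : ℝ) ^ (recip (min q 2) - 1 / 2) * ‖x‖ := by
  rcases le_total q 2 with h | h
  · have := ellNorm_le_mul hq h x
    rw [recip_eq 2, ENNReal.toReal_ofNat, ellNorm_two] at this
    rwa [min_eq_left h]
  · have := ellNorm_anti (by norm_num) h x
    rw [ellNorm_two] at this
    simpa [min_eq_right h, recip_eq 2] using this

theorem norm_le_ellNorm_one {d : ℕ} (x : Vec d) : ‖x‖ ≤ ellNorm 1 x :=
  ellNorm_anti le_rfl (by norm_num) x

/-! ### Dual averaging -/

section
variable {d : ℕ} {p : ENNReal} {Θ : Set (Vec d)} {V : Vec d → ℝ}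

theorem isArgmax_argmaxPoint (hΘ : IsCompact Θ) (hne : Θ.Nonempty)
    (hV : LowerSemicontinuousOn V Θ) (θ : Vec d) : IsArgmax Θ V θ (argmaxPoint Θ V θ) := by
  have h1 : LowerSemicontinuousOn (fun y => V y + -inner ℝ θ y) Θ :=
    hV.add ((show Continuous fun y : Vec d => -(inner ℝ θ y : ℝ) by
      fun_prop).lowerSemicontinuous.lowerSemicontinuousOn Θ)
  obtain ⟨a, ha, hmin⟩ := h1.exists_isMinOn hne hΘ
  refine Classical.epsilon_spec (p := IsArgmax Θ V θ) ⟨a, ha, fun y hy => ?_⟩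
  have := isMinOn_iff.1 hmin y hy
  linarith

/-- The dual variable `θ` is a subgradient at its argmax, so that strong convexity holds there. -/
theorem IsArgmax.le_of_stronglyConvex (hV : StronglyConvexLp p Θ V) {θ x x' : Vec d}
    (hx : IsArgmax Θ V θ x) (hx' : x' ∈ Θ) :
    V x + inner ℝ θ (x' - x) + 1 / 2 * ellNorm p (x - x') ^ 2 ≤ V x' := by
  refine hV.2 x hx.1 x' hx' θ fun y hy => ?_
  have := hx.2 y hy
  rw [inner_sub_right]
  linarith

/-- Adding the strong convexity inequalities at the two points gives
`‖x - x'‖_p² ≤ ⟪θ - θ', x - x'⟫`, so that the argmax is Lipschitz in the dual variable. -/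
theorem IsArgmax.norm_sub_le (hp : 1 ≤ p) (hV : StronglyConvexLp p Θ V) {θ θ' x x' : Vec d}
    (hx : IsArgmax Θ V θ x) (hx' : IsArgmax Θ V θ' x') :
    ‖x - x'‖ ≤ (d : ℝ) ^ (2 * (1 - recip p)) * ‖θ - θ'‖ := by
  have : Fact (1 ≤ p) := ⟨hp⟩
  have h1 := hx.le_of_stronglyConvex hV hx'.1
  have h2 := hx'.le_of_stronglyConvex hV hx.1
  have h3 : ellNorm p (x' - x) = ellNorm p (x - x') := by rw [← ellNorm_neg, neg_sub]
  have h4 : ellNorm p (x - x') ^ 2 ≤ inner ℝ (θ - θ') (x - x') := by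
    rw [h3] at h2
    simp only [inner_sub_left, inner_sub_right] at *
    linarith
  have h5 := h4.trans (real_inner_le_norm _ _)
  have h6 := (norm_le_ellNorm_one (x - x')).trans (ellNorm_one_le hp (x - x'))
  rcases (norm_nonneg (x - x')).eq_or_lt with h0 | h0
  · rw [← h0]; positivity
  have h7 : ‖x - x'‖ ^ 2 ≤ (d : ℝ) ^ (2 * (1 - recip p)) * (‖θ - θ'‖ * ‖x - x'‖) := by
    calc ‖x - x'‖ ^ 2 ≤ ((d : ℝ) ^ (1 - recip p) * ellNorm p (x - x')) ^ 2 := by gcongr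
      _ = (d : ℝ) ^ (2 * (1 - recip p)) * ellNorm p (x - x') ^ 2 := by
          rw [mul_pow, ← Real.rpow_natCast, ← Real.rpow_mul (by positivity)]
          congr 2; push_cast; ring
      _ ≤ _ := by gcongr
  nlinarith

theorem continuous_argmaxPoint (hp : 1 ≤ p) (hΘ : IsCompact Θ) (hne : Θ.Nonempty)
    (hV : LowerSemicontinuousOn V Θ) (hVs : StronglyConvexLp p Θ V) :
    Continuous (argmaxPoint Θ V) := by
  refine (LipschitzWith.of_dist_le_mul (K := ((d : ℝ) ^ (2 * (1 - recip p))).toNNReal)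
    fun θ θ' => ?_).continuous
  rw [dist_eq_norm, dist_eq_norm, Real.coe_toNNReal _ (by positivity)]
  exact (isArgmax_argmaxPoint hΘ hne hV θ).norm_sub_le hp hVs (isArgmax_argmaxPoint hΘ hne hV θ')

/-- Hölder's inequality for the pair `ℓ_∞`, `ℓ_1`. -/
theorem inner_le_ellNorm_one {s y : Vec d} (hs : ∀ i, |s i| ≤ 1) : |inner ℝ s y| ≤ ellNorm 1 y := by
  rw [ellNorm_one, PiLp.inner_apply]
  refine (Finset.abs_sum_le_sum_abs _ _).trans (Finset.sum_le_sum fun i _ => ?_)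
  simp only [RCLike.inner_apply, conj_trivial, abs_mul]
  exact mul_le_of_le_one_right (abs_nonneg _) (hs i)

/-- Regret of dual averaging with constant step `η` and gradients `c t • s t`, where the
coordinates of `s t` are at most `1` in absolute value. The square of the dual norm of such a
gradient is at most `d^(2 - 2/p) c²`. -/
theorem dualAveraging_regret (hp : 1 ≤ p) (hΘ : IsCompact Θ)
    (hV : LowerSemicontinuousOn V Θ) (hVs : StronglyConvexLp p Θ V) {R η : ℝ} (hη : 0 < η)
    (hVrange : ∀ x ∈ Θ, ∀ x' ∈ Θ, V x - V x' ≤ R ^ 2)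
    {z s : ℕ → Vec d} {c : ℕ → ℝ} (hs : ∀ t i, |s t i| ≤ 1) (hz0 : z 0 = 0)
    (hz : ∀ t, z (t + 1) = z t - c t • s t) {x : Vec d} (hx : x ∈ Θ) (T : ℕ) :
    ∑ t ∈ Finset.range T, c t * inner ℝ (s t) (argmaxPoint Θ V (η • z t) - x) ≤
      R ^ 2 / η + η / 2 * (d : ℝ) ^ (2 * (1 - recip p)) * ∑ t ∈ Finset.range T, c t ^ 2 := by
  have : Fact (1 ≤ p) := ⟨hp⟩
  set a : ℕ → Vec d := fun t => argmaxPoint Θ V (η • z t) with ha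
  have hA : ∀ t, IsArgmax Θ V (η • z t) (a t) := fun t => isArgmax_argmaxPoint hΘ ⟨x, hx⟩ hV _
  have step : ∀ t, inner ℝ (η • z (t + 1)) (a (t + 1)) - V (a (t + 1)) ≤
      inner ℝ (η • z t) (a t) - V (a t) - η * (c t * inner ℝ (s t) (a t)) +
        η ^ 2 / 2 * (d : ℝ) ^ (2 * (1 - recip p)) * c t ^ 2 := by
    intro t
    have h1 := (hA t).le_of_stronglyConvex hVs (hA (t + 1)).1
    have h2 : |inner ℝ (s t) (a t - a (t + 1))| ≤
        (d : ℝ) ^ (1 - recip p) * ellNorm p (a t - a (t + 1)) :=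
      (inner_le_ellNorm_one (hs t)).trans (ellNorm_one_le hp _)
    set N := ellNorm p (a t - a (t + 1))
    set D := (d : ℝ) ^ (1 - recip p)
    have hD : (d : ℝ) ^ (2 * (1 - recip p)) = D ^ 2 := by
      rw [← Real.rpow_natCast, ← Real.rpow_mul (by positivity)]
      congr 1; push_cast; ring
    have h3 : η * c t * inner ℝ (s t) (a t - a (t + 1)) ≤ |η * c t| * (D * N) := by
      refine (le_abs_self _).trans ?_
      rw [abs_mul]
      gcongr
    -- the quadratic term of strong convexity absorbs the increment of the argmax
    have h4 : |η * c t| * (D * N) ≤ 1 / 2 * N ^ 2 + 1 / 2 * (η ^ 2 * c t ^ 2 * D ^ 2) := by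
      have := sq_nonneg (N - |η * c t| * D)
      have e : |η * c t| ^ 2 = η ^ 2 * c t ^ 2 := by rw [sq_abs]; ring
      rw [← e]
      nlinarith
    rw [hz, hD]
    simp only [inner_sub_left, inner_sub_right, inner_smul_left,
      conj_trivial] at *
    linarith
  have sum : inner ℝ (η • z T) (a T) - V (a T) ≤ inner ℝ (η • z 0) (a 0) - V (a 0) -
      η * ∑ t ∈ Finset.range T, c t * inner ℝ (s t) (a t) +
        η ^ 2 / 2 * (d : ℝ) ^ (2 * (1 - recip p)) * ∑ t ∈ Finset.range T, c t ^ 2 := by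
    clear_value a
    induction T with
    | zero => simp
    | succ T ih =>
      have := step T
      rw [Finset.sum_range_succ, Finset.sum_range_succ]
      linarith
  have hzT : inner ℝ (z T) x = - ∑ t ∈ Finset.range T, c t * inner ℝ (s t) x := by
    clear sum
    induction T with
    | zero => simp [hz0]
    | succ T ih =>
      rw [Finset.sum_range_succ, hz, inner_sub_left, ih, inner_smul_left]; simp; ring
  have h5 := (hA T).2 x hx
  have h6 := hVrange x hx (a 0) (hA 0).1
  rw [inner_smul_left, hzT] at h5
  rw [hz0] at sum
  simp only [smul_zero, inner_zero_left, conj_trivial] at sum h5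
  have h7 : ∑ t ∈ Finset.range T, c t * inner ℝ (s t) (a t - x) =
      ∑ t ∈ Finset.range T, c t * inner ℝ (s t) (a t) -
        ∑ t ∈ Finset.range T, c t * inner ℝ (s t) x := by
    rw [← Finset.sum_sub_distrib]; simp only [inner_sub_right, mul_sub]
  rw [h7]
  refine le_of_mul_le_mul_left ?_ hη
  have e : η * (R ^ 2 / η) = R ^ 2 := by field_simp
  rw [mul_add, e]
  nlinarith

end

/-! ### Polar coordinates for the `ℓ_1`-norm -/

/-- The vector of `ℝ^d` whose coordinates are all `1`. -/
def ones (d : ℕ) : Vec d := WithLp.toLp 2 (fun _ => 1)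

/-- The sum of the coordinates, as a continuous linear form. -/
noncomputable def coordSum (d : ℕ) : Vec d →L[ℝ] ℝ := innerSL ℝ (ones d)

theorem coordSum_apply {d : ℕ} (w : Vec d) : coordSum d w = ∑ i, w i := by
  simp [coordSum, ones, PiLp.inner_apply]

theorem measurable_ellNorm (p : ENNReal) [Fact (1 ≤ p)] {d : ℕ} :
    Measurable (ellNorm p : Vec d → ℝ) := (continuous_ellNorm p).measurable

/-- Polar coordinates for the linear form `w ↦ ∑ w_i` in place of the norm: the measure of the cone over
a part `B` of the affine hyperplane `∑ w_i = 1`, cut off at heights in `I`, is proportional to the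
`n`-dimensional Hausdorff measure of `B`. -/
theorem hyperplane_measure_eq {n : ℕ} {I : Set ℝ} (hI : MeasurableSet I) (hIpos : I ⊆ Set.Ioi 0)
    (hIb : Bornology.IsBounded I) : ∃ c : NNReal, ∀ B : Set (Vec (n + 1)), MeasurableSet B →
      volume {w : Vec (n + 1) | coordSum _ w ∈ I ∧ (coordSum _ w)⁻¹ • w ∈ B} =
        c * surfaceMeasure (n + 1) (B ∩ {w | coordSum _ w = 1}) := by
  set ℓ := coordSum (n + 1) with hℓ
  set E : Submodule ℝ (Vec (n + 1)) := (ℝ ∙ ones (n + 1))ᗮ with hE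
  have memE : ∀ v, v ∈ E ↔ ℓ v = 0 := fun v => by
    rw [hE, Submodule.mem_orthogonal_singleton_iff_inner_right]; rfl
  have ones_ne : ones (n + 1) ≠ 0 := fun h => by
    have := congrArg (fun v : Vec (n + 1) => v 0) h
    simp [ones] at this
  set p0 : Vec (n + 1) := ((n + 1 : ℝ))⁻¹ • ones (n + 1) with hp0
  have ℓp0 : ℓ p0 = 1 := by
    rw [hℓ, coordSum_apply]
    simp [hp0, ones]
    field_simp
  have hfin : Fact (Module.finrank ℝ (Vec (n + 1)) = n + 1) := ⟨by simp⟩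
  have hrank : Module.finrank ℝ E = n := Submodule.finrank_orthogonal_span_singleton ones_ne
  let Pr : Vec (n + 1) →L[ℝ] E := E.orthogonalProjectionOnto
  have hPr : ∀ a, ℓ a = 1 → (Pr a : Vec (n + 1)) = a - p0 := by
    intro a ha
    have h1 : a - p0 ∈ E := by rw [memE, map_sub, ha, ℓp0, sub_self]
    have h2 : Pr p0 = 0 := by
      refine Submodule.orthogonalProjectionOnto_apply_of_mem_orthogonal ?_
      rw [hE, Submodule.orthogonal_orthogonal]
      exact Submodule.smul_mem _ _ (Submodule.mem_span_singleton_self _)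
    have h3 : Pr (a - p0) = ⟨a - p0, h1⟩ :=
      Submodule.orthogonalProjectionOnto_mem_subspace_eq_self (K := E) ⟨a - p0, h1⟩
    rw [map_sub, h2, sub_zero] at h3
    rw [h3]
  let π : Vec (n + 1) → E := fun w => Pr ((ℓ w)⁻¹ • w)
  have hπm : Measurable π := Pr.continuous.measurable.comp
    ((ℓ.continuous.measurable.inv).smul measurable_id)
  have hπ : ∀ w, ℓ w ∈ I → (ℓ w)⁻¹ • w = π w + p0 := fun w hw => by
    have h0 : ℓ w ≠ 0 := (hIpos hw).ne'
    rw [hPr _ (by rw [map_smul, smul_eq_mul, inv_mul_cancel₀ h0]), sub_add_cancel]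
  have hℓI : MeasurableSet (ℓ ⁻¹' I) := ℓ.continuous.measurable hI
  set κ : Measure (Vec (n + 1)) := volume.restrict (ℓ ⁻¹' I) with hκ
  set m : Measure E := κ.map π with hm
  -- `m` is the measure of cones over subsets of the hyperplane, which `Pr` identifies with its
  -- direction `E`; it is finite on compact sets
  have hmfin : IsFiniteMeasureOnCompacts m := ⟨fun K hK => by
    obtain ⟨C, hC⟩ := hK.isBounded.exists_norm_le
    obtain ⟨M, hM⟩ := hIb.exists_norm_le
    rw [hm, Measure.map_apply hπm hK.measurableSet, hκ,
      Measure.restrict_apply (hπm hK.measurableSet)]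
    refine (measure_mono (t := Metric.closedBall 0 (M * (C + ‖p0‖))) ?_).trans_lt
      measure_closedBall_lt_top
    rintro w ⟨hwK, hwI⟩
    rw [mem_closedBall_zero_iff]
    have h0 : ℓ w ≠ 0 := (hIpos hwI).ne'
    have e : w = ℓ w • ((π w : Vec (n + 1)) + p0) := by
      rw [← hπ w hwI, smul_smul, mul_inv_cancel₀ h0, one_smul]
    rw [e, norm_smul]
    have h1 := hM _ hwI
    have h2 := hC _ hwK
    have h3 : ‖(π w : Vec (n + 1)) + p0‖ ≤ C + ‖p0‖ :=
      (norm_add_le _ _).trans (by simpa using h2)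
    have : 0 ≤ M := (norm_nonneg _).trans h1
    gcongr⟩
  -- and invariant under translations, which lift to volume preserving shears
  have hminv : m.IsAddLeftInvariant := ⟨fun v => by
    have hdet : LinearMap.det (LinearMap.transvection (ℓ : Vec (n + 1) →ₗ[ℝ] ℝ) (v : Vec (n + 1)))
        = 1 := by
      rw [LinearMap.transvection.det]
      simpa using (memE v).1 v.2
    let Sh := LinearMap.transvection (ℓ : Vec (n + 1) →ₗ[ℝ] ℝ) (v : Vec (n + 1))
    have hSh : ∀ w, Sh w = w + ℓ w • (v : Vec (n + 1)) := fun w => by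
      simp [Sh, LinearMap.transvection.apply]
    have hShℓ : ∀ w, ℓ (Sh w) = ℓ w := fun w => by
      rw [hSh, map_add, map_smul, (memE v).1 v.2]; simp
    have hShm : Measurable Sh := Sh.continuous_of_finiteDimensional.measurable
    ext B hB
    rw [Measure.map_apply (measurable_const_add v) hB, hm,
      Measure.map_apply hπm (measurable_const_add v hB), Measure.map_apply hπm hB, hκ,
      Measure.restrict_apply (hπm (measurable_const_add v hB)), Measure.restrict_apply (hπm hB)]
    have h1 := Measure.addHaar_preimage_linearMap (volume : Measure (Vec (n + 1)))
      (f := Sh) (by rw [hdet]; exact one_ne_zero) (π ⁻¹' B ∩ ℓ ⁻¹' I)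
    rw [hdet] at h1
    simp only [inv_one, abs_one, ENNReal.ofReal_one, one_mul] at h1
    rw [← h1]
    congr 1
    ext w
    simp only [Set.mem_inter_iff, Set.mem_preimage, hShℓ]
    refine and_congr_left fun hw => ?_
    have h0 : ℓ w ≠ 0 := (hIpos hw).ne'
    have : π (Sh w) = v + π w := by
      have hv : Pr (v : Vec (n + 1)) = v :=
        Submodule.orthogonalProjectionOnto_mem_subspace_eq_self (K := E) v
      simp only [π, hShℓ]
      rw [hSh, smul_add, smul_smul, inv_mul_cancel₀ h0, one_smul, map_add, hv]
      exact add_comm _ _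
    rw [this]⟩
  -- hence a multiple of the Hausdorff measure of `E`, which `τ` below carries to the hyperplane
  have hHaar : (Measure.hausdorffMeasure (n : ℝ) : Measure E).IsAddHaarMeasure := by
    have := isAddHaarMeasure_hausdorffMeasure (E := E)
    rwa [hrank] at this
  have heq := Measure.isAddLeftInvariant_eq_smul m (Measure.hausdorffMeasure (n : ℝ))
  refine ⟨m.addHaarScalarFactor (Measure.hausdorffMeasure (n : ℝ)), fun B hB => ?_⟩
  let τ : E → Vec (n + 1) := fun e => (e : Vec (n + 1)) + p0
  have hτ : Isometry τ := fun a b => by simp [τ, edist_add_right, Subtype.edist_eq]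
  have h1 : {w : Vec (n + 1) | ℓ w ∈ I ∧ (ℓ w)⁻¹ • w ∈ B} = π ⁻¹' (τ ⁻¹' B) ∩ ℓ ⁻¹' I := by
    ext w
    simp only [Set.mem_ofPred_eq, Set.mem_inter_iff, Set.mem_preimage, τ]
    rw [and_comm]
    refine and_congr_left fun hw => ?_
    rw [hπ w hw]
  have hτB : MeasurableSet (τ ⁻¹' B) := hτ.continuous.measurable hB
  have h2 : volume {w : Vec (n + 1) | ℓ w ∈ I ∧ (ℓ w)⁻¹ • w ∈ B} = m (τ ⁻¹' B) := by
    rw [h1, hm, Measure.map_apply hπm hτB, hκ, Measure.restrict_apply (hπm hτB)]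
  have h4 := congrArg (fun μ => μ (τ ⁻¹' B)) heq
  rw [h2, h4]
  have h3 : B ∩ {w | ℓ w = 1} = τ '' (τ ⁻¹' B) := by
    rw [Set.image_preimage_eq_inter_range]
    congr 1
    ext w
    simp only [Set.mem_ofPred_eq, Set.mem_range, τ]
    constructor
    · intro hw
      exact ⟨Pr w, by rw [hPr w hw, sub_add_cancel]⟩
    · rintro ⟨e, rfl⟩
      rw [map_add, (memE e).1 e.2, ℓp0, zero_add]
  rw [h3, surfaceMeasure, hτ.hausdorffMeasure_image (Or.inl (by simp))]
  simp only [Nat.cast_add, Nat.cast_one, add_sub_cancel_right]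
  rfl

/-- The linear isometry of `ℝ^d` changing the sign of the coordinates where `s` is `false`. -/
noncomputable def flip {d : ℕ} (s : Fin d → Bool) : Vec d ≃ₗᵢ[ℝ] Vec d :=
  LinearIsometryEquiv.piLpCongrRight 2
    (fun i => if s i then LinearIsometryEquiv.refl ℝ ℝ else LinearIsometryEquiv.neg ℝ)

theorem flip_apply {d : ℕ} (s : Fin d → Bool) (w : Vec d) (i : Fin d) :
    flip s w i = if s i then w i else -w i := by
  rw [flip, LinearIsometryEquiv.piLpCongrRight_apply]
  by_cases h : s i = true <;> simp [h]

theorem ellNorm_one_flip {d : ℕ} (s : Fin d → Bool) (w : Vec d) :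
    ellNorm 1 (flip s w) = ellNorm 1 w := by
  rw [ellNorm_one, ellNorm_one]
  refine Finset.sum_congr rfl fun i _ => ?_
  rw [flip_apply]; split_ifs <;> simp

/-- The pattern of signs of a vector, zero counting as positive. -/
noncomputable def signPattern {d : ℕ} (w : Vec d) : Fin d → Bool := fun i => decide (0 ≤ w i)

theorem measurable_signPattern {d : ℕ} : Measurable (signPattern : Vec d → Fin d → Bool) := by
  refine measurable_pi_lambda _ fun i => ?_
  have : MeasurableSet {w : Vec d | 0 ≤ w i} :=
    measurableSet_le measurable_const (by fun_prop)
  refine measurable_to_bool ?_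
  convert this using 1
  ext w
  simp [signPattern]

theorem signPattern_smul {d : ℕ} {c : ℝ} (hc : 0 < c) (w : Vec d) :
    signPattern (c • w) = signPattern w := by
  funext i
  simp [signPattern, mul_nonneg_iff_of_pos_left hc]

/-- If `flip s` maps `w` to a vector of sign pattern `s`, then all coordinates of `w` are nonnegative. -/
theorem coordSum_of_signPattern {d : ℕ} {s : Fin d → Bool} {w : Vec d}
    (h : signPattern (flip s w) = s) : coordSum d w = ellNorm 1 w := by
  rw [coordSum_apply, ellNorm_one]
  refine Finset.sum_congr rfl fun i _ => (abs_of_nonneg ?_).symm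
  have := congrFun h i
  simp only [signPattern, flip_apply] at this
  cases hs : s i <;> simp [hs] at this <;> linarith

theorem measurable_radialProj {d : ℕ} : Measurable fun w : Vec d => (ellNorm 1 w)⁻¹ • w :=
  (measurable_ellNorm 1).inv.smul measurable_id

/-- The measure of the cone over a part `A` of the `ℓ_1`-sphere is proportional to the surface measure
of `A`. The orthants are reduced to the positive one by isometries. -/
theorem cone_measure_eq_of_pos {n : ℕ} {I : Set ℝ} (hI : MeasurableSet I) (hIpos : I ⊆ Set.Ioi 0)
    (hIb : Bornology.IsBounded I) : ∃ c : NNReal, ∀ A : Set (Vec (n + 1)), MeasurableSet A →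
      volume {w : Vec (n + 1) | ellNorm 1 w ∈ I ∧ (ellNorm 1 w)⁻¹ • w ∈ A} =
        c * surfaceMeasure (n + 1) (A ∩ l1Sphere (n + 1)) := by
  obtain ⟨c, hc⟩ := hyperplane_measure_eq (n := n) hI hIpos hIb
  refine ⟨c, fun A hA => ?_⟩
  have hsum : ∀ (μ : Measure (Vec (n + 1))) (Z : Set (Vec (n + 1))),
      μ Z = ∑ s, μ (signPattern ⁻¹' {s} ∩ Z) := by
    intro μ Z
    have h := sum_measure_preimage_singleton (μ := μ.restrict Z)
      (f := (signPattern : Vec (n + 1) → Fin (n + 1) → Bool)) Finset.univ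
      fun s _ => measurable_signPattern (measurableSet_singleton s)
    simp only [Finset.coe_univ, Set.preimage_univ, Measure.restrict_apply_univ] at h
    rw [← h]
    exact Finset.sum_congr rfl fun s _ =>
      Measure.restrict_apply (measurable_signPattern (measurableSet_singleton s))
  rw [hsum volume, hsum (surfaceMeasure (n + 1)), Finset.mul_sum]
  refine Finset.sum_congr rfl fun s _ => ?_
  set Q : Set (Vec (n + 1)) := signPattern ⁻¹' {s} with hQ
  have hQm : MeasurableSet Q := measurable_signPattern (measurableSet_singleton s)
  have hTm : Measurable (flip s) := (flip s).continuous.measurable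
  have e1 : flip s ⁻¹' (Q ∩ {w | ellNorm 1 w ∈ I ∧ (ellNorm 1 w)⁻¹ • w ∈ A}) =
      {w : Vec (n + 1) | coordSum _ w ∈ I ∧ (coordSum _ w)⁻¹ • w ∈ flip s ⁻¹' (Q ∩ A)} := by
    ext w
    simp only [Set.mem_preimage, Set.mem_inter_iff, Set.mem_ofPred_eq, hQ, Set.mem_singleton_iff,
      ellNorm_one_flip, map_smul]
    constructor
    · rintro ⟨h1, h2, h3⟩
      rw [coordSum_of_signPattern h1]
      exact ⟨h2, by rw [signPattern_smul (inv_pos.2 (hIpos h2)), h1], h3⟩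
    · rintro ⟨h1, h2, h3⟩
      rw [signPattern_smul (inv_pos.2 (hIpos h1))] at h2
      rw [coordSum_of_signPattern h2] at h1 h3
      exact ⟨h2, h1, h3⟩
  have e2 : flip s ⁻¹' (Q ∩ A) ∩ {w | coordSum _ w = 1} =
      flip s ⁻¹' (Q ∩ (A ∩ l1Sphere (n + 1))) := by
    ext w
    simp only [Set.mem_preimage, Set.mem_inter_iff, Set.mem_ofPred_eq, hQ, Set.mem_singleton_iff,
      l1Sphere, ellNorm_one_flip]
    rw [and_assoc]
    refine and_congr_right fun h1 => and_congr_right fun _ => ?_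
    rw [coordSum_of_signPattern h1]
  have hZm : MeasurableSet {w : Vec (n + 1) | ellNorm 1 w ∈ I ∧ (ellNorm 1 w)⁻¹ • w ∈ A} :=
    (measurable_ellNorm 1 hI).inter (measurable_radialProj hA)
  rw [← (flip s).measurePreserving.measure_preimage (hQm.inter hZm).nullMeasurableSet, e1,
    hc _ (hTm (hQm.inter hA)), e2, surfaceMeasure]
  congr 1
  exact (flip s).toIsometryEquiv.hausdorffMeasure_preimage _ _

theorem cone_measure_eq {d : ℕ} (hd : d ≠ 0) {I : Set ℝ} (hI : MeasurableSet I)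
    (hIb : Bornology.IsBounded I) : ∃ c : NNReal, ∀ A : Set (Vec d), MeasurableSet A →
      volume {w : Vec d | ellNorm 1 w ∈ I ∧ (ellNorm 1 w)⁻¹ • w ∈ A} =
        c * surfaceMeasure d (A ∩ l1Sphere d) := by
  obtain ⟨n, rfl⟩ := Nat.exists_eq_succ_of_ne_zero hd
  obtain ⟨c, hc⟩ := cone_measure_eq_of_pos (n := n) (hI.inter measurableSet_Ioi)
    Set.inter_subset_right (hIb.subset Set.inter_subset_left)
  refine ⟨c, fun A hA => ?_⟩
  rw [← hc A hA]
  refine measure_congr ?_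
  have h0 : ∀ᵐ w : Vec (n + 1), w ≠ 0 := Measure.ae_ne volume 0
  filter_upwards [h0] with w hw
  have : 0 < ellNorm 1 w := (norm_pos_iff.2 hw).trans_le (norm_le_ellNorm_one w)
  refine propext ?_
  show (_ ∧ _) ↔ ((_ ∧ _) ∧ _)
  simp [this]

/-- The law of a uniform random vector on the `ℓ_1`-sphere. -/
noncomputable abbrev sphereLaw (d : ℕ) : Measure (Vec d) :=
  ProbabilityTheory.cond (surfaceMeasure d) (l1Sphere d)

/-- The image of the Lebesgue measure under the `ℓ_1`-norm. -/
noncomputable def radialMeasure (d : ℕ) : Measure ℝ := (volume : Measure (Vec d)).map (ellNorm 1)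

theorem radialMeasure_lt_top {d : ℕ} {I : Set ℝ} (hI : MeasurableSet I)
    (hIb : Bornology.IsBounded I) : radialMeasure d I < ⊤ := by
  obtain ⟨M, hM⟩ := hIb.exists_norm_le
  rw [radialMeasure, Measure.map_apply (measurable_ellNorm 1) hI]
  refine (measure_mono (t := Metric.closedBall 0 M) fun w hw => ?_).trans_lt
    measure_closedBall_lt_top
  rw [mem_closedBall_zero_iff]
  exact (norm_le_ellNorm_one w).trans ((le_abs_self _).trans (hM _ hw))

instance {d : ℕ} : SigmaFinite (radialMeasure d) :=
  ⟨⟨{ set := fun n : ℕ => Metric.closedBall 0 n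
      set_mem := fun _ => trivial
      finite := fun _ =>
        radialMeasure_lt_top Metric.isClosed_closedBall.measurableSet Metric.isBounded_closedBall
      spanning := Metric.iUnion_closedBall_nat 0 }⟩⟩

/-- Polar coordinates: the `ℓ_1`-norm and the projection to the `ℓ_1`-sphere are independent under
the Lebesgue measure, and the latter is distributed as the normalized surface measure. -/
theorem map_polar {d : ℕ} (hd : d ≠ 0) [hν : IsProbabilityMeasure (sphereLaw d)] :
    (volume : Measure (Vec d)).map (fun w => (ellNorm 1 w, (ellNorm 1 w)⁻¹ • w)) =
      (radialMeasure d).prod (sphereLaw d) := by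
  have hne : surfaceMeasure d (l1Sphere d) ≠ 0 := fun h => by
    have := hν.measure_univ
    rw [sphereLaw, ProbabilityTheory.cond_eq_zero_of_meas_eq_zero h] at this
    simp at this
  have hnt : surfaceMeasure d (l1Sphere d) ≠ ⊤ := fun h => by
    have := hν.measure_univ
    simp [sphereLaw, ProbabilityTheory.cond, h] at this
  have hS : MeasurableSet (l1Sphere d) := measurable_ellNorm 1 (measurableSet_singleton 1)
  refine (Measure.prod_eq fun I A hI hA => ?_).symm
  have hpm : Measurable fun w : Vec d => (ellNorm 1 w, (ellNorm 1 w)⁻¹ • w) :=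
    (measurable_ellNorm 1).prodMk measurable_radialProj
  set pr : Vec d → Vec d := fun w => (ellNorm 1 w)⁻¹ • w with hpr
  -- for fixed `A` the two sides are compared as measures in `I`, on bounded sets first
  let μ₁ : Measure ℝ := (volume.restrict (pr ⁻¹' A)).map (ellNorm 1)
  have hμ₁ : ∀ J, MeasurableSet J → μ₁ J = volume {w : Vec d | ellNorm 1 w ∈ J ∧ pr w ∈ A} := by
    intro J hJ
    rw [Measure.map_apply (measurable_ellNorm 1) hJ,
      Measure.restrict_apply (measurable_ellNorm 1 hJ)]
    rfl
  have hbdd : ∀ J, MeasurableSet J → Bornology.IsBounded J →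
      μ₁ J = sphereLaw d A * radialMeasure d J := by
    intro J hJ hJb
    obtain ⟨c, hc⟩ := cone_measure_eq hd hJ hJb
    have h2 := hc _ MeasurableSet.univ
    simp only [Set.mem_univ, and_true, Set.univ_inter] at h2
    have h3 : radialMeasure d J = c * surfaceMeasure d (l1Sphere d) := by
      rw [radialMeasure, Measure.map_apply (measurable_ellNorm 1) hJ, ← h2]; rfl
    rw [hμ₁ J hJ, hc A hA, h3, ProbabilityTheory.cond_apply hS, Set.inter_comm A]
    calc _ = (surfaceMeasure d (l1Sphere d))⁻¹ * surfaceMeasure d (l1Sphere d) *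
          (c * surfaceMeasure d (l1Sphere d ∩ A)) := by
            rw [ENNReal.inv_mul_cancel hne hnt, one_mul]
      _ = _ := by ring
  have hall : μ₁ = sphereLaw d A • radialMeasure d := by
    refine (Measure.ext_iff_of_iUnion_eq_univ
      (s := fun n : ℕ => Metric.closedBall (0 : ℝ) n) (Metric.iUnion_closedBall_nat 0)).2 fun n => ?_
    ext J hJ
    rw [Measure.restrict_apply hJ, Measure.restrict_apply hJ,
      hbdd _ (hJ.inter Metric.isClosed_closedBall.measurableSet)
        (Metric.isBounded_closedBall.subset Set.inter_subset_right)]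
    simp
  rw [Measure.map_apply hpm (hI.prod hA), mul_comm]
  have := congrArg (fun μ => μ I) hall
  simp only [hμ₁ I hI, Measure.smul_apply, smul_eq_mul] at this
  rw [← this]
  rfl

/-! ### Radial integrals and the Laplace distribution -/

/-- Radial integrals: the image of the Lebesgue measure under the `ℓ_1`-norm has a density
proportional to `r^(d-1)`. -/
theorem exists_radialMeasure_integral {d : ℕ} (hd : d ≠ 0) : ∃ C : ℝ, 0 < C ∧
    ∀ g : ℝ → ℝ, Measurable g →
      (∫ r, g r ∂(radialMeasure d) = C * ∫ r in Set.Ioi 0, r ^ (d - 1) * g r) ∧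
      (Integrable g (radialMeasure d) ↔ IntegrableOn (fun r => r ^ (d - 1) * g r) (Set.Ioi 0)) := by
  let F : Type := PiLp 1 (fun _ : Fin d => ℝ)
  let e : Vec d ≃L[ℝ] F := (PiLp.continuousLinearEquiv 2 ℝ (fun _ : Fin d => ℝ)).trans
    (PiLp.continuousLinearEquiv 1 ℝ (fun _ : Fin d => ℝ)).symm
  let μ : Measure F := (volume : Measure (Vec d)).map e
  have hμ : μ.IsAddHaarMeasure := e.isAddHaarMeasure_map volume
  have hn : ∀ w, ‖e w‖ = ellNorm 1 w := fun w => rfl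
  have : Nonempty (Fin d) := ⟨⟨0, Nat.pos_of_ne_zero hd⟩⟩
  have hnt : Nontrivial F := e.injective.nontrivial
  have hrank : Module.finrank ℝ F = d := by
    rw [← e.toLinearEquiv.finrank_eq]; simp
  have hem : Measurable e := e.continuous.measurable
  have hmap : radialMeasure d = μ.map norm := by
    rw [Measure.map_map measurable_norm hem]; rfl
  refine ⟨d * μ.real (Metric.ball 0 1), ?_, fun g hg => ⟨?_, ?_⟩⟩
  · have : 0 < μ.real (Metric.ball 0 1) :=
      ENNReal.toReal_pos (Metric.measure_ball_pos μ 0 one_pos).ne' measure_ball_lt_top.ne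
    positivity
  · rw [hmap, integral_map measurable_norm.aemeasurable hg.aestronglyMeasurable,
      integral_fun_norm_addHaar μ g, hrank]
    simp [mul_assoc]
  · rw [hmap, integrable_map_measure hg.aestronglyMeasurable measurable_norm.aemeasurable]
    have := integrable_fun_norm_addHaar μ (f := g)
    rw [hrank] at this
    simpa [Function.comp_def] using this

theorem ae_ne_zero {d : ℕ} (hd : d ≠ 0) : ∀ᵐ w : Vec d, w ≠ 0 := by
  have : Nonempty (Fin d) := ⟨⟨0, Nat.pos_of_ne_zero hd⟩⟩
  exact Measure.ae_ne volume 0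

theorem ellNorm_one_pos {d : ℕ} {w : Vec d} (hw : w ≠ 0) : 0 < ellNorm 1 w :=
  (norm_pos_iff.2 hw).trans_le (norm_le_ellNorm_one w)

/-- Integration in polar coordinates of a positively homogeneous function times a radial one. -/
theorem integral_radial_mul_homogeneous {d : ℕ} (hd : d ≠ 0)
    [IsProbabilityMeasure (sphereLaw d)] {k : ℝ → ℝ} (hk : Measurable k) {φ : Vec d → ℝ}
    (hφ : Measurable φ) (j : ℕ) (hom : ∀ c : ℝ, 0 < c → ∀ w, φ (c • w) = c ^ j * φ w) :
    ∫ w, k (ellNorm 1 w) * φ w = (∫ r, k r * r ^ j ∂(radialMeasure d)) * ∫ u, φ u ∂(sphereLaw d) := by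
  have h1 : ∫ w, k (ellNorm 1 w) * φ w =
      ∫ w : Vec d, (fun z : ℝ × Vec d => (k z.1 * z.1 ^ j) * φ z.2)
        (ellNorm 1 w, (ellNorm 1 w)⁻¹ • w) := by
    refine integral_congr_ae ?_
    filter_upwards [ae_ne_zero hd] with w hw
    have h0 := ellNorm_one_pos hw
    show _ = k _ * _ ^ j * φ _
    rw [hom _ (inv_pos.2 h0), inv_pow]
    field_simp
  have hm : Measurable fun z : ℝ × Vec d => (k z.1 * z.1 ^ j) * φ z.2 := by fun_prop
  have hp : Measurable fun w : Vec d => (ellNorm 1 w, (ellNorm 1 w)⁻¹ • w) :=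
    (measurable_ellNorm 1).prodMk measurable_radialProj
  rw [h1, ← integral_map hp.aemeasurable hm.aestronglyMeasurable, map_polar hd,
    integral_prod_mul (fun r => k r * r ^ j) φ]

/-- The Laplace distribution, with density `exp (-|x|) / 2`. -/
noncomputable def laplace : Measure ℝ :=
  volume.withDensity fun x => ENNReal.ofReal (Real.exp (-|x|) / 2)

theorem integral_exp_neg_abs_mul (g : ℝ → ℝ) :
    ∫ x, Real.exp (-|x|) / 2 * g |x| = ∫ x in Set.Ioi 0, Real.exp (-x) * g x := by
  rw [integral_comp_abs (f := fun x => Real.exp (-x) / 2 * g x), ← integral_const_mul]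
  exact integral_congr_ae (.of_forall fun x => by simp only []; ring)

theorem integral_laplace (g : ℝ → ℝ) : ∫ x, g x ∂laplace = ∫ x, Real.exp (-|x|) / 2 * g x := by
  rw [laplace, integral_withDensity_eq_integral_toReal_smul (by fun_prop) (by simp)]
  refine integral_congr_ae (.of_forall fun x => ?_)
  simp only [smul_eq_mul]
  rw [ENNReal.toReal_ofReal (by positivity)]

theorem integrable_laplace_iff {g : ℝ → ℝ} :
    Integrable g laplace ↔ Integrable fun x => Real.exp (-|x|) / 2 * g x := by
  rw [laplace, integrable_withDensity_iff_integrable_smul' (by fun_prop) (by simp)]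
  refine integrable_congr (.of_forall fun x => ?_)
  simp only [smul_eq_mul]
  rw [ENNReal.toReal_ofReal (by positivity)]

theorem integral_laplace_abs_rpow {s : ℝ} (hs : 0 ≤ s) :
    ∫ x, |x| ^ s ∂laplace = Real.Gamma (s + 1) := by
  rw [integral_laplace, integral_exp_neg_abs_mul (fun x => x ^ s),
    Real.Gamma_eq_integral (by linarith)]
  simp

theorem integrable_laplace_abs_rpow {s : ℝ} (hs : 0 ≤ s) :
    Integrable (fun x => |x| ^ s) laplace := by
  by_contra h
  have h1 := integral_laplace_abs_rpow hs
  rw [integral_undef h] at h1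
  exact (Real.Gamma_pos_of_pos (by linarith : (0 : ℝ) < s + 1)).ne h1

instance : IsProbabilityMeasure laplace := by
  have h := integral_laplace_abs_rpow le_rfl
  have h' : laplace.real Set.univ = 1 := by simpa using h
  exact ⟨by rwa [Measure.real, ENNReal.toReal_eq_one_iff] at h'⟩

/-- The density of a random vector with independent Laplace coordinates. -/
theorem pi_laplace_eq (d : ℕ) : Measure.pi (fun _ : Fin d => laplace) =
    volume.withDensity fun x => ENNReal.ofReal (∏ i, (Real.exp (-|x i|) / 2)) := by
  have hint : Integrable fun x : ℝ => Real.exp (-|x|) / 2 := by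
    simpa using integrable_laplace_iff.1 (integrable_const (1 : ℝ))
  refine Measure.pi_eq fun s hs => ?_
  have h1 : ∀ i, laplace (s i) =
      ENNReal.ofReal (∫ x, (s i).indicator (fun x => Real.exp (-|x|) / 2) x) := fun i => by
    rw [ofReal_integral_eq_lintegral_ofReal (hint.indicator (hs i))
      (.of_forall fun x => Set.indicator_nonneg (fun _ _ => by positivity) x), laplace,
      withDensity_apply _ (hs i), ← lintegral_indicator (hs i)]
    refine lintegral_congr fun x => ?_
    by_cases hx : x ∈ s i <;> simp [hx]
  have hint' : Integrable fun x : Fin d → ℝ =>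
      ∏ i, (s i).indicator (fun x => Real.exp (-|x|) / 2) (x i) :=
    Integrable.fintype_prod (μ := fun _ => volume) fun i => hint.indicator (hs i)
  simp_rw [h1]
  rw [← ENNReal.ofReal_prod_of_nonneg fun i _ => integral_nonneg fun x =>
      Set.indicator_nonneg (fun _ _ => by positivity) x,
    ← integral_fintype_prod_volume_eq_prod,
    ofReal_integral_eq_lintegral_ofReal
      hint'
      (.of_forall fun x => Finset.prod_nonneg fun i _ =>
        Set.indicator_nonneg (fun _ _ => by positivity) _),
    withDensity_apply _ (MeasurableSet.univ_pi hs),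
    ← lintegral_indicator (MeasurableSet.univ_pi hs)]
  refine lintegral_congr fun x => ?_
  by_cases hx : x ∈ Set.univ.pi s
  · rw [Set.indicator_of_mem hx]
    congr 1
    exact Finset.prod_congr rfl fun i _ => by rw [Set.indicator_of_mem (hx i trivial)]
  · rw [Set.indicator_of_notMem hx]
    simp only [Set.mem_univ_pi, not_forall] at hx
    obtain ⟨i, hi⟩ := hx
    rw [Finset.prod_eq_zero (Finset.mem_univ i) (Set.indicator_of_notMem hi _)]
    simp

theorem integral_pi_laplace {d : ℕ} (g : Vec d → ℝ) :
    ∫ x, g (WithLp.toLp 2 x) ∂(Measure.pi fun _ : Fin d => laplace) =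
      (1 / 2) ^ d * ∫ w, Real.exp (-ellNorm 1 w) * g w := by
  rw [pi_laplace_eq, integral_withDensity_eq_integral_toReal_smul (by fun_prop) (by simp),
    ← (EuclideanSpace.volume_preserving_symm_measurableEquiv_toLp (Fin d)).symm.integral_comp',
    ← integral_const_mul]
  refine integral_congr_ae (.of_forall fun x => ?_)
  simp only [smul_eq_mul]
  rw [ENNReal.toReal_ofReal (by positivity), Finset.prod_div_distrib, ← Real.exp_sum,
    Finset.sum_neg_distrib]
  simp [ellNorm_one]
  ring

/-- Laplace expectations of positively homogeneous functions. -/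
theorem integral_pi_laplace_homogeneous {d : ℕ} (hd : d ≠ 0)
    [IsProbabilityMeasure (sphereLaw d)] {φ : Vec d → ℝ}
    (hφ : Measurable φ) (j : ℕ) (hom : ∀ c : ℝ, 0 < c → ∀ w, φ (c • w) = c ^ j * φ w) :
    ∫ x, φ (WithLp.toLp 2 x) ∂(Measure.pi fun _ : Fin d => laplace) =
      Real.Gamma (d + j) / Real.Gamma d * ∫ u, φ u ∂(sphereLaw d) := by
  obtain ⟨C, hC, hrad⟩ := exists_radialMeasure_integral hd
  have hd0 : (0 : ℝ) < d := by exact_mod_cast Nat.pos_of_ne_zero hd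
  have hG : ∀ j : ℕ, ∫ r, Real.exp (-r) * r ^ j ∂(radialMeasure d) = C * Real.Gamma (d + j) := by
    intro j
    rw [(hrad _ (by fun_prop)).1, Real.Gamma_eq_integral (by positivity)]
    congr 1
    refine setIntegral_congr_fun measurableSet_Ioi fun r hr => ?_
    have hr' : (0 : ℝ) < r := hr
    rw [show (d : ℝ) + j - 1 = ((d - 1 : ℕ) : ℝ) + (j : ℕ) by
      rw [Nat.cast_sub (by omega)]; push_cast; ring, Real.rpow_add hr', Real.rpow_natCast,
      Real.rpow_natCast]
    ring
  have h1 := integral_pi_laplace (d := d) fun _ => 1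
  have h2 := integral_radial_mul_homogeneous hd (k := fun r => Real.exp (-r)) (by fun_prop)
    (φ := fun _ => 1) (by fun_prop) 0 (by simp)
  rw [h2, hG] at h1
  rw [integral_pi_laplace, integral_radial_mul_homogeneous hd (k := fun r => Real.exp (-r))
    (by fun_prop) hφ j hom, hG]
  simp only [integral_const, probReal_univ, smul_eq_mul, mul_one, Nat.cast_zero, add_zero] at h1
  have hΓ := Real.Gamma_pos_of_pos hd0
  have h3 : (1 / 2 : ℝ) ^ d * C = 1 / Real.Gamma d := by
    field_simp
    field_simp at h1
    linarith
  linear_combination (Real.Gamma (d + j) * ∫ u, φ u ∂(sphereLaw d)) * h3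

/-! ### The Poincaré inequality for the Laplace distribution -/

theorem integrableOn_exp_neg_mul_pow (j : ℕ) :
    IntegrableOn (fun x : ℝ => Real.exp (-x) * x ^ j) (Set.Ioi 0) := by
  have h := Real.GammaIntegral_convergent (s := j + 1) (by positivity)
  simpa [Real.rpow_natCast] using h

/-- Hardy's inequality on the half-line with exponential weight. -/
theorem integral_exp_neg_mul_sq_le {K : NNReal} {v : ℝ → ℝ} (hv : LipschitzWith K v)
    (hv0 : v 0 = 0) :
    ∫ x in Set.Ioi 0, Real.exp (-x) * v x ^ 2 ≤
      4 * ∫ x in Set.Ioi 0, Real.exp (-x) * deriv v x ^ 2 := by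
  have hvb : ∀ x, |v x| ≤ K * |x| := fun x => by
    simpa [hv0, Real.dist_eq] using hv.dist_le_mul x 0
  have hdb : ∀ x, |deriv v x| ≤ K := fun x => norm_deriv_le_of_lipschitz hv
  have i1 : IntegrableOn (fun x => Real.exp (-x) * v x ^ 2) (Set.Ioi 0) := by
    refine ((integrableOn_exp_neg_mul_pow 2).const_mul (K ^ 2 : ℝ)).mono'
      (by have := hv.continuous; fun_prop) (.of_forall fun x => ?_)
    have h2 := pow_le_pow_left₀ (abs_nonneg _) (hvb x) 2
    rw [sq_abs, mul_pow, sq_abs] at h2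
    rw [Real.norm_of_nonneg (by positivity)]
    have := Real.exp_pos (-x)
    nlinarith
  have i2 : IntegrableOn (fun x => Real.exp (-x) * deriv v x ^ 2) (Set.Ioi 0) := by
    refine ((integrableOn_exp_neg_mul_pow 0).const_mul (K ^ 2 : ℝ)).mono'
      (by have := measurable_deriv v; fun_prop) (.of_forall fun x => ?_)
    have h2 := pow_le_pow_left₀ (abs_nonneg _) (hdb x) 2
    rw [sq_abs] at h2
    rw [Real.norm_of_nonneg (by positivity)]
    have := Real.exp_pos (-x)
    nlinarith
  have i3 : IntegrableOn (fun x => Real.exp (-x) * (2 * deriv v x ^ 2 - v x ^ 2 / 2))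
      (Set.Ioi 0) := by
    refine ((i2.const_mul 2).sub (i1.const_mul (1 / 2))).congr (.of_forall fun x => ?_)
    simp only [Pi.sub_apply]; ring
  -- `v(N)² e^(-N) ≥ 0` is the integral of the derivative of `v² e^(-x)`
  have key : ∀ N : ℕ, 0 ≤ ∫ x in (0 : ℝ)..N, Real.exp (-x) * (2 * deriv v x ^ 2 - v x ^ 2 / 2) := by
    intro N
    have hN : (0 : ℝ) ≤ N := N.cast_nonneg
    have acv : AbsolutelyContinuousOnInterval v 0 N :=
      (hv.lipschitzOnWith).absolutelyContinuousOnInterval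
    have ace : AbsolutelyContinuousOnInterval (fun x => Real.exp (-x)) 0 N :=
      ContDiffOn.absolutelyContinuousOnInterval (by fun_prop)
    have h1 := (ace.fun_mul (acv.fun_mul acv)).integral_deriv_eq_sub
    have h2 : ∫ x in (0 : ℝ)..N, deriv (fun x => Real.exp (-x) * (v x * v x)) x ≤
        ∫ x in (0 : ℝ)..N, Real.exp (-x) * (2 * deriv v x ^ 2 - v x ^ 2 / 2) := by
      refine intervalIntegral.integral_mono_ae hN
        (ace.fun_mul (acv.fun_mul acv)).intervalIntegrable_deriv
        ((intervalIntegrable_iff_integrableOn_Ioc_of_le hN).2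
          (i3.mono_set Set.Ioc_subset_Ioi_self)) ?_
      filter_upwards [hv.ae_differentiableAt] with x hx
      have e1 : HasDerivAt (fun x => Real.exp (-x)) (-Real.exp (-x)) x := by
        simpa using (hasDerivAt_neg x).exp
      rw [(e1.fun_mul (hx.hasDerivAt.fun_mul hx.hasDerivAt)).deriv]
      have := Real.exp_pos (-x)
      -- `2 v v' ≤ 2 v'² + v² / 2`, so half of the term `-v²` of the derivative survives
      nlinarith [sq_nonneg (2 * deriv v x - v x)]
    refine le_trans ?_ h2
    rw [h1, hv0]
    have := Real.exp_pos (-(N : ℝ))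
    nlinarith [mul_self_nonneg (v N)]
  have lim := intervalIntegral_tendsto_integral_Ioi (μ := volume) 0 i3
    (tendsto_natCast_atTop_atTop (R := ℝ))
  have h0 := ge_of_tendsto' lim key
  have e : ∫ x in Set.Ioi 0, Real.exp (-x) * (2 * deriv v x ^ 2 - v x ^ 2 / 2) =
      2 * (∫ x in Set.Ioi 0, Real.exp (-x) * deriv v x ^ 2) -
        1 / 2 * ∫ x in Set.Ioi 0, Real.exp (-x) * v x ^ 2 := by
    rw [← integral_const_mul, ← integral_const_mul, ← integral_sub (i2.const_mul 2)
      (i1.const_mul (1 / 2))]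
    exact integral_congr_ae (.of_forall fun x => by simp only []; ring)
  rw [e] at h0
  linarith

theorem integral_eq_Ioi_add_Ioi {g : ℝ → ℝ} (hg : Integrable g) :
    ∫ x, g x = (∫ x in Set.Ioi 0, g x) + ∫ x in Set.Ioi 0, g (-x) := by
  have h := integral_comp_neg_Iic 0 fun x => g (-x)
  simp only [neg_neg, neg_zero] at h
  rw [← h, add_comm, ← setIntegral_union (Set.Iic_disjoint_Ioi le_rfl) measurableSet_Ioi
    hg.integrableOn hg.integrableOn, Set.Iic_union_Ioi, setIntegral_univ]

theorem memLp_id_laplace : MemLp (fun x : ℝ => x) 2 laplace := by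
  rw [memLp_two_iff_integrable_sq (by fun_prop)]
  simpa using integrable_laplace_abs_rpow (s := 2) (by norm_num)

/-- Hardy's inequality for the Laplace distribution. -/
theorem integral_laplace_sq_sub_le {K : NNReal} {u : ℝ → ℝ} (hu : LipschitzWith K u) :
    ∫ x, (u x - u 0) ^ 2 ∂laplace ≤ 4 * ∫ x, deriv u x ^ 2 ∂laplace := by
  have hv : LipschitzWith K fun x => u x - u 0 := by
    simpa using hu.sub (LipschitzWith.const (u 0))
  have hdb : ∀ x, |deriv u x| ≤ K := fun x => norm_deriv_le_of_lipschitz hu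
  have i1 : Integrable (fun x => (u x - u 0) ^ 2) laplace := by
    refine (memLp_id_laplace.integrable_sq.const_mul (K ^ 2 : ℝ)).mono'
      (by have := hu.continuous; fun_prop) (.of_forall fun x => ?_)
    have h1 : |u x - u 0| ≤ K * |x| := by simpa [Real.dist_eq] using hu.dist_le_mul x 0
    have h2 := pow_le_pow_left₀ (abs_nonneg _) h1 2
    rw [sq_abs, mul_pow, sq_abs] at h2
    rwa [Real.norm_of_nonneg (by positivity)]
  have i2 : Integrable (fun x => deriv u x ^ 2) laplace := by
    refine (integrable_const (K ^ 2 : ℝ)).mono'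
      (by have := measurable_deriv u; fun_prop) (.of_forall fun x => ?_)
    have h2 := pow_le_pow_left₀ (abs_nonneg _) (hdb x) 2
    rw [sq_abs] at h2
    rwa [Real.norm_of_nonneg (by positivity)]
  rw [integral_laplace, integral_laplace, integral_eq_Ioi_add_Ioi (integrable_laplace_iff.1 i1),
    integral_eq_Ioi_add_Ioi (integrable_laplace_iff.1 i2)]
  have h1 := integral_exp_neg_mul_sq_le hv (sub_self _)
  have h2 := integral_exp_neg_mul_sq_le (v := fun x => u (-x) - u 0) (K := K)
    (LipschitzWith.of_dist_le_mul fun x y => by simpa using hu.dist_le_mul (-x) (-y)) (by simp)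
  have e1 : ∀ x, deriv (fun x => u x - u 0) x = deriv u x := fun x => by simp
  have e2 : ∀ x, deriv (fun x => u (-x) - u 0) x ^ 2 = deriv u (-x) ^ 2 := fun x => by
    rw [deriv_sub_const_fun, deriv_comp_neg]; ring
  have conv : ∀ g : ℝ → ℝ, ∫ x in Set.Ioi 0, Real.exp (-|x|) / 2 * g x =
      1 / 2 * ∫ x in Set.Ioi 0, Real.exp (-x) * g x := fun g => by
    rw [← integral_const_mul]
    refine setIntegral_congr_fun measurableSet_Ioi fun x hx => ?_
    rw [abs_of_pos hx]; ring
  simp only [e1, e2] at h1 h2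
  simp only [abs_neg]
  rw [conv fun x => (u x - u 0) ^ 2, conv fun x => deriv u x ^ 2,
    conv fun x => (u (-x) - u 0) ^ 2, conv fun x => deriv u (-x) ^ 2]
  linarith

theorem memLp_pi_laplace_of_lipschitz {n : ℕ} {K : NNReal} {H : (Fin n → ℝ) → ℝ}
    (hH : LipschitzWith K H) : MemLp H 2 (Measure.pi fun _ : Fin n => laplace) := by
  have h1 : MemLp (fun x : Fin n → ℝ => |H 0| + K * ∑ i, |x i|) 2
      (Measure.pi fun _ : Fin n => laplace) := by
    have h2 : ∀ i, MemLp (fun x : Fin n → ℝ => |x i|) 2 (Measure.pi fun _ : Fin n => laplace) :=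
      fun i => (memLp_id_laplace.comp_measurePreserving
        (measurePreserving_eval (fun _ : Fin n => laplace) i)).abs
    have h3 : MemLp (fun x : Fin n → ℝ => ∑ i, |x i|) 2 (Measure.pi fun _ : Fin n => laplace) :=
      memLp_finsetSum _ fun i _ => h2 i
    exact (memLp_const (|H 0|)).add (h3.const_mul (K : ℝ))
  refine h1.mono' hH.continuous.aestronglyMeasurable (.of_forall fun x => ?_)
  have h2 : |H x - H 0| ≤ K * ‖x‖ := by simpa [dist_eq_norm] using hH.dist_le_mul x 0
  have h3 : ‖x‖ ≤ ∑ i, |x i| := by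
    rw [pi_norm_le_iff_of_nonneg (by positivity)]
    exact fun i => Finset.single_le_sum (f := fun i => |x i|) (fun _ _ => abs_nonneg _)
      (Finset.mem_univ i)
  have h4 : (K : ℝ) * ‖x‖ ≤ K * ∑ i, |x i| := by gcongr
  have h5 := abs_sub_abs_le_abs_sub (H x) (H 0)
  rw [Real.norm_eq_abs]
  linarith

theorem memLp_laplace_of_lipschitz {K : NNReal} {u : ℝ → ℝ}
    (hu : LipschitzWith K u) : MemLp u 2 laplace := by
  have h0 : MemLp (fun x : ℝ => |x|) 2 laplace := memLp_id_laplace.abs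
  refine ((memLp_const (|u 0|)).add (h0.const_mul (K : ℝ))).mono'
    hu.continuous.aestronglyMeasurable (.of_forall fun x => ?_)
  have h1 : |u x - u 0| ≤ K * |x| := by simpa [Real.dist_eq] using hu.dist_le_mul x 0
  have h5 := abs_sub_abs_le_abs_sub (u x) (u 0)
  simp only [Real.norm_eq_abs, Pi.add_apply]
  linarith

theorem sq_integral_le {α : Type*} [MeasurableSpace α] {μ : Measure α} [IsProbabilityMeasure μ]
    {u : α → ℝ} (hu : MemLp u 2 μ) : (∫ x, u x ∂μ) ^ 2 ≤ ∫ x, u x ^ 2 ∂μ := by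
  have h := variance_nonneg u μ
  rw [variance_eq_sub hu] at h
  simpa using h

/-- The variance is at most the second moment about any point. -/
theorem integral_sq_sub_sq_integral_le {α : Type*} [MeasurableSpace α] {μ : Measure α}
    [IsProbabilityMeasure μ] {u : α → ℝ} (hu : MemLp u 2 μ) (c : ℝ) :
    ∫ x, u x ^ 2 ∂μ - (∫ x, u x ∂μ) ^ 2 ≤ ∫ x, (u x - c) ^ 2 ∂μ := by
  have h1 := hu.integrable_sq
  have h2 := hu.integrable (by norm_num)
  have : ∫ x, (u x - c) ^ 2 ∂μ = ∫ x, u x ^ 2 ∂μ - 2 * c * ∫ x, u x ∂μ + c ^ 2 := by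
    have h3 : Integrable (fun x => 2 * c * u x) μ := h2.const_mul _
    have h4 : Integrable (fun x => u x ^ 2 - 2 * c * u x) μ := h1.sub h3
    calc ∫ x, (u x - c) ^ 2 ∂μ = ∫ x, (u x ^ 2 - 2 * c * u x + c ^ 2) ∂μ :=
          integral_congr_ae (.of_forall fun x => by ring)
      _ = _ := by
        rw [integral_add h4 (integrable_const _), integral_sub h1 h3, integral_const_mul]
        simp
  rw [this]
  nlinarith [sq_nonneg (∫ x, u x ∂μ - c)]

/-! ### The Poincaré inequality of the Laplace product measure -/

theorem measurePreserving_insertNth {n : ℕ} (i : Fin (n + 1)) :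
    MeasurePreserving (MeasurableEquiv.piFinSuccAbove (fun _ : Fin (n + 1) => ℝ) i).symm
      (laplace.prod (Measure.pi fun _ : Fin n => laplace))
      (Measure.pi fun _ : Fin (n + 1) => laplace) :=
  (measurePreserving_piFinSuccAbove (fun _ : Fin (n + 1) => laplace) i).symm

/-- Integration over the coordinate `i` first. -/
theorem integral_pi_laplace_succ {n : ℕ} (i : Fin (n + 1)) {g : (Fin (n + 1) → ℝ) → ℝ}
    (hg : Integrable g (Measure.pi fun _ : Fin (n + 1) => laplace)) :
    ∫ x, g x ∂(Measure.pi fun _ : Fin (n + 1) => laplace) =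
      ∫ y, ∫ a, g (i.insertNth a y) ∂laplace ∂(Measure.pi fun _ : Fin n => laplace) := by
  have h := measurePreserving_insertNth i
  rw [← h.integral_comp']
  have hi := (h.integrable_comp_emb (MeasurableEquiv.measurableEmbedding _)).2 hg
  exact integral_prod_symm _ hi

theorem integrable_integral_insertNth {n : ℕ} (i : Fin (n + 1)) {g : (Fin (n + 1) → ℝ) → ℝ}
    (hg : Integrable g (Measure.pi fun _ : Fin (n + 1) => laplace)) :
    Integrable (fun y => ∫ a, g (i.insertNth a y) ∂laplace) (Measure.pi fun _ : Fin n => laplace) := by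
  have h := measurePreserving_insertNth i
  have hi := (h.integrable_comp_emb (MeasurableEquiv.measurableEmbedding _)).2 hg
  exact hi.integral_prod_right

theorem lipschitzWith_insertNth_left {n : ℕ} (i : Fin (n + 1)) {K : NNReal}
    {H : (Fin (n + 1) → ℝ) → ℝ} (hH : LipschitzWith K H) (y : Fin n → ℝ) :
    LipschitzWith K fun a => H (i.insertNth a y) :=
  LipschitzWith.of_dist_le_mul fun a b => (hH.dist_le_mul _ _).trans_eq (by
    rw [Fin.dist_insertNth_insertNth, dist_self, max_eq_left dist_nonneg])

theorem lipschitzWith_insertNth_right {n : ℕ} (i : Fin (n + 1)) {K : NNReal}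
    {H : (Fin (n + 1) → ℝ) → ℝ} (hH : LipschitzWith K H) (a : ℝ) :
    LipschitzWith K fun y : Fin n → ℝ => H (i.insertNth a y) :=
  LipschitzWith.of_dist_le_mul fun x y => (hH.dist_le_mul _ _).trans_eq (by
    rw [Fin.dist_insertNth_insertNth, dist_self, max_eq_right dist_nonneg])

theorem lipschitzWith_update {n : ℕ} (i : Fin n) {K : NNReal} {H : (Fin n → ℝ) → ℝ}
    (hH : LipschitzWith K H) (c : ℝ) : LipschitzWith K fun x => H (Function.update x i c) :=
  LipschitzWith.of_dist_le_mul fun x y => (hH.dist_le_mul _ _).trans (by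
    gcongr
    refine (dist_pi_le_iff dist_nonneg).2 fun j => ?_
    rcases eq_or_ne j i with rfl | hj
    · simp
    · simpa [hj] using dist_le_pi_dist x y j)

theorem integrable_sq_sub_update {n : ℕ} (i : Fin n) {K : NNReal} {H : (Fin n → ℝ) → ℝ}
    (hH : LipschitzWith K H) : Integrable (fun x => (H x - H (Function.update x i 0)) ^ 2)
      (Measure.pi fun _ : Fin n => laplace) :=
  ((memLp_pi_laplace_of_lipschitz hH).sub
    (memLp_pi_laplace_of_lipschitz (lipschitzWith_update i hH 0))).integrable_sq

/-- The Efron–Stein inequality for products of Laplace distributions, the conditional variance in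
each coordinate being bounded by the second moment about the value at the median. -/
theorem efronStein_laplace {n : ℕ} {K : NNReal} {H : (Fin n → ℝ) → ℝ} (hH : LipschitzWith K H) :
    ∫ x, H x ^ 2 ∂(Measure.pi fun _ : Fin n => laplace) -
        (∫ x, H x ∂(Measure.pi fun _ : Fin n => laplace)) ^ 2 ≤
      ∑ i, ∫ x, (H x - H (Function.update x i 0)) ^ 2 ∂(Measure.pi fun _ : Fin n => laplace) := by
  induction n with
  | zero => simp [integral_unique]
  | succ n ih =>
    set P := Measure.pi fun _ : Fin n => laplace with hP
    have hL2 := memLp_pi_laplace_of_lipschitz hH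
    have hu : ∀ y, MemLp (fun a => H ((0 : Fin (n + 1)).insertNth a y)) 2 laplace := fun y =>
      memLp_laplace_of_lipschitz (lipschitzWith_insertNth_left 0 hH y)
    -- the average over the first coordinate is Lipschitz with the same constant
    set Hb : (Fin n → ℝ) → ℝ := fun y => ∫ a, H ((0 : Fin (n + 1)).insertNth a y) ∂laplace with hHb
    have hHbL : LipschitzWith K Hb := LipschitzWith.of_dist_le_mul fun y y' => by
      rw [dist_eq_norm, hHb]
      simp only
      rw [← integral_sub ((hu y).integrable (by norm_num)) ((hu y').integrable (by norm_num))]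
      refine (norm_integral_le_of_norm_le_const (C := K * dist y y') (.of_forall fun a => ?_)).trans
        (by simp)
      rw [← dist_eq_norm]
      exact (lipschitzWith_insertNth_right 0 hH a).dist_le_mul y y'
    have hHb2 := memLp_pi_laplace_of_lipschitz hHbL
    have ih' := ih hHbL
    have e1 := integral_pi_laplace_succ 0 hL2.integrable_sq
    have e2 := integral_pi_laplace_succ 0 (hL2.integrable (by norm_num))
    have i1 := integrable_integral_insertNth 0 hL2.integrable_sq
    rw [e1, e2, Fin.sum_univ_succ, integral_pi_laplace_succ 0 (integrable_sq_sub_update 0 hH)]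
    have a1 : ∫ y, (∫ a, H ((0 : Fin (n + 1)).insertNth a y) ^ 2 ∂laplace - Hb y ^ 2) ∂P ≤
        ∫ y, ∫ a, (H ((0 : Fin (n + 1)).insertNth a y) -
          H (Function.update ((0 : Fin (n + 1)).insertNth a y) 0 0)) ^ 2 ∂laplace ∂P := by
      refine integral_mono (i1.sub hHb2.integrable_sq)
        (integrable_integral_insertNth 0 (integrable_sq_sub_update 0 hH)) fun y => ?_
      have := integral_sq_sub_sq_integral_le (hu y) (H ((0 : Fin (n + 1)).insertNth 0 y))
      simpa [Fin.update_insertNth, hHb] using this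
    have a2 : ∀ i : Fin n, ∫ y, (Hb y - Hb (Function.update y i 0)) ^ 2 ∂P ≤
        ∫ x, (H x - H (Function.update x i.succ 0)) ^ 2
          ∂(Measure.pi fun _ : Fin (n + 1) => laplace) := by
      intro i
      rw [integral_pi_laplace_succ 0 (integrable_sq_sub_update i.succ hH)]
      refine integral_mono (integrable_sq_sub_update i hHbL)
        (integrable_integral_insertNth 0 (integrable_sq_sub_update i.succ hH)) fun y => ?_
      -- Jensen's inequality: averaging over the first coordinate decreases the squared increments
      have h1 := sq_integral_le ((hu y).sub (hu (Function.update y i 0)))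
      have h2 : ∫ a, ((fun a => H ((0 : Fin (n + 1)).insertNth a y)) -
          fun a => H ((0 : Fin (n + 1)).insertNth a (Function.update y i 0))) a ∂laplace =
          Hb y - Hb (Function.update y i 0) :=
        integral_sub ((hu _).integrable (by norm_num)) ((hu _).integrable (by norm_num))
      rw [h2] at h1
      refine h1.trans_eq (integral_congr_ae (.of_forall fun a => ?_))
      simp [Fin.insertNth_zero']
    rw [integral_sub i1 hHb2.integrable_sq] at a1
    have a3 := Finset.sum_le_sum fun i (_ : i ∈ Finset.univ) => a2 i
    linarith

/-- The Poincaré inequality for the product of Laplace distributions. -/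
theorem poincare_laplace {n : ℕ} {K : NNReal} {H : (Fin n → ℝ) → ℝ} (hH : LipschitzWith K H) :
    ∫ x, H x ^ 2 ∂(Measure.pi fun _ : Fin n => laplace) -
        (∫ x, H x ∂(Measure.pi fun _ : Fin n => laplace)) ^ 2 ≤
      4 * ∫ x, ∑ i, lineDeriv ℝ H x (Pi.single i 1) ^ 2
        ∂(Measure.pi fun _ : Fin n => laplace) := by
  have hi : ∀ i, Integrable (fun x => lineDeriv ℝ H x (Pi.single i 1) ^ 2)
      (Measure.pi fun _ : Fin n => laplace) := fun i => by
    refine (integrable_const ((K : ℝ) ^ 2)).mono'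
      ((measurable_lineDeriv hH.continuous).pow_const 2).aestronglyMeasurable
      (.of_forall fun x => ?_)
    have h := norm_lineDeriv_le_of_lipschitz ℝ hH (x₀ := x) (v := Pi.single i (1 : ℝ))
    rw [Pi.norm_single, norm_one, mul_one] at h
    rw [norm_pow]
    gcongr
  refine (efronStein_laplace hH).trans ?_
  rw [integral_finsetSum _ fun i _ => hi i, Finset.mul_sum]
  refine Finset.sum_le_sum fun i _ => ?_
  obtain ⟨m, rfl⟩ : ∃ m, n = m + 1 := ⟨n - 1, by have := i.pos; omega⟩
  rw [integral_pi_laplace_succ i (integrable_sq_sub_update i hH),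
    integral_pi_laplace_succ i (hi i), ← integral_const_mul]
  refine integral_mono (integrable_integral_insertNth i (integrable_sq_sub_update i hH))
    ((integrable_integral_insertNth i (hi i)).const_mul 4) fun y => ?_
  have h := integral_laplace_sq_sub_le (lipschitzWith_insertNth_left i hH y)
  have e : ∀ a, lineDeriv ℝ H (i.insertNth a y) (Pi.single i 1) =
      deriv (fun a => H (i.insertNth a y)) a := fun a => by
    rw [lineDeriv]
    have : ∀ t : ℝ, (i.insertNth a y + t • Pi.single i (1 : ℝ) : Fin (m + 1) → ℝ) =
        i.insertNth (a + t) y := fun t => by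
      ext j
      rcases Fin.eq_self_or_eq_succAbove i j with rfl | ⟨k, rfl⟩ <;> simp
    simp_rw [this]
    rw [deriv_comp_const_add (f := fun a => H (i.insertNth a y)), add_zero]
  simpa [Fin.update_insertNth, e] using h

/-! ### Variance of Lipschitz functions on the `ℓ_1`-sphere -/

theorem measurableSet_l1Sphere (d : ℕ) : MeasurableSet (l1Sphere d) :=
  measurable_ellNorm 1 (measurableSet_singleton 1)

theorem ae_sphereLaw_ellNorm_one (d : ℕ) : ∀ᵐ u ∂(sphereLaw d), ellNorm 1 u = 1 :=
  ProbabilityTheory.ae_cond_mem (measurableSet_l1Sphere d)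

theorem measurePreserving_neg_sphereLaw (d : ℕ) :
    MeasurePreserving (Neg.neg : Vec d → Vec d) (sphereLaw d) (sphereLaw d) := by
  refine ⟨measurable_neg, ?_⟩
  ext A hA
  rw [Measure.map_apply measurable_neg hA, ProbabilityTheory.cond_apply (measurableSet_l1Sphere d),
    ProbabilityTheory.cond_apply (measurableSet_l1Sphere d)]
  congr 1
  have e : l1Sphere d ∩ Neg.neg ⁻¹' A = LinearIsometryEquiv.neg ℝ ⁻¹' (l1Sphere d ∩ A) := by
    ext u
    simp [l1Sphere, ellNorm_neg]
  rw [e, surfaceMeasure]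
  exact (LinearIsometryEquiv.neg ℝ (E := Vec d)).toIsometryEquiv.hausdorffMeasure_preimage _ _

theorem integral_sphereLaw_of_odd {d : ℕ} {G : Vec d → ℝ} (hodd : ∀ u, G (-u) = -G u) :
    ∫ u, G u ∂(sphereLaw d) = 0 := by
  have h := (measurePreserving_neg_sphereLaw d).integral_comp
    (MeasurableEquiv.neg (Vec d)).measurableEmbedding G
  simp only [hodd, integral_neg] at h
  linarith

theorem ellNorm_one_le_sqrt_mul_norm {d : ℕ} (x : Vec d) : ellNorm 1 x ≤ √d * ‖x‖ := by
  have h := ellNorm_le_mul (r := 1) (q := 2) le_rfl (by norm_num) x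
  rw [ellNorm_two, recip_eq, recip_eq] at h
  rw [Real.sqrt_eq_rpow]
  norm_num at h ⊢
  exact h

/-- The extension of the restriction to the `ℓ_1`-sphere that is homogeneous of degree one. -/
noncomputable def homExt {d : ℕ} (G : Vec d → ℝ) (w : Vec d) : ℝ :=
  ellNorm 1 w * G ((ellNorm 1 w)⁻¹ • w)

theorem homExt_smul {d : ℕ} (G : Vec d → ℝ) {c : ℝ} (hc : 0 < c) (w : Vec d) :
    homExt G (c • w) = c * homExt G w := by
  unfold homExt
  rw [ellNorm_smul, abs_of_pos hc, smul_smul, mul_inv, mul_assoc]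
  congr 4
  field_simp

theorem homExt_neg {d : ℕ} {G : Vec d → ℝ} (hodd : ∀ u, G (-u) = -G u) (w : Vec d) :
    homExt G (-w) = -homExt G w := by
  unfold homExt
  rw [ellNorm_neg, smul_neg, hodd, mul_neg]

theorem ellNorm_one_nonneg {d : ℕ} (w : Vec d) : 0 ≤ ellNorm 1 w := ellNorm_nonneg 1 w

/-- The slope at `w` of the homogeneous extension of an odd Lipschitz function. -/
theorem abs_homExt_sub_le {d : ℕ} {G : Vec d → ℝ} {K : ℝ} (hK : 0 ≤ K)
    (hG : ∀ u v, |G u - G v| ≤ K * ‖u - v‖) (h0 : G 0 = 0) {w : Vec d} (hw : w ≠ 0) (w' : Vec d) :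
    |homExt G w' - homExt G w| ≤ K * (1 + 2 * √d * (‖w‖ / ellNorm 1 w)) * ‖w' - w‖ := by
  set r := ellNorm 1 w with hr
  set r' := ellNorm 1 w' with hr'
  have hr0 : 0 < r := ellNorm_one_pos hw
  have hr0' : 0 ≤ r' := ellNorm_one_nonneg w'
  have hrr : |r' - r| ≤ √d * ‖w' - w‖ := by
    refine le_trans ?_ (ellNorm_one_le_sqrt_mul_norm _)
    rw [abs_le]
    have h1 := ellNorm_add_le 1 (w' - w) w
    have h2 := ellNorm_add_le 1 (w - w') w'
    have h3 := ellNorm_neg 1 (w - w')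
    rw [sub_add_cancel] at h1 h2
    rw [neg_sub] at h3
    constructor <;> linarith
  have a1 : |r' * (G (r'⁻¹ • w') - G (r⁻¹ • w))| ≤ K * (‖w' - w‖ + |r' - r| * (‖w‖ / r)) := by
    rcases hr0'.eq_or_lt with h | h
    · rw [← h]; simp; positivity
    rw [abs_mul, abs_of_pos h]
    calc r' * |G (r'⁻¹ • w') - G (r⁻¹ • w)| ≤ r' * (K * ‖r'⁻¹ • w' - r⁻¹ • w‖) := by
          gcongr; exact hG _ _
      _ = K * ‖r' • (r'⁻¹ • w' - r⁻¹ • w)‖ := by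
          rw [norm_smul, Real.norm_of_nonneg hr0']; ring
      _ = K * ‖(w' - w) - ((r' - r) * r⁻¹) • w‖ := by
          congr 2
          rw [smul_sub, smul_smul, smul_smul, mul_inv_cancel₀ h.ne', one_smul, sub_mul,
            mul_inv_cancel₀ hr0.ne', sub_smul, one_smul]
          abel
      _ ≤ K * (‖w' - w‖ + ‖((r' - r) * r⁻¹) • w‖) := by gcongr; exact norm_sub_le _ _
      _ = _ := by
          rw [norm_smul, norm_mul, norm_inv, Real.norm_of_nonneg hr0.le, Real.norm_eq_abs]
          ring
  have a2 : |(r' - r) * G (r⁻¹ • w)| ≤ |r' - r| * (K * (‖w‖ / r)) := by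
    rw [abs_mul]
    gcongr
    have := hG (r⁻¹ • w) 0
    rw [h0, sub_zero, sub_zero, norm_smul, norm_inv, Real.norm_of_nonneg hr0.le] at this
    rwa [div_eq_inv_mul]
  have e : homExt G w' - homExt G w =
      r' * (G (r'⁻¹ • w') - G (r⁻¹ • w)) + (r' - r) * G (r⁻¹ • w) := by
    unfold homExt; ring
  rw [e]
  refine (abs_add_le _ _).trans ((add_le_add a1 a2).trans ?_)
  have h5 : |r' - r| * (K * (‖w‖ / r)) ≤ √d * ‖w' - w‖ * (K * (‖w‖ / r)) := by gcongr
  nlinarith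

/-- The Lipschitz constant, of order `√d`, only serves for integrability and differentiability. -/
theorem exists_lipschitzWith_homExt {d : ℕ} {G : Vec d → ℝ} {K : ℝ} (hK : 0 ≤ K)
    (hG : ∀ u v, |G u - G v| ≤ K * ‖u - v‖) (h0 : G 0 = 0) :
    ∃ C : NNReal, LipschitzWith C (homExt G) := by
  refine ⟨(K * (1 + 2 * √d)).toNNReal, LipschitzWith.of_dist_le_mul fun w' w => ?_⟩
  rw [Real.coe_toNNReal _ (by positivity), Real.dist_eq, dist_eq_norm]
  have main : ∀ w w' : Vec d, w ≠ 0 →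
      |homExt G w' - homExt G w| ≤ K * (1 + 2 * √d) * ‖w' - w‖ := by
    intro w w' hw
    refine (abs_homExt_sub_le hK hG h0 hw w').trans ?_
    have : ‖w‖ / ellNorm 1 w ≤ 1 :=
      div_le_one_of_le₀ (norm_le_ellNorm_one w) (ellNorm_one_nonneg w)
    have h2 : 2 * √d * (‖w‖ / ellNorm 1 w) ≤ 2 * √d := mul_le_of_le_one_right (by positivity) this
    exact mul_le_mul_of_nonneg_right (mul_le_mul_of_nonneg_left (by linarith) hK) (norm_nonneg _)
  rcases eq_or_ne w 0 with rfl | hw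
  · rcases eq_or_ne w' 0 with rfl | hw'
    · simp
    · rw [abs_sub_comm, norm_sub_rev]
      exact main w' 0 hw'
  · exact main w w' hw

/-- A pointwise bound on the slope in the Euclidean norm bounds the Euclidean norm of the gradient,
computed from partial derivatives. -/
theorem sum_lineDeriv_sq_le {d : ℕ} {H : Vec d → ℝ} {x : Fin d → ℝ}
    (hd : DifferentiableAt ℝ (fun x : Fin d → ℝ => H (WithLp.toLp 2 x)) x) {K : ℝ} (hK : 0 ≤ K)
    (hH : ∀ w', |H w' - H (WithLp.toLp 2 x)| ≤ K * ‖w' - WithLp.toLp 2 x‖) :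
    ∑ i, lineDeriv ℝ (fun x : Fin d → ℝ => H (WithLp.toLp 2 x)) x (Pi.single i 1) ^ 2 ≤ K ^ 2 := by
  set H0 := fun x : Fin d → ℝ => H (WithLp.toLp 2 x) with hH0
  set a : Fin d → ℝ := fun i => lineDeriv ℝ H0 x (Pi.single i 1) with ha
  -- the derivative of `H0` in the direction of its gradient `a`
  have hLa : lineDeriv ℝ H0 x a = ∑ i, a i ^ 2 := by
    rw [hd.lineDeriv_eq_fderiv]
    conv_lhs => rw [← Finset.univ_sum_single a, map_sum]
    refine Finset.sum_congr rfl fun i _ => ?_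
    have : (Pi.single i (a i) : Fin d → ℝ) = a i • Pi.single i 1 := by
      rw [← Pi.single_smul, smul_eq_mul, mul_one]
    rw [this, map_smul, ← hd.lineDeriv_eq_fderiv, smul_eq_mul, sq]
  have hder : HasDerivAt (fun t : ℝ => H0 (x + t • a)) (∑ i, a i ^ 2) 0 := by
    have := hd.hasFDerivAt.hasLineDerivAt a
    rw [← hd.lineDeriv_eq_fderiv, hLa] at this
    exact this
  set N := ‖(WithLp.toLp 2 a : Vec d)‖ with hN
  have hN2 : ∑ i, a i ^ 2 = N ^ 2 := by
    rw [hN, EuclideanSpace.norm_sq_eq]; simp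
  have hle : ‖∑ i, a i ^ 2‖ ≤ K * N := by
    refine hder.le_of_lip' (by positivity) (.of_forall fun t => ?_)
    have := hH (WithLp.toLp 2 (x + t • a))
    rw [← WithLp.toLp_sub, add_sub_cancel_left, WithLp.toLp_smul, norm_smul] at this
    simp only [hH0, zero_smul, add_zero, sub_zero, Real.norm_eq_abs] at this ⊢
    linarith
  rw [hN2, Real.norm_of_nonneg (by positivity)] at hle
  show ∑ i, a i ^ 2 ≤ K ^ 2
  rw [hN2]
  have hN0 : 0 ≤ N := norm_nonneg _
  have : N ≤ K := by
    rcases hN0.eq_or_lt with h | h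
    · rw [← h]; exact hK
    · nlinarith
  gcongr

/-- With `W` a vector of independent Laplace variables, `E‖W‖² = 2 d` is compared to
`E‖W‖_1² = d (d + 1)`. -/
theorem integral_sphereLaw_norm_sq {d : ℕ} (hd : d ≠ 0) [IsProbabilityMeasure (sphereLaw d)] :
    ∫ u, ‖u‖ ^ 2 ∂(sphereLaw d) = 2 / (d + 1) := by
  have h := integral_pi_laplace_homogeneous hd (φ := fun u : Vec d => ‖u‖ ^ 2) (by fun_prop) 2
    (fun c hc w => by rw [norm_smul, mul_pow, Real.norm_of_nonneg hc.le])
  have hd0 : (0 : ℝ) < d := by exact_mod_cast Nat.pos_of_ne_zero hd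
  have hΓ : Real.Gamma (d + (2 : ℕ)) = (d + 1) * (d * Real.Gamma d) := by
    rw [show (d : ℝ) + (2 : ℕ) = (d + 1) + 1 by push_cast; ring, Real.Gamma_add_one (by positivity),
      Real.Gamma_add_one (by positivity)]
  have hi : ∀ i : Fin d, MemLp (fun x : Fin d → ℝ => x i) 2 (Measure.pi fun _ => laplace) :=
    fun i => memLp_id_laplace.comp_measurePreserving
      (measurePreserving_eval (fun _ : Fin d => laplace) i)
  have hl : ∫ x : Fin d → ℝ, ‖(WithLp.toLp 2 x : Vec d)‖ ^ 2 ∂(Measure.pi fun _ => laplace) =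
      2 * d := by
    simp_rw [EuclideanSpace.norm_sq_eq, Real.norm_eq_abs, sq_abs]
    rw [integral_finsetSum _ fun i _ => (hi i).integrable_sq]
    have : ∀ i : Fin d, ∫ x : Fin d → ℝ, x i ^ 2 ∂(Measure.pi fun _ => laplace) = 2 := fun i => by
      rw [integral_comp_eval (μ := fun _ : Fin d => laplace) (i := i) (f := fun y : ℝ => y ^ 2)
        (by fun_prop)]
      have h2 := integral_laplace_abs_rpow (s := 2) (by norm_num)
      rw [show (2 : ℝ) + 1 = (2 : ℕ) + 1 by norm_num, Real.Gamma_nat_eq_factorial] at h2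
      simpa using h2
    simp [this]; ring
  rw [hl, hΓ] at h
  have := Real.Gamma_pos_of_pos hd0
  field_simp at h ⊢
  linarith

/-- The variance of an odd function that is Lipschitz for the Euclidean norm, under the uniform
distribution on the `ℓ_1`-sphere. -/
theorem integral_sphereLaw_sq_le {d : ℕ} (hd : d ≠ 0) [IsProbabilityMeasure (sphereLaw d)]
    {G : Vec d → ℝ} {K : ℝ} (hK : 0 ≤ K)
    (hG : ∀ u v, |G u - G v| ≤ K * ‖u - v‖) (hodd : ∀ u, G (-u) = -G u) :
    ∫ u, G u ^ 2 ∂(sphereLaw d) ≤ 4 * (1 + 2 * √2) ^ 2 * K ^ 2 / (d * (d + 1)) := by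
  have h0 : G 0 = 0 := by have := hodd 0; simp at this; linarith
  have hd0 : (0 : ℝ) < d := by exact_mod_cast Nat.pos_of_ne_zero hd
  obtain ⟨C, hC⟩ := exists_lipschitzWith_homExt hK hG h0
  have hCm : Measurable (homExt G) := hC.continuous.measurable
  have hL := hC.comp (PiLp.lipschitzWith_toLp 2 (fun _ : Fin d => ℝ))
  have hP := poincare_laplace hL
  simp only [Function.comp_def] at hP
  have hsph : ∀ᵐ u ∂(sphereLaw d), homExt G u = G u := by
    filter_upwards [ae_sphereLaw_ellNorm_one d] with u hu
    rw [homExt, hu]; simp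
  have e1 : ∫ x, homExt G (WithLp.toLp 2 x) ∂(Measure.pi fun _ : Fin d => laplace) = 0 := by
    rw [integral_pi_laplace_homogeneous hd hCm 1 fun c hc w => by
      rw [homExt_smul G hc, pow_one], integral_sphereLaw_of_odd (homExt_neg hodd), mul_zero]
  have hΓ : Real.Gamma (d + (2 : ℕ)) / Real.Gamma d = d * (d + 1) := by
    rw [show (d : ℝ) + (2 : ℕ) = (d + 1) + 1 by push_cast; ring, Real.Gamma_add_one (by positivity),
      Real.Gamma_add_one (by positivity)]
    have := Real.Gamma_pos_of_pos hd0
    field_simp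
  have e2 : ∫ x, homExt G (WithLp.toLp 2 x) ^ 2 ∂(Measure.pi fun _ : Fin d => laplace) =
      d * (d + 1) * ∫ u, G u ^ 2 ∂(sphereLaw d) := by
    rw [integral_pi_laplace_homogeneous hd (φ := fun w => homExt G w ^ 2) (by fun_prop) 2
      fun c hc w => by rw [homExt_smul G hc, mul_pow], hΓ]
    congr 1
    refine integral_congr_ae ?_
    filter_upwards [hsph] with u hu
    rw [hu]
  -- the squared slope `S` of the extension is homogeneous of degree zero; its mean is bounded through
  -- `d E‖ζ‖² ≤ 2` and `√d E‖ζ‖ ≤ √2`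
  set S : Vec d → ℝ := fun w => (1 + 2 * √d * (‖w‖ / ellNorm 1 w)) ^ 2 with hS
  have hSm : Measurable S := by
    have := measurable_ellNorm 1 (d := d)
    fun_prop
  have hSb : ∀ w, S w ≤ (1 + 2 * √d) ^ 2 := fun w => by
    have h1 : ‖w‖ / ellNorm 1 w ≤ 1 :=
      div_le_one_of_le₀ (norm_le_ellNorm_one w) (ellNorm_one_nonneg w)
    have h2 : 0 ≤ ‖w‖ / ellNorm 1 w := div_nonneg (norm_nonneg _) (ellNorm_one_nonneg w)
    simp only [hS]
    have h3 : 2 * √d * (‖w‖ / ellNorm 1 w) ≤ 2 * √d := mul_le_of_le_one_right (by positivity) h1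
    exact pow_le_pow_left₀ (by positivity) (by linarith) 2
  have hSi : Integrable (fun x : Fin d → ℝ => S (WithLp.toLp 2 x))
      (Measure.pi fun _ : Fin d => laplace) := by
    refine (integrable_const ((1 + 2 * √d) ^ 2)).mono'
      (hSm.comp (by fun_prop)).aestronglyMeasurable (.of_forall fun x => ?_)
    rw [Real.norm_of_nonneg (by positivity)]
    exact hSb _
  have e3 : ∫ x : Fin d → ℝ, S (WithLp.toLp 2 x) ∂(Measure.pi fun _ => laplace) =
      ∫ u, S u ∂(sphereLaw d) := by
    rw [integral_pi_laplace_homogeneous hd hSm 0 fun c hc w => by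
      simp only [hS]
      rw [ellNorm_smul, norm_smul, abs_of_pos hc, Real.norm_of_nonneg hc.le,
        mul_div_mul_left _ _ hc.ne', pow_zero, one_mul]]
    have := Real.Gamma_pos_of_pos hd0
    simp [this.ne']
  have hnorm : MemLp (fun u : Vec d => ‖u‖) 2 (sphereLaw d) := by
    refine MemLp.of_bound (by fun_prop) 1 ?_
    filter_upwards [ae_sphereLaw_ellNorm_one d] with u hu
    rw [norm_norm, ← hu]
    exact norm_le_ellNorm_one u
  have e4 : ∫ u, S u ∂(sphereLaw d) ≤ (1 + 2 * √2) ^ 2 := by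
    have i1 := hnorm.integrable (by norm_num)
    have i2 := hnorm.integrable_sq
    have h1 : ∫ u, S u ∂(sphereLaw d) =
        1 + 4 * √d * ∫ u, ‖u‖ ∂(sphereLaw d) + 4 * d * ∫ u, ‖u‖ ^ 2 ∂(sphereLaw d) := by
      have i3 : Integrable (fun u : Vec d => 4 * √d * ‖u‖) (sphereLaw d) := i1.const_mul _
      have i4 : Integrable (fun u : Vec d => 4 * d * ‖u‖ ^ 2) (sphereLaw d) := i2.const_mul _
      have i5 : Integrable (fun u : Vec d => 1 + 4 * √d * ‖u‖) (sphereLaw d) :=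
        (integrable_const 1).add i3
      rw [← integral_const_mul, ← integral_const_mul]
      calc _ = ∫ u, (1 + 4 * √d * ‖u‖ + 4 * d * ‖u‖ ^ 2) ∂(sphereLaw d) := by
            refine integral_congr_ae ?_
            filter_upwards [ae_sphereLaw_ellNorm_one d] with u hu
            simp only [hS]
            rw [hu, div_one]
            have := Real.sq_sqrt hd0.le
            linear_combination (4 * ‖u‖ ^ 2) * this
        _ = _ := by
            rw [integral_add i5 i4, integral_add (integrable_const 1) i3]; simp
    have h2 := sq_integral_le hnorm
    rw [integral_sphereLaw_norm_sq hd] at h1 h2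
    set m := ∫ u, ‖u‖ ∂(sphereLaw d)
    have h3 : √d * m ≤ √2 := by
      refine Real.le_sqrt_of_sq_le ?_
      rw [mul_pow, Real.sq_sqrt hd0.le]
      calc (d : ℝ) * m ^ 2 ≤ d * (2 / (d + 1)) := by gcongr
        _ ≤ 2 := by
          rw [mul_div_assoc', div_le_iff₀ (by positivity)]; linarith
    have h4 : 4 * (d : ℝ) * (2 / (d + 1)) ≤ 8 := by
      rw [mul_div_assoc', div_le_iff₀ (by positivity)]; linarith
    rw [h1]
    have h5 := Real.sq_sqrt (show (0 : ℝ) ≤ 2 by norm_num)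
    nlinarith
  -- the squared norm of the gradient is at most `K² S`
  have hgrad : ∫ x, ∑ i, lineDeriv ℝ (fun x : Fin d → ℝ => homExt G (WithLp.toLp 2 x)) x
      (Pi.single i 1) ^ 2 ∂(Measure.pi fun _ : Fin d => laplace) ≤ K ^ 2 * (1 + 2 * √2) ^ 2 := by
    calc _ ≤ ∫ x : Fin d → ℝ, K ^ 2 * S (WithLp.toLp 2 x) ∂(Measure.pi fun _ => laplace) := by
          refine integral_mono_of_nonneg
            (.of_forall fun x => Finset.sum_nonneg fun i _ => sq_nonneg _) (hSi.const_mul _) ?_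
          have hac : Measure.pi (fun _ : Fin d => laplace) ≪ volume := by
            rw [pi_laplace_eq]; exact withDensity_absolutelyContinuous _ _
          have : Nonempty (Fin d) := ⟨⟨0, Nat.pos_of_ne_zero hd⟩⟩
          have hne : ∀ᵐ x : Fin d → ℝ, x ≠ 0 := Measure.ae_ne volume 0
          filter_upwards [hac.ae_le hL.ae_differentiableAt, hac.ae_le hne] with x hx hx0
          have hx0' : (WithLp.toLp 2 x : Vec d) ≠ 0 := by simpa using hx0
          have hn1 := ellNorm_one_nonneg (WithLp.toLp 2 x : Vec d)
          refine (sum_lineDeriv_sq_le hx (by positivity)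
            (abs_homExt_sub_le hK hG h0 hx0')).trans_eq ?_
          simp only [hS]
          ring
      _ ≤ _ := by
          rw [integral_const_mul, e3]
          gcongr
  rw [e1, e2] at hP
  rw [le_div_iff₀ (by positivity)]
  nlinarith

/-! ### The mean `ℓ_q`-norm on the `ℓ_1`-sphere -/

theorem Gamma_add_one_le_rpow {r : ℝ} (hr : 1 ≤ r) : Real.Gamma (r + 1) ≤ r ^ r := by
  have key : ∀ n : ℕ, ∀ r : ℝ, 1 ≤ r → r ≤ n + 2 → Real.Gamma (r + 1) ≤ r ^ r := by
    intro n
    induction n with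
    | zero =>
      intro r h1 h2
      norm_num at h2
      -- on `[2, 3]` the convex function `Γ` lies below its chord, `Γ(r + 1) ≤ r`
      have h := Real.convexOn_Gamma.2 (show (2 : ℝ) ∈ Set.Ioi 0 by simp)
        (show (3 : ℝ) ∈ Set.Ioi 0 by simp) (show 0 ≤ 2 - r by linarith)
        (show 0 ≤ r - 1 by linarith) (by ring)
      have e3 : Real.Gamma 3 = 2 := by
        rw [show (3 : ℝ) = (2 : ℕ) + 1 by norm_num, Real.Gamma_nat_eq_factorial]
        norm_num [Nat.factorial]
      simp only [smul_eq_mul, Real.Gamma_two, e3] at h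
      rw [show (2 - r) * 2 + (r - 1) * 3 = r + 1 by ring] at h
      calc Real.Gamma (r + 1) ≤ r ^ (1 : ℝ) := by rw [Real.rpow_one]; linarith
        _ ≤ r ^ r := Real.rpow_le_rpow_of_exponent_le h1 h1
    | succ n ih =>
      intro r h1 h2
      push_cast at h2
      rcases le_total r (n + 2) with h | h
      · exact ih r h1 h
      have hn : (0 : ℝ) ≤ n := n.cast_nonneg
      have h3 := ih (r - 1) (by linarith) (by linarith)
      rw [sub_add_cancel] at h3
      rw [Real.Gamma_add_one (by linarith)]
      calc r * Real.Gamma r ≤ r * (r - 1) ^ (r - 1) := by gcongr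
        _ ≤ r * r ^ (r - 1) := by
          gcongr
          linarith
        _ = r ^ r := by
          conv_rhs => rw [show r = 1 + (r - 1) by ring, Real.rpow_add (by linarith), Real.rpow_one]
          rw [show 1 + (r - 1) = r by ring]
  obtain ⟨n, hn⟩ := exists_nat_ge r
  exact key n r hr (by linarith)

theorem integrable_ellNorm_sphereLaw {d : ℕ} [IsProbabilityMeasure (sphereLaw d)] {q : ENNReal}
    (hq : 1 ≤ q) : Integrable (ellNorm q) (sphereLaw d) := by
  have : Fact (1 ≤ q) := ⟨hq⟩
  refine (integrable_const (1 : ℝ)).mono' (measurable_ellNorm q).aestronglyMeasurable ?_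
  filter_upwards [ae_sphereLaw_ellNorm_one d] with u hu
  rw [Real.norm_of_nonneg (ellNorm_nonneg q u), ← hu]
  exact ellNorm_anti le_rfl hq u

/-- For a vector `W` of independent Laplace variables, `d` times the left-hand side is `E‖W‖_r`, at
most `(E‖W‖_r^r)^(1/r) = (d Γ(r+1))^(1/r)`. -/
theorem integral_sphereLaw_ellNorm_le_of_ne_top {d : ℕ} (hd : d ≠ 0)
    [IsProbabilityMeasure (sphereLaw d)] {r : ENNReal} (hr : 1 ≤ r) (hr' : r ≠ ⊤) :
    ∫ u, ellNorm r u ∂(sphereLaw d) ≤ r.toReal * (d : ℝ) ^ recip r / d := by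
  have : Fact (1 ≤ r) := ⟨hr⟩
  set s := r.toReal with hs
  have hs1 : 1 ≤ s := by simpa using ENNReal.toReal_mono hr' hr
  have hd0 : (0 : ℝ) < d := by exact_mod_cast Nat.pos_of_ne_zero hd
  have h1 := integral_pi_laplace_homogeneous hd (φ := ellNorm r) (measurable_ellNorm r) 1
    fun c hc w => by rw [ellNorm_smul, abs_of_pos hc, pow_one]
  have hΓ : Real.Gamma (d + (1 : ℕ)) / Real.Gamma d = d := by
    rw [Nat.cast_one, Real.Gamma_add_one (by positivity)]
    have := Real.Gamma_pos_of_pos hd0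
    field_simp
  rw [hΓ] at h1
  set P := Measure.pi fun _ : Fin d => laplace with hP
  set Y : (Fin d → ℝ) → ℝ := fun x => ellNorm r (WithLp.toLp 2 x : Vec d) with hY
  have hYs : ∀ x, Y x ^ s = ∑ i, |x i| ^ s := fun x => by
    simp only [hY]
    rw [ellNorm_eq_sum hr hr', ← Real.rpow_mul (by positivity), one_div_mul_cancel (by positivity),
      Real.rpow_one]
  have hi : ∀ i : Fin d, Integrable (fun x : Fin d → ℝ => |x i| ^ s) P := fun i =>
    (measurePreserving_eval (fun _ : Fin d => laplace) i).integrable_comp_of_integrable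
      (integrable_laplace_abs_rpow (by linarith : 0 ≤ s))
  have hY0 : ∀ x, 0 ≤ Y x := fun x => ellNorm_nonneg r _
  have hYsi : Integrable (fun x => Y x ^ s) P := by
    simp_rw [hYs]
    exact integrable_finsetSum _ fun i _ => hi i
  have hYm : Measurable Y := (measurable_ellNorm r).comp (by fun_prop)
  have hYi : Integrable Y P := by
    refine ((integrable_const (1 : ℝ)).add hYsi).mono' hYm.aestronglyMeasurable
      (.of_forall fun x => ?_)
    rw [Real.norm_of_nonneg (hY0 x), Pi.add_apply]
    rcases le_total (Y x) 1 with h | h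
    · have := Real.rpow_nonneg (hY0 x) s
      linarith
    · have := Real.rpow_le_rpow_of_exponent_le h hs1
      rw [Real.rpow_one] at this
      linarith
  -- Jensen's inequality for the power `s`
  have hJ := (convexOn_rpow hs1).map_integral_le (μ := P) (f := Y)
    (Real.continuous_rpow_const (by linarith)).continuousOn isClosed_Ici
    (.of_forall fun x => hY0 x) hYi hYsi
  have hsum : ∫ x, Y x ^ s ∂P = d * Real.Gamma (s + 1) := by
    simp_rw [hYs]
    rw [integral_finsetSum _ fun i _ => hi i]
    have : ∀ i : Fin d, ∫ x : Fin d → ℝ, |x i| ^ s ∂P = Real.Gamma (s + 1) := fun i => by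
      rw [hP, integral_comp_eval (μ := fun _ : Fin d => laplace) (i := i)
        (f := fun y : ℝ => |y| ^ s)
        (integrable_laplace_abs_rpow (by linarith)).aestronglyMeasurable, integral_laplace_abs_rpow (by linarith)]
    simp [this]
  have hle : ∫ x, Y x ∂P ≤ s * (d : ℝ) ^ recip r := by
    have h2 : (∫ x, Y x ∂P) ^ s ≤ (s * (d : ℝ) ^ recip r) ^ s := by
      refine hJ.trans ?_
      rw [hsum, Real.mul_rpow (by positivity) (by positivity), ← Real.rpow_mul hd0.le, recip_eq,
        one_div_mul_cancel (by positivity), Real.rpow_one, mul_comm]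
      gcongr
      exact Gamma_add_one_le_rpow hs1
    exact (Real.rpow_le_rpow_iff (integral_nonneg hY0) (by positivity) (by linarith)).1 h2
  rw [h1] at hle
  rw [le_div_iff₀ hd0, mul_comm]
  exact hle

theorem one_le_log {d : ℕ} (hd : 3 ≤ d) : 1 ≤ Real.log d := by
  rw [Real.le_log_iff_exp_le (by positivity)]
  have : (3 : ℝ) ≤ d := by exact_mod_cast hd
  linarith [Real.exp_one_lt_d9]

/-- The mean `ℓ_q`-norm over the `ℓ_1`-ball is at most `b_q(d)`. For `q ≥ log d`, the norm is bounded by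
the one of exponent `log d`, since `d^(1 / log d) = e`. -/
theorem integral_sphereLaw_ellNorm_le {d : ℕ} (hd : 3 ≤ d)
    [IsProbabilityMeasure (sphereLaw d)] {q : ENNReal} (hq : 1 ≤ q) :
    d / (d + 1) * ∫ u, ellNorm q u ∂(sphereLaw d) ≤ bias q d := by
  have hd0 : (0 : ℝ) < d := by exact_mod_cast (by omega : 0 < d)
  have hd' : d ≠ 0 := by omega
  have hlog := one_le_log hd
  have main : ∫ u, ellNorm q u ∂(sphereLaw d) ≤
      (if q < ENNReal.ofReal (Real.log d) then q.toReal * (d : ℝ) ^ recip q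
      else Real.exp 1 * Real.log d) / d := by
    split_ifs with h
    · exact integral_sphereLaw_ellNorm_le_of_ne_top hd' hq h.ne_top
    · have h1 : 1 ≤ ENNReal.ofReal (Real.log d) := by simpa using hlog
      calc ∫ u, ellNorm q u ∂(sphereLaw d)
          ≤ ∫ u, ellNorm (ENNReal.ofReal (Real.log d)) u ∂(sphereLaw d) :=
            integral_mono (integrable_ellNorm_sphereLaw hq) (integrable_ellNorm_sphereLaw h1)
              fun u => ellNorm_anti h1 (not_lt.1 h) u
        _ ≤ _ := integral_sphereLaw_ellNorm_le_of_ne_top hd' h1 ENNReal.ofReal_ne_top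
        _ = _ := by
          rw [recip_eq, ENNReal.toReal_ofReal (by linarith), one_div, Real.rpow_inv_log hd0
            (by intro h; rw [h] at hlog; norm_num at hlog), mul_comm (Real.log d)]
  calc _ ≤ (d : ℝ) / (d + 1) * _ := mul_le_mul_of_nonneg_left main (by positivity)
    _ = _ := by
      rw [bias]
      field_simp

theorem bias_pos {d : ℕ} (hd : 3 ≤ d) {q : ENNReal} (hq : 1 ≤ q) : 0 < bias q d := by
  have hd0 : (0 : ℝ) < d := by exact_mod_cast (by omega : 0 < d)
  have hlog := one_le_log hd
  unfold bias
  refine mul_pos (by positivity) ?_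
  split_ifs with h
  · have : 0 < q.toReal := ENNReal.toReal_pos (by positivity) h.ne_top
    positivity
  · have : 0 < Real.log d := by linarith
    positivity

/-! ### Signs, cut-offs and line derivatives -/

theorem signVec_apply {d : ℕ} (x : Vec d) (i : Fin d) :
    signVec x i = if 0 ≤ x i then (1 : ℝ) else -1 := rfl

theorem abs_signVec_le {d : ℕ} (x : Vec d) (i : Fin d) : |signVec x i| ≤ 1 := by
  rw [signVec_apply]; split_ifs <;> simp

theorem measurable_signVec {d : ℕ} : Measurable (signVec : Vec d → Vec d) := by
  refine (WithLp.measurable_toLp 2 _).comp (measurable_pi_lambda _ fun i => ?_)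
  exact Measurable.ite (measurableSet_le measurable_const (by fun_prop)) measurable_const
    measurable_const

theorem signVec_smul {d : ℕ} {c : ℝ} (hc : 0 < c) (x : Vec d) : signVec (c • x) = signVec x := by
  ext i
  simp [signVec_apply, mul_nonneg_iff_of_pos_left hc]

theorem ae_apply_ne_zero {d : ℕ} : ∀ᵐ w : Vec d, ∀ i, w i ≠ 0 := by
  refine ae_all_iff.2 fun i => ?_
  let p : Vec d →ₗ[ℝ] ℝ := (EuclideanSpace.proj i : Vec d →L[ℝ] ℝ)
  have h : LinearMap.ker p ≠ ⊤ := fun h => by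
    have : EuclideanSpace.single i (1 : ℝ) ∈ LinearMap.ker p := h ▸ Submodule.mem_top
    simp [p] at this
  have h2 := Measure.addHaar_submodule (volume : Measure (Vec d)) _ h
  rw [ae_iff]
  convert h2 using 2
  ext w
  simp [p]

/-- A radius cut-off, equal to `1` on `[0, 1]` and to `0` beyond `1 + ε`. -/
noncomputable def cutoff (ε r : ℝ) : ℝ := max 0 (min 1 ((1 + ε - r) / ε))

theorem cutoff_nonneg (ε r : ℝ) : 0 ≤ cutoff ε r := le_max_left _ _

theorem cutoff_le_one (ε r : ℝ) : cutoff ε r ≤ 1 := max_le zero_le_one (min_le_left _ _)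

theorem cutoff_of_le {ε r : ℝ} (hε : 0 < ε) (hr : r ≤ 1) : cutoff ε r = 1 := by
  have : 1 ≤ (1 + ε - r) / ε := by rw [le_div_iff₀ hε]; linarith
  rw [cutoff, min_eq_left this, max_eq_right zero_le_one]

theorem cutoff_of_ge {ε r : ℝ} (hε : 0 < ε) (hr : 1 + ε ≤ r) : cutoff ε r = 0 := by
  have : (1 + ε - r) / ε ≤ 0 := div_nonpos_of_nonpos_of_nonneg (by linarith) hε.le
  rw [cutoff, min_eq_right (by linarith), max_eq_left this]

theorem cutoff_of_mem {ε r : ℝ} (hε : 0 < ε) (hr : r ∈ Set.Icc 1 (1 + ε)) :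
    cutoff ε r = (1 + ε - r) / ε := by
  have h1 : 0 ≤ (1 + ε - r) / ε := div_nonneg (by linarith [hr.2]) hε.le
  have h2 : (1 + ε - r) / ε ≤ 1 := by rw [div_le_one hε]; linarith [hr.1]
  rw [cutoff, min_eq_right h2, max_eq_right h1]

theorem hasDerivAt_cutoff {ε r : ℝ} (hε : 0 < ε) (h1 : r ≠ 1) (h2 : r ≠ 1 + ε) :
    HasDerivAt (cutoff ε) (if r ∈ Set.Ico 1 (1 + ε) then -ε⁻¹ else 0) r := by
  rcases lt_or_gt_of_ne h1 with h | h
  · rw [if_neg fun hr => absurd hr.1 (not_le.2 h)]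
    refine (hasDerivAt_const r (1 : ℝ)).congr_of_eventuallyEq ?_
    filter_upwards [gt_mem_nhds h] with s hs using cutoff_of_le hε hs.le
  rcases lt_or_gt_of_ne h2 with h' | h'
  · rw [if_pos ⟨h.le, h'⟩]
    have : HasDerivAt (fun s => (1 + ε - s) / ε) (-ε⁻¹) r := by
      have := ((hasDerivAt_id r).const_sub (1 + ε)).div_const ε
      simpa [div_eq_mul_inv] using this
    refine this.congr_of_eventuallyEq ?_
    filter_upwards [lt_mem_nhds h, gt_mem_nhds h'] with s hs hs'
      using cutoff_of_mem hε ⟨hs.le, hs'.le⟩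
  · rw [if_neg fun hr => absurd hr.2 (not_lt.2 h'.le)]
    refine (hasDerivAt_const r (0 : ℝ)).congr_of_eventuallyEq ?_
    filter_upwards [lt_mem_nhds h'] with s hs using cutoff_of_ge hε hs.le

theorem lipschitzWith_ellNorm_one {d : ℕ} :
    LipschitzWith (Real.sqrt d).toNNReal (ellNorm 1 : Vec d → ℝ) :=
  LipschitzWith.of_le_add_mul _ fun x y => by
    rw [Real.coe_toNNReal _ (by positivity), dist_eq_norm]
    have h1 := ellNorm_add_le 1 (x - y) y
    have h2 := ellNorm_one_le_sqrt_mul_norm (x - y)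
    rw [sub_add_cancel] at h1
    linarith

theorem lipschitzWith_cutoff {ε : ℝ} (hε : 0 < ε) : LipschitzWith (ε⁻¹).toNNReal (cutoff ε) := by
  have h : LipschitzWith (ε⁻¹).toNNReal fun r => (1 + ε - r) / ε :=
    LipschitzWith.of_dist_le_mul fun r s => by
      rw [Real.coe_toNNReal _ (by positivity), Real.dist_eq, Real.dist_eq, ← sub_div, abs_div,
        abs_of_pos hε, abs_sub_comm r s, div_eq_inv_mul]
      ring_nf
      exact le_rfl
  exact (h.const_min 1).const_max 0

theorem hasDerivAt_ellNorm_one_line {d : ℕ} {w : Vec d} (hw : ∀ i, w i ≠ 0) (v : Vec d) :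
    HasDerivAt (fun t : ℝ => ellNorm 1 (w + t • v)) (inner ℝ (signVec w) v) 0 := by
  have h : ∀ i, HasDerivAt (fun t : ℝ => |w i + t * v i|) (v i * signVec w i) 0 := by
    intro i
    have h1 : HasDerivAt (fun t : ℝ => w i + t * v i) (v i) 0 := by
      simpa using ((hasDerivAt_id (0 : ℝ)).mul_const (v i)).const_add (w i)
    rw [signVec_apply]
    rcases lt_or_gt_of_ne (hw i) with h0 | h0
    · rw [if_neg (not_le.2 h0)]
      have := (hasDerivAt_abs_neg (show w i + 0 * v i < 0 by simpa using h0)).comp 0 h1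
      simpa [mul_comm, Function.comp_def] using this
    · rw [if_pos h0.le]
      have := (hasDerivAt_abs_pos (show 0 < w i + 0 * v i by simpa using h0)).comp 0 h1
      simpa [mul_comm, Function.comp_def] using this
  have := HasDerivAt.fun_sum (u := Finset.univ) fun i _ => h i
  simp only [ellNorm_one, PiLp.inner_apply]
  simpa using this

/-- The gradient inequality of a convex function at a point of differentiability. -/
theorem sub_le_lineDeriv_of_convexOn {d : ℕ} {f : Vec d → ℝ} (hf : ConvexOn ℝ Set.univ f) {w : Vec d}
    (hw : DifferentiableAt ℝ f w) (v : Vec d) : f w - f (w - v) ≤ lineDeriv ℝ f w v := by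
  have h1 : ConvexOn ℝ Set.univ fun t : ℝ => f (w + t • v) := by
    have : ConvexOn ℝ Set.univ (f ∘ AffineMap.lineMap (k := ℝ) w (w + v)) :=
      hf.comp_affineMap (AffineMap.lineMap w (w + v))
    convert this using 2
    simp [AffineMap.lineMap_apply, add_comm]
  have h2 : HasDerivAt (fun t : ℝ => f (w + t • v)) (lineDeriv ℝ f w v) 0 :=
    (hw.hasFDerivAt.hasLineDerivAt v).lineDifferentiableAt.hasLineDerivAt
  have h3 := h1.slope_le_of_hasDerivAt (Set.mem_univ (-1)) (Set.mem_univ 0) (by norm_num) h2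
  rw [slope_def_field] at h3
  simpa [sub_eq_add_neg] using h3

/-! ### Integration by parts on a smoothed `ℓ_1`-ball -/

theorem radialMeasure_real_Ico {d : ℕ} {C : ℝ}
    (hC : ∀ g : ℝ → ℝ, Measurable g →
      ∫ r, g r ∂(radialMeasure d) = C * ∫ r in Set.Ioi 0, r ^ (d - 1) * g r) (hd : d ≠ 0)
    {a b : ℝ} (ha : 0 < a) (hab : a ≤ b) :
    (radialMeasure d).real (Set.Ico a b) = C * ((b ^ d - a ^ d) / d) := by
  have h := hC ((Set.Ico a b).indicator 1) (measurable_one.indicator measurableSet_Ico)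
  rw [integral_indicator_one measurableSet_Ico] at h
  rw [h]
  congr 1
  have e : ∀ r, r ^ (d - 1) * (Set.Ico a b).indicator (1 : ℝ → ℝ) r =
      (Set.Ico a b).indicator (fun r => r ^ (d - 1)) r := fun r => by
    by_cases hr : r ∈ Set.Ico a b <;> simp [hr]
  simp_rw [e]
  rw [setIntegral_indicator measurableSet_Ico,
    Set.inter_eq_right.2 (show Set.Ico a b ⊆ Set.Ioi 0 from fun r hr => ha.trans_le hr.1), integral_Ico_eq_integral_Ioc,
    ← intervalIntegral.integral_of_le hab, integral_pow]
  have : d - 1 + 1 = d := by omega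
  rw [this, Nat.cast_sub (by omega)]
  simp

theorem radialMeasure_singleton {d : ℕ} {C : ℝ}
    (hC : ∀ g : ℝ → ℝ, Measurable g →
      ∫ r, g r ∂(radialMeasure d) = C * ∫ r in Set.Ioi 0, r ^ (d - 1) * g r) (a : ℝ) :
    radialMeasure d {a} = 0 := by
  have h := hC (({a} : Set ℝ).indicator 1) (measurable_one.indicator (measurableSet_singleton a))
  rw [integral_indicator_one (measurableSet_singleton a)] at h
  have h0 : ∫ r in Set.Ioi 0, r ^ (d - 1) * (({a} : Set ℝ).indicator (1 : ℝ → ℝ)) r = 0 := by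
    rw [integral_eq_zero_of_ae]
    filter_upwards [Measure.ae_ne (volume.restrict (Set.Ioi 0)) a] with r hr
    simp [hr]
  rw [h0, mul_zero, Measure.real, ENNReal.toReal_eq_zero_iff] at h
  exact h.resolve_right
    (radialMeasure_lt_top (measurableSet_singleton a) Bornology.isBounded_singleton).ne

theorem ae_ellNorm_one_ne {d : ℕ} (hd : d ≠ 0) (a : ℝ) : ∀ᵐ w : Vec d, ellNorm 1 w ≠ a := by
  obtain ⟨C, -, hC⟩ := exists_radialMeasure_integral hd
  have h := radialMeasure_singleton (fun g hg => (hC g hg).1) a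
  rw [radialMeasure, Measure.map_apply (measurable_ellNorm 1) (measurableSet_singleton a)] at h
  rw [ae_iff]
  convert h using 2
  ext w; simp

/-- The line derivative of a radial cut-off function. -/
theorem lineDeriv_cutoff {d : ℕ} {ε : ℝ} (hε : 0 < ε) {w : Vec d} (hw : ∀ i, w i ≠ 0)
    (h1 : ellNorm 1 w ≠ 1) (h2 : ellNorm 1 w ≠ 1 + ε) (v : Vec d) :
    lineDeriv ℝ (fun w : Vec d => cutoff ε (ellNorm 1 w)) w (-v) =
      (Set.Ico 1 (1 + ε)).indicator (fun _ => ε⁻¹) (ellNorm 1 w) * inner ℝ (signVec w) v := by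
  have h3 : HasDerivAt (fun t : ℝ => cutoff ε (ellNorm 1 (w + t • -v)))
      ((if ellNorm 1 w ∈ Set.Ico 1 (1 + ε) then -ε⁻¹ else 0) * inner ℝ (signVec w) (-v)) 0 := by
    have ha : HasDerivAt (cutoff ε) (if ellNorm 1 w ∈ Set.Ico 1 (1 + ε) then -ε⁻¹ else 0)
        (ellNorm 1 (w + (0 : ℝ) • -v)) := by
      simpa using hasDerivAt_cutoff hε h1 h2
    exact HasDerivAt.comp (h₂ := cutoff ε) (0 : ℝ) ha (hasDerivAt_ellNorm_one_line hw (-v))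
  rw [lineDeriv, h3.deriv, inner_neg_right]
  by_cases h : ellNorm 1 w ∈ Set.Ico 1 (1 + ε)
  · rw [if_pos h, Set.indicator_of_mem h]; ring
  · rw [if_neg h, Set.indicator_of_notMem h]; ring

theorem hasCompactSupport_cutoff {d : ℕ} {ε : ℝ} (hε : 0 < ε) :
    HasCompactSupport fun w : Vec d => cutoff ε (ellNorm 1 w) := by
  refine HasCompactSupport.intro (isCompact_closedBall (0 : Vec d) (1 + ε)) fun w hw => ?_
  rw [mem_closedBall_zero_iff, not_le] at hw
  exact cutoff_of_ge hε (hw.le.trans (norm_le_ellNorm_one w))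

theorem volume_l1_lt_top {d : ℕ} {I : Set ℝ} (hI : MeasurableSet I)
    (hIb : Bornology.IsBounded I) : volume (ellNorm 1 ⁻¹' I : Set (Vec d)) < ⊤ := by
  have := radialMeasure_lt_top (d := d) hI hIb
  rwa [radialMeasure, Measure.map_apply (measurable_ellNorm 1) hI] at this

/-- Integration by parts on the `ℓ_1`-ball with its indicator smoothed over a shell of
width `ε`. -/
theorem integral_ball_sub_le_shell {d : ℕ} (hd : d ≠ 0) [IsProbabilityMeasure (sphereLaw d)]
    {f : Vec d → ℝ} (hf : ConvexOn ℝ Set.univ f) {K : NNReal} (hL : LipschitzWith K f) (v : Vec d)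
    {ε : ℝ} (hε : 0 < ε) :
    ∫ w in ellNorm 1 ⁻¹' (Set.Ico 0 1), (f w - f (w - v)) ≤
      (radialMeasure d).real (Set.Ico 1 (1 + ε)) * (K * ‖v‖) +
      ε⁻¹ * (radialMeasure d).real (Set.Ico 1 (1 + ε)) *
        (∫ u, inner ℝ (signVec u) v * f u ∂(sphereLaw d) + ε * (K * ellNorm 1 v)) := by
  set g : Vec d → ℝ := fun w => cutoff ε (ellNorm 1 w) with hg
  set I : Set ℝ := Set.Ico 1 (1 + ε) with hI
  have hIm : MeasurableSet I := measurableSet_Ico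
  set B : Set (Vec d) := ellNorm 1 ⁻¹' (Set.Ico 0 1) with hB
  have hBm : MeasurableSet B := measurable_ellNorm 1 measurableSet_Ico
  set Z : Set (Vec d) := ellNorm 1 ⁻¹' I with hZ
  have hZm : MeasurableSet Z := measurable_ellNorm 1 hIm
  have hBt : volume B ≠ ⊤ := (volume_l1_lt_top measurableSet_Ico (Metric.isBounded_Ico 0 1)).ne
  have hZt : volume Z ≠ ⊤ := (volume_l1_lt_top hIm (Metric.isBounded_Ico _ _)).ne
  have hZr : volume.real Z = (radialMeasure d).real I := by
    rw [Measure.real, Measure.real, radialMeasure, Measure.map_apply (measurable_ellNorm 1) hIm]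
  set D : Vec d → ℝ := fun w => f w - f (w - v) with hD
  have hDc : Continuous D := by have := hL.continuous; fun_prop
  have hDb : ∀ w, |D w| ≤ K * ‖v‖ := fun w => by
    have := hL.dist_le_mul w (w - v)
    rwa [Real.dist_eq, dist_eq_norm, sub_sub_cancel] at this
  have hgL := (lipschitzWith_cutoff hε).comp (lipschitzWith_ellNorm_one (d := d))
  have hgc : HasCompactSupport g := hasCompactSupport_cutoff hε
  have hgi : Integrable g := hgL.continuous.integrable_of_hasCompactSupport hgc
  have hDi : ∀ S : Set (Vec d), volume S ≠ ⊤ → IntegrableOn D S := fun S hS =>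
    Measure.integrableOn_of_bounded hS hDc.aestronglyMeasurable (M := K * ‖v‖)
      (.of_forall hDb)
  -- the integral over the ball against the smoothed one
  have s1 : ∫ w in B, D w ≤ (∫ w, D w * g w) + (radialMeasure d).real I * (K * ‖v‖) := by
    have hsplit : ∀ w, D w * g w = B.indicator D w + Z.indicator (fun w => D w * g w) w := by
      intro w
      have h0 := ellNorm_one_nonneg w
      by_cases hwB : w ∈ B
      · have hwZ : w ∉ Z := fun h => absurd hwB.2 (not_lt.2 h.1)
        rw [Set.indicator_of_mem hwB, Set.indicator_of_notMem hwZ, hg]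
        simp only
        rw [cutoff_of_le hε hwB.2.le]; ring
      · have h1 : 1 ≤ ellNorm 1 w := not_lt.1 fun h => hwB ⟨h0, h⟩
        rw [Set.indicator_of_notMem hwB, zero_add]
        by_cases hwZ : w ∈ Z
        · rw [Set.indicator_of_mem hwZ]
        · have h2 : 1 + ε ≤ ellNorm 1 w := not_lt.1 fun h => hwZ ⟨h1, h⟩
          rw [Set.indicator_of_notMem hwZ, hg]
          simp only
          rw [cutoff_of_ge hε h2, mul_zero]
    have hZi : IntegrableOn (fun w => D w * g w) Z :=
      Measure.integrableOn_of_bounded hZt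
        (hDc.mul hgL.continuous).aestronglyMeasurable (M := K * ‖v‖) (.of_forall fun w => by
          rw [norm_mul, Real.norm_eq_abs, Real.norm_of_nonneg (cutoff_nonneg _ _)]
          exact (mul_le_of_le_one_right (abs_nonneg _) (cutoff_le_one _ _)).trans (hDb w))
    have e : ∫ w, D w * g w = (∫ w in B, D w) + ∫ w in Z, D w * g w := by
      rw [integral_congr_ae (.of_forall hsplit),
        integral_add ((hDi B hBt).integrable_indicator hBm) (hZi.integrable_indicator hZm),
        integral_indicator hBm, integral_indicator hZm]
    have hb : ‖∫ w in Z, D w * g w‖ ≤ K * ‖v‖ * volume.real Z :=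
      norm_setIntegral_le_of_norm_le_const hZt.lt_top fun w _ => by
        rw [norm_mul, Real.norm_eq_abs, Real.norm_of_nonneg (cutoff_nonneg _ _)]
        exact (mul_le_of_le_one_right (abs_nonneg _) (cutoff_le_one _ _)).trans (hDb w)
    rw [hZr, Real.norm_eq_abs] at hb
    have := neg_abs_le (∫ w in Z, D w * g w)
    linarith
  -- convexity and integration by parts
  have s2 : ∫ w, D w * g w ≤ ∫ w, lineDeriv ℝ f w v * g w := by
    refine integral_mono_ae ?_ ?_ ?_
    · exact hgi.bdd_mul hDc.aestronglyMeasurable (c := K * ‖v‖) (.of_forall hDb)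
    · exact hgi.bdd_mul (measurable_lineDeriv hL.continuous).aestronglyMeasurable (c := K * ‖v‖)
        (.of_forall fun w => norm_lineDeriv_le_of_lipschitz ℝ hL)
    · filter_upwards [hL.ae_differentiableAt] with w hw
      exact mul_le_mul_of_nonneg_right (sub_le_lineDeriv_of_convexOn hf hw v) (cutoff_nonneg _ _)
  have s3 : ∫ w, lineDeriv ℝ f w v * g w = ∫ w, lineDeriv ℝ g w (-v) * f w :=
    hL.integral_lineDeriv_mul_eq hgL hgc v
  -- the derivative of the cut-off lives on the shell, where `f` is close to its value on the sphere
  set φ : Vec d → ℝ := fun w => inner ℝ (signVec w) v * f ((ellNorm 1 w)⁻¹ • w) +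
    ε * (K * ellNorm 1 v) with hφ
  have hφm : Measurable φ := by
    have h1 := measurable_signVec (d := d)
    have h2 := hL.continuous.measurable.comp (measurable_radialProj (d := d))
    exact ((h1.inner measurable_const).mul h2).add_const _
  set k : ℝ → ℝ := I.indicator fun _ => ε⁻¹ with hk
  have hkm : Measurable k := measurable_const.indicator hIm
  have hk0 : ∀ r, 0 ≤ k r := fun r => Set.indicator_nonneg (fun _ _ => by positivity) r
  have hkint : ∫ r, k r * r ^ 0 ∂(radialMeasure d) = ε⁻¹ * (radialMeasure d).real I := by
    simp only [pow_zero, mul_one, hk]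
    rw [integral_indicator_const _ hIm, smul_eq_mul, mul_comm]
  have hpt : ∀ w, k (ellNorm 1 w) * inner ℝ (signVec w) v * f w ≤ k (ellNorm 1 w) * φ w := by
    intro w
    rw [mul_assoc]
    by_cases hw : ellNorm 1 w ∈ I
    · refine mul_le_mul_of_nonneg_left ?_ (hk0 _)
      have h1 : 1 ≤ ellNorm 1 w := hw.1
      have hfd : |f w - f ((ellNorm 1 w)⁻¹ • w)| ≤ K * ε := by
        have h2 := hL.dist_le_mul w ((ellNorm 1 w)⁻¹ • w)
        rw [Real.dist_eq, dist_eq_norm] at h2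
        refine h2.trans (mul_le_mul_of_nonneg_left ?_ K.coe_nonneg)
        have h3 : w - (ellNorm 1 w)⁻¹ • w = (1 - (ellNorm 1 w)⁻¹) • w := by
          rw [sub_smul, one_smul]
        have h4 : (ellNorm 1 w)⁻¹ ≤ 1 := inv_le_one_of_one_le₀ h1
        rw [h3, norm_smul, Real.norm_of_nonneg (by linarith)]
        calc (1 - (ellNorm 1 w)⁻¹) * ‖w‖ ≤ (1 - (ellNorm 1 w)⁻¹) * ellNorm 1 w := by
              exact mul_le_mul_of_nonneg_left (norm_le_ellNorm_one w) (by linarith)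
          _ = ellNorm 1 w - 1 := by field_simp
          _ ≤ ε := by linarith [hw.2]
      have hs := inner_le_ellNorm_one (y := v) (abs_signVec_le w)
      have h5 : inner ℝ (signVec w) v * (f w - f ((ellNorm 1 w)⁻¹ • w)) ≤
          ellNorm 1 v * (K * ε) := by
        refine (le_abs_self _).trans ?_
        rw [abs_mul]
        exact mul_le_mul hs hfd (abs_nonneg _) (ellNorm_one_nonneg v)
      simp only [hφ]
      nlinarith
    · simp [hk, Set.indicator_of_notMem hw]
  have hφb : ∀ w, |φ w| ≤ ellNorm 1 v * (|f 0| + K) + ε * (K * ellNorm 1 v) := by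
    intro w
    have hs := inner_le_ellNorm_one (y := v) (abs_signVec_le w)
    have hv := ellNorm_one_nonneg v
    have h2 : |f ((ellNorm 1 w)⁻¹ • w)| ≤ |f 0| + K := by
      have h3 := hL.dist_le_mul ((ellNorm 1 w)⁻¹ • w) 0
      rw [Real.dist_eq, dist_eq_norm, sub_zero, norm_smul, norm_inv,
        Real.norm_of_nonneg (ellNorm_one_nonneg w)] at h3
      have h4 : (ellNorm 1 w)⁻¹ * ‖w‖ ≤ 1 := by
        rw [← div_eq_inv_mul]
        exact div_le_one_of_le₀ (norm_le_ellNorm_one w) (ellNorm_one_nonneg w)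
      have h5 := abs_sub_abs_le_abs_sub (f ((ellNorm 1 w)⁻¹ • w)) (f 0)
      have h6 : (K : ℝ) * ((ellNorm 1 w)⁻¹ * ‖w‖) ≤ K * 1 :=
        mul_le_mul_of_nonneg_left h4 K.coe_nonneg
      linarith
    simp only [hφ]
    refine (abs_add_le _ _).trans (add_le_add ?_ ?_)
    · rw [abs_mul]
      exact mul_le_mul hs h2 (abs_nonneg _) hv
    · rw [abs_of_nonneg (by positivity)]
  have hki : Integrable fun w : Vec d => k (ellNorm 1 w) := by
    have : Integrable (Z.indicator fun _ : Vec d => ε⁻¹) :=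
      (integrable_indicator_iff hZm).2 (integrableOn_const hZt)
    exact this
  have s4 : ∫ w, lineDeriv ℝ g w (-v) * f w ≤ ∫ w, k (ellNorm 1 w) * φ w := by
    have e : ∀ᵐ w : Vec d, lineDeriv ℝ g w (-v) * f w =
        k (ellNorm 1 w) * inner ℝ (signVec w) v * f w := by
      filter_upwards [ae_apply_ne_zero, ae_ellNorm_one_ne hd 1, ae_ellNorm_one_ne hd (1 + ε)]
        with w h1 h2 h3
      rw [hg, lineDeriv_cutoff hε h1 h2 h3 v]
    have hφi : Integrable fun w : Vec d => k (ellNorm 1 w) * φ w :=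
      hki.mul_bdd hφm.aestronglyMeasurable (.of_forall hφb)
    have hli : Integrable fun w => lineDeriv ℝ g w (-v) * f w := by
      have hkc : Integrable fun w : Vec d => k (ellNorm 1 w) *
          (inner ℝ (signVec w) v * f w) := by
        have hfm : AEStronglyMeasurable (fun w : Vec d => inner ℝ (signVec w) v * f w) volume :=
          (((measurable_signVec (d := d)).inner measurable_const).mul
            hL.continuous.measurable).aestronglyMeasurable
        refine ((hki.mul_const (ellNorm 1 v * (|f 0| + K * (1 + ε))))).mono'
          (hki.aestronglyMeasurable.mul hfm) (.of_forall fun w => ?_)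
        rw [norm_mul, Real.norm_of_nonneg (hk0 _)]
        by_cases hw : ellNorm 1 w ∈ I
        · refine mul_le_mul_of_nonneg_left ?_ (hk0 _)
          rw [norm_mul]
          refine mul_le_mul (inner_le_ellNorm_one (abs_signVec_le w)) ?_ (norm_nonneg _)
            (ellNorm_one_nonneg v)
          have h3 := hL.dist_le_mul w 0
          rw [Real.dist_eq, dist_eq_norm, sub_zero] at h3
          have h5 := abs_sub_abs_le_abs_sub (f w) (f 0)
          have h6 : (K : ℝ) * ‖w‖ ≤ K * (1 + ε) :=
            mul_le_mul_of_nonneg_left ((norm_le_ellNorm_one w).trans hw.2.le) K.coe_nonneg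
          rw [Real.norm_eq_abs]
          linarith
        · simp [hk, Set.indicator_of_notMem hw]
      refine hkc.congr ?_
      filter_upwards [e] with w hw
      rw [hw, mul_assoc]
    refine integral_mono_ae hli hφi ?_
    filter_upwards [e] with w hw
    rw [hw]
    exact hpt w
  have s5 : ∫ w, k (ellNorm 1 w) * φ w = ε⁻¹ * (radialMeasure d).real I *
      (∫ u, inner ℝ (signVec u) v * f u ∂(sphereLaw d) + ε * (K * ellNorm 1 v)) := by
    rw [integral_radial_mul_homogeneous hd hkm hφm 0 ?_, hkint]
    · congr 1
      have hi : Integrable (fun u => inner ℝ (signVec u) v * f ((ellNorm 1 u)⁻¹ • u))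
          (sphereLaw d) := by
        refine ((integrable_const (ellNorm 1 v * (|f 0| + K) + ε * (K * ellNorm 1 v))).mono'
          hφm.aestronglyMeasurable (.of_forall hφb)).sub
            (integrable_const (ε * (K * ellNorm 1 v))) |>.congr (.of_forall fun u => ?_)
        simp [hφ]
      simp only [hφ]
      rw [integral_add hi (integrable_const _)]
      congr 1
      · refine integral_congr_ae ?_
        filter_upwards [ae_sphereLaw_ellNorm_one d] with u hu
        rw [hu, inv_one, one_smul]
      · simp
    · intro c hc w
      simp only [hφ]
      rw [signVec_smul hc, ellNorm_smul, abs_of_pos hc, smul_smul, mul_inv, pow_zero, one_mul]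
      congr 4
      field_simp
  linarith

/-! ### The gradient inequality for the smoothed function -/

open Filter Topology in
/-- The gradient inequality for the smoothing over the `ℓ_1`-ball: the surface integral against the
sign dominates the increments of a convex function averaged over the ball. -/
theorem integral_ball_sub_le_sphere {d : ℕ} (hd : d ≠ 0) [IsProbabilityMeasure (sphereLaw d)]
    {C : ℝ} (hC : ∀ g : ℝ → ℝ, Measurable g →
      ∫ r, g r ∂(radialMeasure d) = C * ∫ r in Set.Ioi 0, r ^ (d - 1) * g r)
    {f : Vec d → ℝ} (hf : ConvexOn ℝ Set.univ f) {K : NNReal} (hL : LipschitzWith K f) (v : Vec d) :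
    ∫ w in ellNorm 1 ⁻¹' (Set.Ico 0 1), (f w - f (w - v)) ≤
      C * ∫ u, inner ℝ (signVec u) v * f u ∂(sphereLaw d) := by
  set A := ∫ u, inner ℝ (signVec u) v * f u ∂(sphereLaw d)
  have hd0 : (d : ℝ) ≠ 0 := by exact_mod_cast hd
  have hder : HasDerivAt (fun r : ℝ => C * (r ^ d / d)) C 1 := by
    have := ((hasDerivAt_pow d (1 : ℝ)).div_const (d : ℝ)).const_mul C
    simpa [hd0] using this
  have t1 : Tendsto (fun ε : ℝ => ε⁻¹ * (radialMeasure d).real (Set.Ico 1 (1 + ε))) (𝓝[>] 0)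
      (𝓝 C) := by
    refine hder.tendsto_slope_zero_right.congr' ?_
    filter_upwards [self_mem_nhdsWithin] with ε hε
    rw [radialMeasure_real_Ico hC hd one_pos (by linarith [show (0 : ℝ) < ε from hε])]
    simp only [one_pow, smul_eq_mul]; ring
  have t2 : Tendsto (fun ε : ℝ => ε) (𝓝[>] 0) (𝓝 0) := tendsto_nhdsWithin_of_tendsto_nhds tendsto_id
  have t3 : Tendsto (fun ε : ℝ => (radialMeasure d).real (Set.Ico 1 (1 + ε))) (𝓝[>] 0)
      (𝓝 0) := by
    have := t2.mul t1
    rw [zero_mul] at this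
    refine this.congr' ?_
    filter_upwards [self_mem_nhdsWithin] with ε hε
    have : ε ≠ 0 := (show (0 : ℝ) < ε from hε).ne'
    field_simp
  have t4 := (t3.mul_const (K * ‖v‖)).add
    (t1.mul ((t2.mul_const (K * ellNorm 1 v)).const_add A))
  rw [zero_mul, zero_add, zero_mul, add_zero] at t4
  refine ge_of_tendsto t4 ?_
  filter_upwards [self_mem_nhdsWithin] with ε hε
  exact integral_ball_sub_le_shell hd hf hL v hε

/-- Integrals over the unit `ℓ_1`-ball of homogeneous functions. The constant `C` is the one of
`exists_radialMeasure_integral`. -/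
theorem integral_ball_homogeneous {d : ℕ} (hd : d ≠ 0) [IsProbabilityMeasure (sphereLaw d)]
    {C : ℝ} (hC : ∀ g : ℝ → ℝ, Measurable g →
      ∫ r, g r ∂(radialMeasure d) = C * ∫ r in Set.Ioi 0, r ^ (d - 1) * g r)
    {φ : Vec d → ℝ} (hφ : Measurable φ) (j : ℕ)
    (hom : ∀ c : ℝ, 0 < c → ∀ w, φ (c • w) = c ^ j * φ w) :
    ∫ w in ellNorm 1 ⁻¹' (Set.Ico 0 1), φ w = C / (d + j) * ∫ u, φ u ∂(sphereLaw d) := by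
  have hBm : MeasurableSet (ellNorm 1 ⁻¹' (Set.Ico 0 1) : Set (Vec d)) :=
    measurable_ellNorm 1 measurableSet_Ico
  have hkm : Measurable ((Set.Ico (0 : ℝ) 1).indicator (1 : ℝ → ℝ)) :=
    measurable_one.indicator measurableSet_Ico
  have h1 := integral_radial_mul_homogeneous hd hkm hφ j hom
  have h2 : ∫ w : Vec d, (Set.Ico (0 : ℝ) 1).indicator (1 : ℝ → ℝ) (ellNorm 1 w) * φ w =
      ∫ w in ellNorm 1 ⁻¹' (Set.Ico 0 1), φ w := by
    rw [← integral_indicator hBm]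
    refine integral_congr_ae (.of_forall fun w => ?_)
    by_cases hw : ellNorm 1 w ∈ Set.Ico (0 : ℝ) 1
    · simp only [Set.indicator_of_mem hw]
      rw [Set.indicator_of_mem (show w ∈ ellNorm 1 ⁻¹' (Set.Ico 0 1) from hw)]
      simp
    · simp only [Set.indicator_of_notMem hw]
      rw [Set.indicator_of_notMem (show w ∉ ellNorm 1 ⁻¹' (Set.Ico 0 1) from hw)]
      simp
  rw [← h2, h1, hC (fun r => (Set.Ico (0 : ℝ) 1).indicator (1 : ℝ → ℝ) r * r ^ j)
    (hkm.mul (by fun_prop))]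
  congr 1
  have e : ∀ r, r ^ (d - 1) * ((Set.Ico (0 : ℝ) 1).indicator (1 : ℝ → ℝ) r * r ^ j) =
      (Set.Ico (0 : ℝ) 1).indicator (fun r => r ^ (d - 1 + j)) r := fun r => by
    by_cases hr : r ∈ Set.Ico (0 : ℝ) 1
    · simp only [Set.indicator_of_mem hr, Pi.one_apply]; ring
    · simp only [Set.indicator_of_notMem hr]; ring
  simp_rw [e]
  rw [setIntegral_indicator measurableSet_Ico,
    show Set.Ioi (0 : ℝ) ∩ Set.Ico 0 1 = Set.Ioo 0 1 by
      ext r; simp only [Set.mem_inter_iff, Set.mem_Ioi, Set.mem_Ico, Set.mem_Ioo]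
      exact ⟨fun h => ⟨h.1, h.2.2⟩, fun h => ⟨h.1, h.1.le, h.2⟩⟩,
    ← integral_Ioc_eq_integral_Ioo, ← intervalIntegral.integral_of_le zero_le_one, integral_pow]
  have : ((d - 1 + j : ℕ) : ℝ) + 1 = d + j := by
    rw [Nat.cast_add, Nat.cast_sub (by omega)]; push_cast; ring
  rw [this, div_eq_mul_inv C]
  simp

/-- The set where a coordinate vanishes is a cone of Lebesgue measure zero. -/
theorem ae_sphereLaw_apply_ne_zero {d : ℕ} (hd : d ≠ 0) [IsProbabilityMeasure (sphereLaw d)] :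
    ∀ᵐ u ∂(sphereLaw d), ∀ i, u i ≠ 0 := by
  refine ae_all_iff.2 fun i => ?_
  obtain ⟨C, hC0, hC⟩ := exists_radialMeasure_integral hd
  set Z : Set (Vec d) := {u | u i = 0} with hZ
  have hZm : MeasurableSet Z := measurableSet_eq_fun (by fun_prop) measurable_const
  have h := integral_ball_homogeneous hd (fun g hg => (hC g hg).1)
    (φ := Z.indicator 1) (measurable_one.indicator hZm) 0 fun c hc w => by
      by_cases hw : w i = 0 <;> simp [hZ, Set.indicator, hw, hc.ne']
  have h0 : ∫ w in ellNorm 1 ⁻¹' (Set.Ico 0 1), Z.indicator (1 : Vec d → ℝ) w = 0 := by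
    refine integral_eq_zero_of_ae (ae_restrict_of_ae ?_)
    filter_upwards [ae_apply_ne_zero (d := d)] with w hw
    simp [hZ, Set.indicator, hw i]
  have hd0 : (0 : ℝ) < d := by exact_mod_cast Nat.pos_of_ne_zero hd
  rw [h0, integral_indicator_one hZm] at h
  have h1 : (sphereLaw d).real Z = 0 := by
    rcases mul_eq_zero.1 h.symm with h | h
    · exact absurd h (by positivity)
    · exact h
  rw [ae_iff]
  simpa using (measureReal_eq_zero_iff).1 h1

theorem signVec_neg {d : ℕ} {u : Vec d} (hu : ∀ i, u i ≠ 0) : signVec (-u) = -signVec u := by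
  ext i
  have e : (-u) i = -(u i) := rfl
  have e' : (-signVec u) i = -(signVec u i) := rfl
  rw [e', signVec_apply, signVec_apply, e]
  rcases lt_or_gt_of_ne (hu i) with h | h
  · rw [if_pos (by linarith), if_neg (by linarith), neg_neg]
  · rw [if_neg (by linarith), if_pos h.le]

theorem lipschitzWith_of_ellNorm {d : ℕ} {q : ENNReal} (hq : 1 ≤ q) {f : Vec d → ℝ} {L : ℝ}
    (hL : 0 ≤ L) (hf : ∀ x x', |f x - f x'| ≤ L * ellNorm q (x - x')) :
    LipschitzWith (L * √d).toNNReal f :=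
  LipschitzWith.of_dist_le_mul fun x y => by
    rw [Real.coe_toNNReal _ (by positivity), Real.dist_eq, dist_eq_norm, mul_assoc]
    exact (hf x y).trans (mul_le_mul_of_nonneg_left
      ((ellNorm_anti le_rfl hq _).trans (ellNorm_one_le_sqrt_mul_norm _)) hL)

theorem continuous_of_ellNorm {d : ℕ} {q : ENNReal} (hq : 1 ≤ q) {f : Vec d → ℝ} {L : ℝ}
    (hL : 0 ≤ L) (hf : ∀ x x', |f x - f x'| ≤ L * ellNorm q (x - x')) : Continuous f :=
  (lipschitzWith_of_ellNorm hq hL hf).continuous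

section
variable {d : ℕ} {q : ENNReal} {f : Vec d → ℝ} {L h : ℝ}

/-- The one-point `ℓ_1`-randomized gradient estimate is a subgradient up to the bias
`L h b_q(d)`. -/
theorem sub_sub_bias_le (hd : 3 ≤ d) [IsProbabilityMeasure (sphereLaw d)] (hq : 1 ≤ q)
    (hf : ConvexOn ℝ Set.univ f) (hL : 0 ≤ L) (hfL : ∀ x x', |f x - f x'| ≤ L * ellNorm q (x - x'))
    (hh : 0 < h) (x v : Vec d) :
    f x - f (x - v) - L * h * bias q d ≤
      d / h * ∫ u, inner ℝ (signVec u) v * f (x + h • u) ∂(sphereLaw d) := by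
  have hd' : d ≠ 0 := by omega
  have hd0 : (0 : ℝ) < d := by exact_mod_cast (by omega : 0 < d)
  have : Fact (1 ≤ q) := ⟨hq⟩
  obtain ⟨C, hC0, hC⟩ := exists_radialMeasure_integral hd'
  have hC' := fun g hg => (hC g hg).1
  set F : Vec d → ℝ := fun u => f (x + h • u) with hF
  have hFc : ConvexOn ℝ Set.univ F := ⟨convex_univ, fun a _ b _ s t hs ht hst => by
    have e : x + h • (s • a + t • b) = s • (x + h • a) + t • (x + h • b) := by
      have : x = (s + t) • x := by rw [hst, one_smul]
      nth_rewrite 1 [this]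
      module
    simp only [hF, e]
    exact hf.2 (Set.mem_univ _) (Set.mem_univ _) hs ht hst⟩
  have hFL : ∀ u u', |F u - F u'| ≤ L * h * ellNorm q (u - u') := fun u u' => by
    refine (hfL _ _).trans_eq ?_
    rw [add_sub_add_left_eq_sub, ← smul_sub, ellNorm_smul, abs_of_pos hh]; ring
  have hFlip := lipschitzWith_of_ellNorm hq (by positivity) hFL
  set B : Set (Vec d) := ellNorm 1 ⁻¹' (Set.Ico 0 1) with hB
  have hBm : MeasurableSet B := measurable_ellNorm 1 measurableSet_Ico
  have hBt : volume B ≠ ⊤ := (volume_l1_lt_top measurableSet_Ico (Metric.isBounded_Ico 0 1)).ne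
  have hBv : volume.real B = C / d := by
    have := integral_ball_homogeneous hd' hC' (φ := fun _ => 1) measurable_const 0 (by simp)
    simpa using this
  have hBn : ∀ w ∈ B, ‖w‖ ≤ 1 := fun w hw => (norm_le_ellNorm_one w).trans hw.2.le
  have hBi : ∀ g : Vec d → ℝ, Continuous g → IntegrableOn g B := fun g hg => by
    refine (hg.continuousOn.integrableOn_compact (isCompact_closedBall (0 : Vec d) 1)).mono_set
      fun w hw => ?_
    rw [mem_closedBall_zero_iff]; exact hBn w hw
  have main := integral_ball_sub_le_sphere hd' hC' hFc hFlip (h⁻¹ • v)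
  have hFcont := hFlip.continuous
  have hFcont' : Continuous fun w => F (w - h⁻¹ • v) := by fun_prop
  rw [integral_sub (hBi F hFcont) (hBi _ hFcont')] at main
  -- the averages over the ball against the values at the centres
  have low : C / d * f x ≤ ∫ w in B, F w := by
    have hneg : ∫ w in B, F (-w) = ∫ w in B, F w := by
      have h1 : MeasurePreserving (Neg.neg : Vec d → Vec d) (volume.restrict B)
          (volume.restrict B) := by
        have := (Measure.measurePreserving_neg (volume : Measure (Vec d))).restrict_preimage hBm
        convert this using 2
        ext w
        simp [hB, ellNorm_neg]
      exact h1.integral_comp (MeasurableEquiv.neg (Vec d)).measurableEmbedding F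
    -- convexity on the pair `w`, `-w`, whose midpoint is the centre
    have h2 : ∫ w in B, 2 * f x ≤ ∫ w in B, (F w + F (-w)) := by
      refine integral_mono (integrableOn_const hBt) ((hBi F hFcont).add
        (hBi _ (hFcont.comp continuous_neg))) fun w => ?_
      have := hFc.2 (Set.mem_univ w) (Set.mem_univ (-w)) (show (0 : ℝ) ≤ 1 / 2 by norm_num)
        (show (0 : ℝ) ≤ 1 / 2 by norm_num) (by norm_num)
      have e : (1 / 2 : ℝ) • w + (1 / 2 : ℝ) • (-w) = 0 := by simp
      rw [e] at this
      simp only [hF, smul_zero, add_zero, smul_eq_mul] at this ⊢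
      linarith
    rw [integral_add (hBi F hFcont) (hBi (fun w => F (-w)) (hFcont.comp continuous_neg)), hneg,
      setIntegral_const, hBv, smul_eq_mul] at h2
    linarith
  have up : ∫ w in B, F (w - h⁻¹ • v) ≤ C / d * (f (x - v) + L * h * bias q d) := by
    have h1 : ∫ w in B, F (w - h⁻¹ • v) ≤ ∫ w in B, (f (x - v) + L * h * ellNorm q w) := by
      refine integral_mono (hBi _ hFcont') (hBi _ (by have := continuous_ellNorm q (d := d); fun_prop))
        fun w => ?_
      have h2 := hfL (x + h • (w - h⁻¹ • v)) (x - v)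
      have e : x + h • (w - h⁻¹ • v) - (x - v) = h • w := by
        rw [smul_sub, smul_smul, mul_inv_cancel₀ hh.ne', one_smul]; abel
      rw [e, ellNorm_smul, abs_of_pos hh, abs_le] at h2
      simp only [hF]
      linarith [h2.2]
    have h3 := integral_ball_homogeneous hd' hC' (measurable_ellNorm q) 1
      fun c hc w => by rw [ellNorm_smul, abs_of_pos hc, pow_one]
    have hcn := continuous_ellNorm q (d := d)
    rw [integral_add (hBi (fun _ => f (x - v)) continuous_const)
      (hBi (fun w => L * h * ellNorm q w) (by fun_prop)), setIntegral_const, hBv,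
      integral_const_mul, h3, smul_eq_mul, Nat.cast_one] at h1
    have h4 := integral_sphereLaw_ellNorm_le hd hq
    have h5 : C / (d + 1) * ∫ u, ellNorm q u ∂(sphereLaw d) ≤ C / d * bias q d := by
      calc _ = C / d * (d / (d + 1) * ∫ u, ellNorm q u ∂(sphereLaw d)) := by field_simp
        _ ≤ _ := by gcongr
    have h6 := mul_le_mul_of_nonneg_left h5 (show 0 ≤ L * h by positivity)
    linarith
  have e : ∫ u, inner ℝ (signVec u) (h⁻¹ • v) * F u ∂(sphereLaw d) =
      h⁻¹ * ∫ u, inner ℝ (signVec u) v * f (x + h • u) ∂(sphereLaw d) := by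
    rw [← integral_const_mul]
    refine integral_congr_ae (.of_forall fun u => ?_)
    simp only [hF, inner_smul_right]; ring
  rw [e] at main
  set A := ∫ u, inner ℝ (signVec u) v * f (x + h • u) ∂(sphereLaw d)
  have h7 : C / d * (f x - f (x - v) - L * h * bias q d) ≤ C / d * (d / h * A) := by
    have e2 : C / d * (d / h * A) = C * (h⁻¹ * A) := by field_simp
    rw [e2]
    linarith
  exact le_of_mul_le_mul_left h7 (by positivity)

end

/-! ### Moments of the two-point gradient estimate -/

section
variable {d : ℕ} {q : ENNReal} {f : Vec d → ℝ} {L h : ℝ}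

theorem abs_sub_le_of_ellNorm_one (hq : 1 ≤ q) (hL : 0 ≤ L)
    (hfL : ∀ x x', |f x - f x'| ≤ L * ellNorm q (x - x')) (hh : 0 ≤ h) (x : Vec d) {u : Vec d}
    (hu : ellNorm 1 u = 1) : |f (x + h • u) - f (x - h • u)| ≤ 2 * L * h := by
  have : Fact (1 ≤ q) := ⟨hq⟩
  have h1 := hfL (x + h • u) (x - h • u)
  have e : x + h • u - (x - h • u) = (2 * h) • u := by module
  rw [e, ellNorm_smul, abs_of_nonneg (show 0 ≤ 2 * h by positivity)] at h1
  have h2 : ellNorm q u ≤ 1 := hu ▸ ellNorm_anti le_rfl hq u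
  have h3 : L * (2 * h * ellNorm q u) ≤ L * (2 * h * 1) := by gcongr
  linarith

theorem integrable_inner_signVec_mul [IsProbabilityMeasure (sphereLaw d)]
    (hq : 1 ≤ q) (hL : 0 ≤ L) (hfL : ∀ x x', |f x - f x'| ≤ L * ellNorm q (x - x')) (h : ℝ)
    (x v : Vec d) :
    Integrable (fun u => inner ℝ (signVec u) v * f (x + h • u)) (sphereLaw d) := by
  have : Fact (1 ≤ q) := ⟨hq⟩
  have hc := continuous_of_ellNorm hq hL hfL
  have hm := measurable_signVec (d := d)
  refine Integrable.of_bound (C := ellNorm 1 v * (|f x| + L * |h|)) (by fun_prop) ?_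
  filter_upwards [ae_sphereLaw_ellNorm_one d] with u hu
  rw [norm_mul, Real.norm_eq_abs, Real.norm_eq_abs]
  refine mul_le_mul (inner_le_ellNorm_one (abs_signVec_le u)) ?_ (abs_nonneg _)
    (ellNorm_one_nonneg v)
  have h1 := hfL (x + h • u) x
  rw [add_sub_cancel_left, ellNorm_smul] at h1
  have h2 : ellNorm q u ≤ 1 := hu ▸ ellNorm_anti le_rfl hq u
  have h3 : L * (|h| * ellNorm q u) ≤ L * (|h| * 1) := by gcongr
  have h4 := abs_sub_abs_le_abs_sub (f (x + h • u)) (f x)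
  linarith

/-- The two-point `ℓ_1`-randomized gradient estimate, with noise `a`, `b`, is on average a
subgradient up to the bias `L h b_q(d)`: by the symmetry of the sphere the noise averages out. -/
theorem sub_sub_bias_le_integral (hd : 3 ≤ d) [IsProbabilityMeasure (sphereLaw d)] (hq : 1 ≤ q)
    (hf : ConvexOn ℝ Set.univ f) (hL : 0 ≤ L) (hfL : ∀ x x', |f x - f x'| ≤ L * ellNorm q (x - x'))
    (hh : 0 < h) (x v : Vec d) (a b : ℝ) :
    f x - f (x - v) - L * h * bias q d ≤
      ∫ u, d / (2 * h) * ((f (x + h • u) + a) - (f (x - h • u) + b)) * inner ℝ (signVec u) v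
        ∂(sphereLaw d) := by
  have hi := integrable_inner_signVec_mul hq hL hfL
  have hd' : d ≠ 0 := by omega
  set I := ∫ u, inner ℝ (signVec u) v * f (x + h • u) ∂(sphereLaw d) with hI
  have hneg : ∀ᵐ u ∂(sphereLaw d),
      inner ℝ (signVec (-u)) v = -inner ℝ (signVec u) v := by
    filter_upwards [ae_sphereLaw_apply_ne_zero hd'] with u hu
    rw [signVec_neg hu, inner_neg_left]
  have h1 : ∫ u, inner ℝ (signVec u) v * f (x + (-h) • u) ∂(sphereLaw d) = -I := by
    rw [hI, ← (measurePreserving_neg_sphereLaw d).integral_comp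
      (MeasurableEquiv.neg (Vec d)).measurableEmbedding, ← integral_neg]
    refine integral_congr_ae ?_
    filter_upwards [hneg] with u hu
    rw [hu, smul_neg, neg_smul, neg_neg]; ring
  have hsi : Integrable (fun u => inner ℝ (signVec u) v) (sphereLaw d) := by
    have hm := measurable_signVec (d := d)
    exact Integrable.of_bound (C := ellNorm 1 v) (by fun_prop)
      (.of_forall fun u => inner_le_ellNorm_one (abs_signVec_le u))
  have h0 : ∫ u, inner ℝ (signVec u) v ∂(sphereLaw d) = 0 := by
    have : ∫ u, inner ℝ (signVec u) v ∂(sphereLaw d) =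
        -∫ u, inner ℝ (signVec u) v ∂(sphereLaw d) := by
      rw [← integral_neg]
      nth_rewrite 1 [← (measurePreserving_neg_sphereLaw d).integral_comp
        (MeasurableEquiv.neg (Vec d)).measurableEmbedding]
      exact integral_congr_ae hneg
    linarith
  have key : ∫ u, d / (2 * h) * ((f (x + h • u) + a) - (f (x - h • u) + b)) *
      inner ℝ (signVec u) v ∂(sphereLaw d) = d / h * I := by
    have e : ∀ u : Vec d, d / (2 * h) * ((f (x + h • u) + a) - (f (x - h • u) + b)) *
        inner ℝ (signVec u) v =
        d / (2 * h) * (inner ℝ (signVec u) v * f (x + h • u) -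
          inner ℝ (signVec u) v * f (x + (-h) • u) + (a - b) * inner ℝ (signVec u) v) := fun u => by
      rw [neg_smul, ← sub_eq_add_neg]; ring
    simp_rw [e]
    have hdiff : Integrable (fun u => inner ℝ (signVec u) v * f (x + h • u) -
        inner ℝ (signVec u) v * f (x + (-h) • u)) (sphereLaw d) := (hi h x v).sub (hi (-h) x v)
    rw [integral_const_mul, integral_add hdiff (hsi.const_mul _),
      integral_sub (hi h x v) (hi (-h) x v), integral_const_mul, h0, h1]
    field_simp
    ring
  rw [key]
  exact sub_sub_bias_le hd hq hf hL hfL hh x v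

/-- The second moment of the two-point gradient estimate. -/
theorem integral_sq_estimate_le (hd : 3 ≤ d) [IsProbabilityMeasure (sphereLaw d)] (hq : 1 ≤ q)
    (hL : 0 ≤ L) (hfL : ∀ x x', |f x - f x'| ≤ L * ellNorm q (x - x'))
    (hh : 0 < h) (x : Vec d) (a b : ℝ) :
    ∫ u, (d / (2 * h) * ((f (x + h • u) + a) - (f (x - h • u) + b))) ^ 2 ∂(sphereLaw d) ≤
      12 * (1 + √2) ^ 2 * L ^ 2 * (d : ℝ) ^ (2 * recip (min q 2) - 1) +
        d ^ 2 / (4 * h ^ 2) * (a - b) ^ 2 := by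
  have : Fact (1 ≤ q) := ⟨hq⟩
  have hd' : d ≠ 0 := by omega
  have hd0 : (0 : ℝ) < d := by exact_mod_cast (by omega : 0 < d)
  have hc := continuous_of_ellNorm hq hL hfL
  set G : Vec d → ℝ := fun u => f (x + h • u) - f (x - h • u) with hG
  set D : ℝ := (d : ℝ) ^ (recip (min q 2) - 1 / 2) with hD
  have hD2 : D ^ 2 = (d : ℝ) ^ (2 * recip (min q 2) - 1) := by
    rw [hD, ← Real.rpow_natCast, ← Real.rpow_mul hd0.le]; congr 1; push_cast; ring
  have hodd : ∀ u, G (-u) = -G u := fun u => by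
    simp only [hG, smul_neg, sub_neg_eq_add, ← sub_eq_add_neg]; ring
  have hGc : Continuous G := by fun_prop
  have hGb : ∀ᵐ u ∂(sphereLaw d), |G u| ≤ 2 * L * h := by
    filter_upwards [ae_sphereLaw_ellNorm_one d] with u hu
    exact abs_sub_le_of_ellNorm_one hq hL hfL hh.le x hu
  have hGi : Integrable G (sphereLaw d) :=
    Integrable.of_bound (C := 2 * L * h) hGc.aestronglyMeasurable hGb
  have hG2 : Integrable (fun u => G u ^ 2) (sphereLaw d) :=
    Integrable.of_bound (C := (2 * L * h) ^ 2) (hGc.pow 2).aestronglyMeasurable (by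
      filter_upwards [hGb] with u hu
      rw [norm_pow]
      exact pow_le_pow_left₀ (norm_nonneg _) hu 2)
  have hGL : ∀ u v, |G u - G v| ≤ 2 * L * h * D * ‖u - v‖ := fun u v => by
    have h1 := hfL (x + h • u) (x + h • v)
    have h2 := hfL (x - h • v) (x - h • u)
    have e1 : x + h • u - (x + h • v) = h • (u - v) := by module
    have e2 : x - h • v - (x - h • u) = h • (u - v) := by module
    rw [e1, ellNorm_smul, abs_of_pos hh] at h1
    rw [e2, ellNorm_smul, abs_of_pos hh] at h2
    have h3 : L * (h * ellNorm q (u - v)) ≤ L * (h * (D * ‖u - v‖)) := by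
      gcongr
      exact ellNorm_le_norm hq _
    have h4 : G u - G v = (f (x + h • u) - f (x + h • v)) + (f (x - h • v) - f (x - h • u)) := by
      simp only [hG]; ring
    rw [h4]
    refine (abs_add_le _ _).trans ?_
    linarith
  have hvar := integral_sphereLaw_sq_le hd' (by positivity) hGL hodd
  have h0 := integral_sphereLaw_of_odd hodd
  have e : ∀ u, (d / (2 * h) * ((f (x + h • u) + a) - (f (x - h • u) + b))) ^ 2 =
      d ^ 2 / (4 * h ^ 2) * (G u ^ 2 + 2 * (a - b) * G u + (a - b) ^ 2) := fun u => by
    simp only [hG]; ring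
  simp_rw [e]
  have hsum : Integrable (fun u => G u ^ 2 + 2 * (a - b) * G u) (sphereLaw d) :=
    hG2.add (hGi.const_mul _)
  rw [integral_const_mul, integral_add hsum (integrable_const _),
    integral_add hG2 (hGi.const_mul _), integral_const_mul, h0, integral_const, ← hD2]
  simp only [probReal_univ, one_smul, mul_zero, add_zero]
  -- `(1 + 2√2)² = 9 + 4√2 ≤ 9 + 6√2 = 3 (1 + √2)²`
  have h5 : 4 * (1 + 2 * √2) ^ 2 * (2 * L * h * D) ^ 2 / (d * (d + 1)) ≤
      48 * (1 + √2) ^ 2 * (L * h * D) ^ 2 / d ^ 2 := by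
    have hs : √2 ^ 2 = 2 := Real.sq_sqrt (by norm_num)
    have hs0 := Real.sqrt_nonneg 2
    refine div_le_div₀ (by positivity) ?_ (by positivity) (by nlinarith)
    have : 16 * (1 + 2 * √2) ^ 2 ≤ 48 * (1 + √2) ^ 2 := by nlinarith
    calc _ = 16 * (1 + 2 * √2) ^ 2 * (L * h * D) ^ 2 := by ring
      _ ≤ _ := by gcongr
  calc _ ≤ d ^ 2 / (4 * h ^ 2) * (48 * (1 + √2) ^ 2 * (L * h * D) ^ 2 / d ^ 2 + (a - b) ^ 2) := by
        gcongr
        exact hvar.trans h5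
    _ = _ := by field_simp; ring

end

/-! ### Independence of the rounds -/

section
variable {Ω : Type*} [MeasurableSpace Ω] {P : Measure Ω} [IsProbabilityMeasure P]

/-- If `N` is independent of the pair `(A, B)`, and `A` of `B`, then `(N, A)` is independent
of `B`. -/
theorem indepFun_prodMk_left_of_indepFun {α β γ : Type*} [MeasurableSpace α] [MeasurableSpace β]
    [MeasurableSpace γ] {N : Ω → α} {A : Ω → β} {B : Ω → γ} (hN : Measurable N)
    (hA : Measurable A) (hB : Measurable B) (hNAB : IndepFun N (fun ω => (A ω, B ω)) P)
    (hAB : IndepFun A B P) : IndepFun (fun ω => (N ω, A ω)) B P := by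
  have : IsProbabilityMeasure (P.map N) := Measure.isProbabilityMeasure_map hN.aemeasurable
  have : IsProbabilityMeasure (P.map A) := Measure.isProbabilityMeasure_map hA.aemeasurable
  have : IsProbabilityMeasure (P.map B) := Measure.isProbabilityMeasure_map hB.aemeasurable
  have hNA : IndepFun N A P := hNAB.comp measurable_id measurable_fst
  rw [indepFun_iff_map_prod_eq_prod_map_map (hN.prodMk hA).aemeasurable hB.aemeasurable,
    hNA.map_prod_eq_prod_map_map hN.aemeasurable hA.aemeasurable,
    ← ((measurePreserving_prodAssoc (P.map N) (P.map A) (P.map B)).symm).map_eq,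
    ← hAB.map_prod_eq_prod_map_map hA.aemeasurable hB.aemeasurable,
    ← hNAB.map_prod_eq_prod_map_map hN.aemeasurable (hA.prodMk hB).aemeasurable,
    Measure.map_map (MeasurableEquiv.measurable _) (hN.prodMk (hA.prodMk hB))]
  rfl

/-- Integrating out an independent random variable. -/
theorem integral_indepFun_eq {β γ : Type*} [MeasurableSpace β] [MeasurableSpace γ]
    {Y : Ω → β} {Z : Ω → γ} (hY : Measurable Y) (hZ : Measurable Z) (hYZ : IndepFun Y Z P)
    {Φ : β × γ → ℝ} (hΦ : Measurable Φ) (hint : Integrable (fun ω => Φ (Y ω, Z ω)) P) :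
    Integrable (fun ω => ∫ u, Φ (Y ω, u) ∂(P.map Z)) P ∧
      ∫ ω, Φ (Y ω, Z ω) ∂P = ∫ ω, ∫ u, Φ (Y ω, u) ∂(P.map Z) ∂P := by
  have : IsProbabilityMeasure (P.map Y) := Measure.isProbabilityMeasure_map hY.aemeasurable
  have : IsProbabilityMeasure (P.map Z) := Measure.isProbabilityMeasure_map hZ.aemeasurable
  have hmap := hYZ.map_prod_eq_prod_map_map hY.aemeasurable hZ.aemeasurable
  have hi : Integrable Φ ((P.map Y).prod (P.map Z)) := by
    rw [← hmap]
    exact (integrable_map_measure hΦ.aestronglyMeasurable (hY.prodMk hZ).aemeasurable).2 hint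
  have hs : StronglyMeasurable fun y => ∫ u, Φ (y, u) ∂(P.map Z) :=
    hΦ.stronglyMeasurable.integral_prod_right'
  refine ⟨(integrable_map_measure hs.aestronglyMeasurable hY.aemeasurable).1
    hi.integral_prod_left, ?_⟩
  rw [← integral_map hY.aemeasurable hs.aestronglyMeasurable, ← integral_prod _ hi, ← hmap,
    integral_map (hY.prodMk hZ).aemeasurable hΦ.aestronglyMeasurable]

end

section
variable {d : ℕ} {Θ : Set (Vec d)} {V : Vec d → ℝ} {η h : ℕ → ℝ} {f : ℕ → Vec d → ℝ}

theorem measurable_dualVar (hA : Measurable (argmaxPoint Θ V)) (hf : ∀ t, Measurable (f t))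
    {α : Type*} [MeasurableSpace α] {ζ : ℕ → α → Vec d} {ξ' ξ'' : ℕ → α → ℝ}
    (hζ : ∀ t, Measurable (ζ t)) (hξ' : ∀ t, Measurable (ξ' t)) (hξ'' : ∀ t, Measurable (ξ'' t))
    (t : ℕ) : Measurable fun a =>
      dualVar Θ V η h f (fun s => ζ s a) (fun s => ξ' s a) (fun s => ξ'' s a) t := by
  induction t with
  | zero => exact measurable_const
  | succ t ih =>
    have := hζ t
    have := hξ' t
    have := hξ'' t
    have := hf t
    have := measurable_signVec (d := d)
    simp only [dualVar, gradEstimate]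
    fun_prop

/-- The dual variable only depends on the randomization of the earlier rounds. -/
theorem dualVar_congr {ζ ζ' : ℕ → Vec d} {ξ' ξ'' : ℕ → ℝ} {t : ℕ}
    (hζ : ∀ s < t, ζ s = ζ' s) :
    dualVar Θ V η h f ζ ξ' ξ'' t = dualVar Θ V η h f ζ' ξ' ξ'' t := by
  induction t with
  | zero => rfl
  | succ t ih =>
    simp only [dualVar, ih fun s hs => hζ s (hs.trans t.lt_succ_self), hζ t t.lt_succ_self]

/-- The state of the algorithm at the beginning of a round, together with the noises of the round,
is independent of the randomization drawn in that round. -/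
theorem indepFun_dualVar {Ω : Type*} [MeasurableSpace Ω] {P : Measure Ω} [IsProbabilityMeasure P]
    (hA : Measurable (argmaxPoint Θ V)) (hf : ∀ t, Measurable (f t))
    {ζ : ℕ → Ω → Vec d} {ξ' ξ'' : ℕ → Ω → ℝ}
    (hζ : ∀ t, Measurable (ζ t)) (hξ' : ∀ t, Measurable (ξ' t)) (hξ'' : ∀ t, Measurable (ξ'' t))
    (hζindep : iIndepFun ζ P)
    (hξindep : IndepFun (fun ω t => (ξ' t ω, ξ'' t ω)) (fun ω t => ζ t ω) P) (t : ℕ) :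
    IndepFun (fun ω => (dualVar Θ V η h f (fun s => ζ s ω) (fun s => ξ' s ω)
      (fun s => ξ'' s ω) t, ξ' t ω, ξ'' t ω)) (ζ t) P := by
  classical
  set S := Finset.range t
  have hNm : Measurable fun ω t => (ξ' t ω, ξ'' t ω) :=
    measurable_pi_lambda _ fun s => (hξ' s).prodMk (hξ'' s)
  have hAm : Measurable fun ω (s : S) => ζ s ω := measurable_pi_lambda _ fun s => hζ s
  have h1 : IndepFun (fun ω (s : S) => ζ s ω) (ζ t) P :=
    (hζindep.indepFun_finset S {t} (by simp [S]) hζ).comp measurable_id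
      (measurable_pi_apply (⟨t, Finset.mem_singleton_self t⟩ : ({t} : Finset ℕ)))
  have h2 : IndepFun (fun ω t => (ξ' t ω, ξ'' t ω)) (fun ω => (fun s : S => ζ s ω, ζ t ω)) P :=
    hξindep.comp measurable_id (φ := id)
      (ψ := fun z : ℕ → Vec d => ((fun s : S => z s), z t)) (by fun_prop)
  have h3 := indepFun_prodMk_left_of_indepFun hNm hAm (hζ t) h2 h1
  -- the dual variable is a function of the noises and of the earlier randomization only
  set Ψ : (ℕ → ℝ × ℝ) × (S → Vec d) → Vec d × ℝ × ℝ := fun a =>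
    (dualVar Θ V η h f (fun s => if hs : s ∈ S then a.2 ⟨s, hs⟩ else 0) (fun s => (a.1 s).1)
      (fun s => (a.1 s).2) t, (a.1 t).1, (a.1 t).2) with hΨ
  have hΨm : Measurable Ψ := by
    refine Measurable.prodMk (measurable_dualVar hA hf (fun s => ?_) (fun s => by fun_prop)
      (fun s => by fun_prop) t) (by fun_prop)
    by_cases hs : s ∈ S
    · simp only [hs, dif_pos]; fun_prop
    · simp only [hs, dif_neg, not_false_eq_true]; fun_prop
  have h4 := h3.comp hΨm measurable_id
  rw [Function.id_comp] at h4
  convert h4 using 1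
  funext ω
  simp only [hΨ, Function.comp]
  congr 1
  refine dualVar_congr fun s hs => ?_
  rw [dif_pos (Finset.mem_range.2 hs)]

end

/-! ### The expected regret -/

section
variable {d : ℕ} {p q : ENNReal} {Θ : Set (Vec d)} {V : Vec d → ℝ} {f : ℕ → Vec d → ℝ}
  {R L σ η h : ℝ}
  {Ω : Type*} [MeasurableSpace Ω] {P : Measure Ω} [IsProbabilityMeasure P]
  {ζ : ℕ → Ω → Vec d} {ξ' ξ'' : ℕ → Ω → ℝ}

/-- The expectation over one round: a random point `Y` and noises `a`, `b`, jointly independent of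
the randomization `Z` of the round. -/
theorem integral_round_le (hd : 3 ≤ d) (hq : 1 ≤ q) {f : Vec d → ℝ}
    (hf : ConvexOn ℝ Set.univ f) (hL : 0 ≤ L) (hfL : ∀ x x', |f x - f x'| ≤ L * ellNorm q (x - x'))
    (hh : 0 < h) (hΘ : IsCompact Θ) {Y Z : Ω → Vec d} {a b : Ω → ℝ} (hY : Measurable Y)
    (hZ : Measurable Z) (ha : Measurable a) (hb : Measurable b) (hYΘ : ∀ ω, Y ω ∈ Θ)
    (hZlaw : P.map Z = sphereLaw d) (hind : IndepFun (fun ω => (Y ω, a ω, b ω)) Z P)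
    (ha2 : Integrable (fun ω => a ω ^ 2) P ∧ ∫ ω, a ω ^ 2 ∂P ≤ σ ^ 2)
    (hb2 : Integrable (fun ω => b ω ^ 2) P ∧ ∫ ω, b ω ^ 2 ∂P ≤ σ ^ 2)
    {c : Ω → ℝ}
    (hc : ∀ ω, c ω = d / (2 * h) * ((f (Y ω + h • Z ω) + a ω) - (f (Y ω - h • Z ω) + b ω)))
    (x : Vec d) :
    (Integrable (fun ω => f (Y ω) - f x) P ∧
      Integrable (fun ω => c ω * inner ℝ (signVec (Z ω)) (Y ω - x)) P ∧
      Integrable (fun ω => c ω ^ 2) P) ∧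
    ∫ ω, (f (Y ω) - f x) ∂P ≤
      ∫ ω, c ω * inner ℝ (signVec (Z ω)) (Y ω - x) ∂P + L * h * bias q d ∧
    ∫ ω, c ω ^ 2 ∂P ≤ 12 * (1 + √2) ^ 2 * L ^ 2 * (d : ℝ) ^ (2 * recip (min q 2) - 1) +
      d ^ 2 * σ ^ 2 / h ^ 2 := by
  have : IsProbabilityMeasure (sphereLaw d) := hZlaw ▸ Measure.isProbabilityMeasure_map hZ.aemeasurable
  have : Fact (1 ≤ q) := ⟨hq⟩
  have hfc := continuous_of_ellNorm hq hL hfL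
  have hsm := measurable_signVec (d := d)
  have hYabm : Measurable fun ω => (Y ω, a ω, b ω) := hY.prodMk (ha.prodMk hb)
  have hcm : Measurable c := by
    have := hfc.measurable
    rw [show c = _ from funext hc]
    fun_prop
  have haL := (memLp_two_iff_integrable_sq ha.aestronglyMeasurable).2 ha2.1
  have hbL := (memLp_two_iff_integrable_sq hb.aestronglyMeasurable).2 hb2.1
  have hZ1 : ∀ᵐ ω ∂P, ellNorm 1 (Z ω) = 1 := by
    have := ae_sphereLaw_ellNorm_one d
    rw [← hZlaw] at this
    exact ae_of_ae_map hZ.aemeasurable this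
  -- integrability
  have i1 : Integrable (fun ω => f (Y ω) - f x) P := by
    obtain ⟨M, hM⟩ := hΘ.exists_bound_of_continuousOn (f := fun y => f y - f x) (by fun_prop)
    have := hfc.measurable
    exact Integrable.of_bound (C := M) (by fun_prop) (.of_forall fun ω => hM _ (hYΘ ω))
  have hΔm : MemLp (fun ω => f (Y ω + h • Z ω) - f (Y ω - h • Z ω)) 2 P := by
    have := hfc.measurable
    refine MemLp.of_bound (by fun_prop) (2 * L * h) ?_
    filter_upwards [hZ1] with ω hω
    exact abs_sub_le_of_ellNorm_one hq hL hfL hh.le _ hω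
  have hcL : MemLp c 2 P := by
    have := (hΔm.add (haL.sub hbL)).const_mul (d / (2 * h))
    convert this using 2 with ω
    rw [hc]
    simp only [Pi.add_apply, Pi.sub_apply]
    ring
  have i2 : Integrable (fun ω => c ω * inner ℝ (signVec (Z ω)) (Y ω - x)) P := by
    have hn := continuous_ellNorm 1 (d := d)
    obtain ⟨M, hM⟩ := hΘ.exists_bound_of_continuousOn (f := fun y => ellNorm 1 (y - x))
      (by fun_prop)
    refine (hcL.integrable one_le_two).mul_bdd (c := M) (by fun_prop) (.of_forall fun ω => ?_)
    refine (inner_le_ellNorm_one (abs_signVec_le _)).trans ?_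
    exact (le_abs_self _).trans (hM _ (hYΘ ω))
  have i3 : Integrable (fun ω => c ω ^ 2) P := hcL.integrable_sq
  refine ⟨⟨i1, i2, i3⟩, ?_, ?_⟩
  · set Φ : (Vec d × ℝ × ℝ) × Vec d → ℝ := fun w =>
      d / (2 * h) * ((f (w.1.1 + h • w.2) + w.1.2.1) - (f (w.1.1 - h • w.2) + w.1.2.2)) *
        inner ℝ (signVec w.2) (w.1.1 - x) with hΦ
    have hΦm : Measurable Φ := by
      have := hfc.measurable
      fun_prop
    have e : (fun ω => c ω * inner ℝ (signVec (Z ω)) (Y ω - x)) =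
        fun ω => Φ ((Y ω, a ω, b ω), Z ω) := by
      funext ω; rw [hc]
    obtain ⟨h1, h2⟩ := integral_indepFun_eq hYabm hZ hind hΦm (e ▸ i2)
    rw [hZlaw] at h1 h2
    rw [e, h2]
    have i5 : Integrable (fun ω => f (Y ω) - f x - L * h * bias q d) P :=
      i1.sub (integrable_const _)
    -- the point `Y - (Y - x) = x` is the one of comparison
    have h3 := integral_mono i5 h1 fun ω => by
      have := sub_sub_bias_le_integral hd hq hf hL hfL hh (Y ω) (Y ω - x) (a ω) (b ω)
      rw [sub_sub_cancel] at this
      exact this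
    rw [integral_sub i1 (integrable_const _), integral_const, probReal_univ, one_smul] at h3
    linarith
  · set Φ : (Vec d × ℝ × ℝ) × Vec d → ℝ := fun w =>
      (d / (2 * h) * ((f (w.1.1 + h • w.2) + w.1.2.1) - (f (w.1.1 - h • w.2) + w.1.2.2))) ^ 2
      with hΦ
    have hΦm : Measurable Φ := by
      have := hfc.measurable
      fun_prop
    have e : (fun ω => c ω ^ 2) = fun ω => Φ ((Y ω, a ω, b ω), Z ω) := by
      funext ω; rw [hc]
    obtain ⟨h1, h2⟩ := integral_indepFun_eq hYabm hZ hind hΦm (e ▸ i3)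
    rw [hZlaw] at h1 h2
    rw [e, h2]
    have i4 : Integrable (fun ω => 2 * a ω ^ 2 + 2 * b ω ^ 2) P :=
      (ha2.1.const_mul 2).add (hb2.1.const_mul 2)
    have hsq := fun ω => integral_sq_estimate_le hd hq hL hfL hh (Y ω) (a ω) (b ω)
    generalize 12 * (1 + √2) ^ 2 * L ^ 2 * (d : ℝ) ^ (2 * recip (min q 2) - 1) = K at hsq ⊢
    have h3 : ∫ ω, ∫ u, Φ ((Y ω, a ω, b ω), u) ∂(sphereLaw d) ∂P ≤
        ∫ ω, (K + d ^ 2 / (4 * h ^ 2) * (2 * a ω ^ 2 + 2 * b ω ^ 2)) ∂P := by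
      refine integral_mono h1 ((integrable_const K).add (i4.const_mul _)) fun ω => ?_
      refine (hsq ω).trans ?_
      have : (a ω - b ω) ^ 2 ≤ 2 * a ω ^ 2 + 2 * b ω ^ 2 := by nlinarith [sq_nonneg (a ω + b ω)]
      gcongr
    rw [integral_add (integrable_const K) (i4.const_mul _), integral_const_mul,
      integral_add (ha2.1.const_mul 2) (hb2.1.const_mul 2), integral_const_mul,
      integral_const_mul, integral_const, probReal_univ, one_smul] at h3
    refine h3.trans ?_
    have h4 : 2 * ∫ ω, a ω ^ 2 ∂P + 2 * ∫ ω, b ω ^ 2 ∂P ≤ 4 * σ ^ 2 := by linarith [ha2.2, hb2.2]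
    calc _ ≤ K + d ^ 2 / (4 * h ^ 2) * (4 * σ ^ 2) := by gcongr
      _ = _ := by field_simp

/-- The expected regret for arbitrary parameters `η` and `h`. -/
theorem integral_regret_le (hd : 3 ≤ d) (hp : 1 ≤ p) (hq : 1 ≤ q) (hL : 0 ≤ L) (hη : 0 < η)
    (hh : 0 < h) (hΘ : IsCompact Θ) (hV : LowerSemicontinuousOn V Θ)
    (hVs : StronglyConvexLp p Θ V) (hVrange : ∀ x ∈ Θ, ∀ x' ∈ Θ, V x - V x' ≤ R ^ 2)
    (hf : ∀ t, ConvexOn ℝ Set.univ (f t))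
    (hfL : ∀ t, ∀ x x' : Vec d, |f t x - f t x'| ≤ L * ellNorm q (x - x'))
    (hζ : ∀ t, Measurable (ζ t)) (hζindep : iIndepFun ζ P)
    (hζlaw : ∀ t, P.map (ζ t) = sphereLaw d)
    (hξ'm : ∀ t, Measurable (ξ' t)) (hξ''m : ∀ t, Measurable (ξ'' t))
    (hξ' : ∀ t, Integrable (fun ω => ξ' t ω ^ 2) P ∧ ∫ ω, ξ' t ω ^ 2 ∂P ≤ σ ^ 2)
    (hξ'' : ∀ t, Integrable (fun ω => ξ'' t ω ^ 2) P ∧ ∫ ω, ξ'' t ω ^ 2 ∂P ≤ σ ^ 2)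
    (hξindep : IndepFun (fun ω t => (ξ' t ω, ξ'' t ω)) (fun ω t => ζ t ω) P)
    {X : ℕ → Ω → Vec d}
    (hX : ∀ t ω, X t ω = output Θ V (fun _ => η) (fun _ => h) f (fun s => ζ s ω) (fun s => ξ' s ω)
      (fun s => ξ'' s ω) t)
    {x : Vec d} (hx : x ∈ Θ) (T : ℕ) :
    Integrable (fun ω => regret f (fun t => X t ω) T x) P ∧
      ∫ ω, regret f (fun t => X t ω) T x ∂P ≤
        R ^ 2 / η + η / 2 * (d : ℝ) ^ (2 * (1 - recip p)) *
          (T * (12 * (1 + √2) ^ 2 * L ^ 2 * (d : ℝ) ^ (2 * recip (min q 2) - 1) +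
            d ^ 2 * σ ^ 2 / h ^ 2)) + T * (L * h * bias q d) := by
  set z : ℕ → Ω → Vec d := fun t ω => dualVar Θ V (fun _ => η) (fun _ => h) f (fun s => ζ s ω)
    (fun s => ξ' s ω) (fun s => ξ'' s ω) t with hz
  have hA := (continuous_argmaxPoint hp hΘ ⟨x, hx⟩ hV hVs).measurable
  have hfm : ∀ t, Measurable (f t) := fun t => (continuous_of_ellNorm hq hL (hfL t)).measurable
  have hzm : ∀ t, Measurable (z t) := fun t => measurable_dualVar hA hfm hζ hξ'm hξ''m t
  have hXz : ∀ t ω, X t ω = argmaxPoint Θ V (η • z t ω) := hX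
  have hXm : ∀ t, Measurable (X t) := fun t => by
    rw [show X t = _ from funext (hXz t)]
    have := hzm t
    fun_prop
  have hXΘ : ∀ t ω, X t ω ∈ Θ := fun t ω => by
    rw [hXz]; exact (isArgmax_argmaxPoint hΘ ⟨x, hx⟩ hV _).1
  have hind : ∀ t, IndepFun (fun ω => (X t ω, ξ' t ω, ξ'' t ω)) (ζ t) P := fun t => by
    have h1 := indepFun_dualVar (η := fun _ => η) (h := fun _ => h) hA hfm hζ hξ'm hξ''m hζindep
      hξindep t
    have h2 := h1.comp (φ := fun w : Vec d × ℝ × ℝ => (argmaxPoint Θ V (η • w.1), w.2))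
      (ψ := id) (by fun_prop) measurable_id
    rw [Function.id_comp] at h2
    convert h2 using 1
    funext ω
    simp only [hXz, Function.comp, hz]
  set c : ℕ → Ω → ℝ := fun t ω =>
    d / (2 * h) * ((f t (X t ω + h • ζ t ω) + ξ' t ω) - (f t (X t ω - h • ζ t ω) + ξ'' t ω)) with hc
  have round := fun t => integral_round_le hd hq (hf t) hL (hfL t) hh hΘ (hXm t) (hζ t) (hξ'm t)
    (hξ''m t) (hXΘ t) (hζlaw t) (hind t) (hξ' t) (hξ'' t) (c := c t) (fun ω => rfl) x
  have hdet : ∀ ω, ∑ t ∈ Finset.range T, c t ω * inner ℝ (signVec (ζ t ω)) (X t ω - x) ≤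
      R ^ 2 / η + η / 2 * (d : ℝ) ^ (2 * (1 - recip p)) * ∑ t ∈ Finset.range T, c t ω ^ 2 := by
    intro ω
    have h1 := dualAveraging_regret hp hΘ hV hVs hη hVrange (z := fun t => z t ω)
      (s := fun t => signVec (ζ t ω)) (c := fun t => c t ω) (fun t i => abs_signVec_le _ i) rfl
      (fun t => by
        simp only [hc, hXz]
        rfl) hx T
    simp only [← hXz] at h1
    exact h1
  refine ⟨integrable_finsetSum _ fun t _ => (round t).1.1, ?_⟩
  have j2 : Integrable (fun ω => ∑ t ∈ Finset.range T,
      c t ω * inner ℝ (signVec (ζ t ω)) (X t ω - x)) P :=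
    integrable_finsetSum _ fun t _ => (round t).1.2.1
  have j3 : Integrable (fun ω => ∑ t ∈ Finset.range T, c t ω ^ 2) P :=
    integrable_finsetSum _ fun t _ => (round t).1.2.2
  have h1 : ∫ ω, regret f (fun t => X t ω) T x ∂P ≤
      ∫ ω, ∑ t ∈ Finset.range T, c t ω * inner ℝ (signVec (ζ t ω)) (X t ω - x) ∂P +
        T * (L * h * bias q d) := by
    simp only [regret]
    rw [integral_finsetSum _ fun t _ => (round t).1.1,
      integral_finsetSum _ fun t _ => (round t).1.2.1]
    refine (Finset.sum_le_sum fun t _ => (round t).2.1).trans_eq ?_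
    rw [Finset.sum_add_distrib, Finset.sum_const, Finset.card_range, nsmul_eq_mul]
  have h2 := integral_mono j2 ((integrable_const (R ^ 2 / η)).add
    (j3.const_mul (η / 2 * (d : ℝ) ^ (2 * (1 - recip p))))) hdet
  simp only [Pi.add_apply] at h2
  rw [integral_add (integrable_const _) (j3.const_mul _), integral_const, probReal_univ, one_smul,
    integral_const_mul, integral_finsetSum _ fun t _ => (round t).1.2.2] at h2
  have h3 := Finset.sum_le_sum fun t (_ : t ∈ Finset.range T) => (round t).2.2
  rw [Finset.sum_const, Finset.card_range, nsmul_eq_mul] at h3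
  have h4 := mul_le_mul_of_nonneg_left h3
    (show 0 ≤ η / 2 * (d : ℝ) ^ (2 * (1 - recip p)) by positivity)
  linarith

end

/-! ### Tuning of the parameters -/

theorem sqrt_add_le {u v : ℝ} (hu : 0 ≤ u) (hv : 0 ≤ v) : √(u + v) ≤ √u + √v := by
  rw [Real.sqrt_le_left (by positivity), add_sq, Real.sq_sqrt hu, Real.sq_sqrt hv]
  have : 0 ≤ 2 * √u * √v := by positivity
  linarith

/-- The tuning of the step size and of the discretization parameter, with `s = √T`,
`m = d^(2-1/p)` and `E = d^(1+2/(q∧2)-2/p)`. -/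
theorem tuned_bound {R L σ b m s E h η : ℝ} (hR : 0 < R) (hL : 0 < L) (hσ : 0 < σ) (hb : 0 < b)
    (hm : 0 < m) (hs : 0 < s) (hE : 0 < E) (hh : 0 < h)
    (hh2 : h ^ 2 = √2 * R * σ / (L * b) / s * m)
    (hη : η = R / √(s ^ 2 * L) *
      (σ * b / (2 * √2 * R) * (s * m) + 6 * (1 + √2) ^ 2 * L * E) ^ (-(1 / 2) : ℝ)) :
    R ^ 2 / η + η * s ^ 2 * (6 * (1 + √2) ^ 2 * L ^ 2 * E + m ^ 2 * σ ^ 2 / (2 * h ^ 2)) +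
        s ^ 2 * (L * h * b) ≤
      11.9 * R * L * (s * √E) + 2.4 * √(R * L * σ * s ^ 3 * (b * m)) := by
  have h2 : √2 ^ 2 = 2 := Real.sq_sqrt (by norm_num)
  have h20 : 0 < √2 := by positivity
  have h2u : √2 ≤ 1.4143 := by
    rw [Real.sqrt_le_left (by norm_num)]; norm_num
  set B := σ * b / (2 * √2 * R) * (s * m) + 6 * (1 + √2) ^ 2 * L * E with hB
  have hB0 : 0 < B := by positivity
  set W := R * L * σ * s ^ 3 * (b * m) with hW
  have hW0 : 0 < W := by positivity
  set M := √(s ^ 2 * L * B) with hM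
  have hM0 : 0 < M := by positivity
  have hM2 : M ^ 2 = s ^ 2 * L * B := Real.sq_sqrt (by positivity)
  have hηM : η = R / M := by
    rw [hη, hM, Real.sqrt_mul (by positivity : 0 ≤ s ^ 2 * L) B, Real.rpow_neg hB0.le,
      ← Real.sqrt_eq_rpow, div_mul_eq_div_div, div_eq_mul_inv (R / √(s ^ 2 * L))]
  -- the step size balances `R² / η` against `η s² L B`
  have hA : 6 * (1 + √2) ^ 2 * L ^ 2 * E + m ^ 2 * σ ^ 2 / (2 * h ^ 2) = L * B := by
    rw [hh2, hB]
    field_simp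
    ring
  have e1 : R ^ 2 / η + η * s ^ 2 *
      (6 * (1 + √2) ^ 2 * L ^ 2 * E + m ^ 2 * σ ^ 2 / (2 * h ^ 2)) = 2 * (R * M) := by
    have : R / M * s ^ 2 * (L * B) = R / M * M ^ 2 := by rw [hM2]; ring
    rw [hA, hηM, this]
    field_simp
    ring
  have e2 : s ^ 2 * (L * h * b) = √(√2 * W) := by
    rw [eq_comm, Real.sqrt_eq_iff_eq_sq (by positivity) (by positivity)]
    have : (s ^ 2 * (L * h * b)) ^ 2 = s ^ 4 * L ^ 2 * b ^ 2 * h ^ 2 := by ring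
    rw [this, hh2, hW]
    field_simp
  -- the noise part of `2 R M` equals the bias term `√(√2 W)`
  have e3 : 2 * (R * M) ≤ 2 * √6 * (1 + √2) * R * L * (s * √E) + √(√2 * W) := by
    have : 2 * (R * M) = √(24 * (1 + √2) ^ 2 * (R * L * s) ^ 2 * E + √2 * W) := by
      rw [eq_comm, Real.sqrt_eq_iff_eq_sq (by positivity) (by positivity)]
      have : (2 * (R * M)) ^ 2 = 4 * R ^ 2 * M ^ 2 := by ring
      rw [this, hM2, hB, hW]
      field_simp
      linear_combination (2 * s * σ * b * m) * h2
    rw [this]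
    refine (sqrt_add_le (by positivity) (by positivity)).trans_eq ?_
    congr 1
    rw [Real.sqrt_eq_iff_eq_sq (by positivity) (by positivity)]
    have h6 : √6 ^ 2 = 6 := Real.sq_sqrt (by norm_num)
    have hE2 : √E ^ 2 = E := Real.sq_sqrt hE.le
    have : (2 * √6 * (1 + √2) * R * L * (s * √E)) ^ 2 =
        4 * √6 ^ 2 * (1 + √2) ^ 2 * (R * L * s) ^ 2 * √E ^ 2 := by ring
    rw [this, h6, hE2]; ring
  -- the value is `11.827…`
  have e4 : 2 * √6 * (1 + √2) ≤ 11.9 := by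
    have h6u : √6 ≤ 2.4495 := by
      rw [Real.sqrt_le_left (by norm_num)]; norm_num
    nlinarith [Real.sqrt_nonneg 6]
  -- the constant is `2 · 2^(1/4) = 2.378…`
  have e5 : 2 * √(√2 * W) ≤ 2.4 * √W := by
    rw [Real.sqrt_mul h20.le, ← mul_assoc]
    gcongr
    have : √(√2) ≤ 1.2 := by
      rw [Real.sqrt_le_left (by norm_num)]; linarith
    linarith
  have e6 : 2 * √6 * (1 + √2) * R * L * (s * √E) ≤ 11.9 * R * L * (s * √E) := by gcongr
  rw [e1, e2]
  linarith

/-- The bias in the form of the rate, bounding `1 / (d + 1)` by `1 / d`. -/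
theorem bias_mul_le {d : ℕ} (hd : 3 ≤ d) {q : ENNReal} (P : ℝ) :
    bias q d * (d : ℝ) ^ (2 - P) ≤
      if q < ENNReal.ofReal (Real.log d) then q.toReal * (d : ℝ) ^ (1 + recip q - P)
      else Real.exp 1 * Real.log d * (d : ℝ) ^ (1 - P) := by
  have hd0 : (0 : ℝ) < d := by exact_mod_cast (by omega : 0 < d)
  have hl := Real.log_natCast_nonneg d
  have e1 : (d : ℝ) ^ (2 - P) = d * (d : ℝ) ^ (1 - P) := by
    rw [show (2 : ℝ) - P = 1 + (1 - P) by ring, Real.rpow_add hd0, Real.rpow_one]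
  have key : ∀ y, 0 ≤ y → 1 / ((d : ℝ) + 1) * y * (d * (d : ℝ) ^ (1 - P)) ≤
      y * (d : ℝ) ^ (1 - P) := fun y hy => by
    have : (d : ℝ) / (d + 1) ≤ 1 := by rw [div_le_one (by positivity)]; linarith
    calc _ = (d : ℝ) / (d + 1) * (y * (d : ℝ) ^ (1 - P)) := by ring
      _ ≤ _ := mul_le_of_le_one_left (by positivity) this
  rw [bias, e1]
  split_ifs
  · refine (key _ (by positivity)).trans_eq ?_
    rw [mul_assoc, ← Real.rpow_add hd0]
    congr 2; ring
  · exact key _ (by positivity)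

end ZeroOrder

theorem theorem2 {d : ℕ} (hd : 3 ≤ d) (p q : ENNReal) (hp : 1 ≤ p) (hq : 1 ≤ q)
    (R L σ : ℝ) (hR : 0 < R) (hL : 0 < L) (hσ : 0 < σ) (T : ℕ) (hT : 1 ≤ T)
    -- the action set and the regularizer
    (Θ : Set (Vec d)) (hΘcompact : IsCompact Θ) (hΘconvex : Convex ℝ Θ)
    (V : Vec d → ℝ) (hVlsc : LowerSemicontinuousOn V Θ) (hVstrong : StronglyConvexLp p Θ V)
    (hVrange : ∀ x ∈ Θ, ∀ x' ∈ Θ, V x - V x' ≤ R ^ 2)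
    -- the loss functions
    (f : ℕ → Vec d → ℝ) (hfconvex : ∀ t, ConvexOn ℝ Set.univ (f t))
    (hfLip : ∀ t, ∀ x x' : Vec d, |f t x - f t x'| ≤ L * ellNorm q (x - x'))
    -- the randomization of the algorithm
    {Ω : Type*} [MeasurableSpace Ω] (P : Measure Ω) [IsProbabilityMeasure P]
    (ζ : ℕ → Ω → Vec d) (hζmeas : ∀ t, Measurable (ζ t)) (hζindep : iIndepFun ζ P)
    (hζunif : ∀ t, pdf.IsUniform (ζ t) (l1Sphere d) P (surfaceMeasure d))
    -- the adversarial noise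
    (ξ' ξ'' : ℕ → Ω → ℝ) (hξ'meas : ∀ t, Measurable (ξ' t)) (hξ''meas : ∀ t, Measurable (ξ'' t))
    (hξ' : ∀ t, Integrable (fun ω => ξ' t ω ^ 2) P ∧ ∫ ω, ξ' t ω ^ 2 ∂P ≤ σ ^ 2)
    (hξ'' : ∀ t, Integrable (fun ω => ξ'' t ω ^ 2) P ∧ ∫ ω, ξ'' t ω ^ 2 ∂P ≤ σ ^ 2)
    (hξindep : IndepFun (fun ω t => (ξ' t ω, ξ'' t ω)) (fun ω t => ζ t ω) P)
    -- the outputs of the algorithm run with the tuned parameters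
    (X : ℕ → Ω → Vec d)
    (hX : ∀ t ω, X t ω =
      output Θ V (fun _ => noisyStep p q d T R L σ) (fun _ => noisyDiscr p q d T R L σ) f
        (fun s => ζ s ω) (fun s => ξ' s ω) (fun s => ξ'' s ω) t)
    (x : Vec d) (hx : x ∈ Θ) :
    Integrable (fun ω => regret f (fun t => X t ω) T x) P ∧
      ∫ ω, regret f (fun t => X t ω) T x ∂P ≤
        11.9 * R * L * √(T * (d : ℝ) ^ (1 + 2 * recip (min q 2) - 2 * recip p)) +
          2.4 * √(R * L * σ) * (T : ℝ) ^ (3 / 4 : ℝ) *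
            (if q < ENNReal.ofReal (Real.log d) then
              √(q.toReal * (d : ℝ) ^ (1 + recip q - recip p))
            else √(Real.exp 1 * Real.log d * (d : ℝ) ^ (1 - recip p))) := by
  have hlaw : ∀ t, P.map (ζ t) = sphereLaw d := fun t => hζunif t
  have hsl : IsProbabilityMeasure (sphereLaw d) :=
    hlaw 0 ▸ Measure.isProbabilityMeasure_map (hζmeas 0).aemeasurable
  have hd0 : (0 : ℝ) < d := by exact_mod_cast (by omega : 0 < d)
  have hT0 : (0 : ℝ) < T := by exact_mod_cast (by omega : 0 < T)
  have hb : 0 < bias q d := bias_pos hd hq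
  set h := noisyDiscr p q d T R L σ with hh
  set η := noisyStep p q d T R L σ with hη
  set m : ℝ := (d : ℝ) ^ (2 - recip p) with hm
  set E : ℝ := (d : ℝ) ^ (1 + 2 * recip (min q 2) - 2 * recip p) with hE
  have hm0 : 0 < m := by positivity
  have hE0 : 0 < E := by positivity
  have hs0 : 0 < √(T : ℝ) := by positivity
  have hs2 : √(T : ℝ) ^ 2 = T := Real.sq_sqrt hT0.le
  have hm2 : m ^ 2 = (d : ℝ) ^ (4 - 2 * recip p) := by
    rw [hm, ← Real.rpow_natCast, ← Real.rpow_mul hd0.le]; congr 1; push_cast; ring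
  have hh0 : 0 < h := by rw [hh, noisyDiscr]; positivity
  have hh2 : h ^ 2 = √2 * R * σ / (L * bias q d) / √T * m := by
    rw [hh, noisyDiscr, mul_pow, mul_pow, ← Real.rpow_natCast, ← Real.rpow_natCast,
      ← Real.rpow_natCast, ← Real.rpow_mul (by positivity), ← Real.rpow_mul hT0.le,
      ← Real.rpow_mul hd0.le, Real.sqrt_eq_rpow T, div_eq_mul_inv _ ((T : ℝ) ^ (1 / 2 : ℝ)),
      ← Real.rpow_neg hT0.le, hm]
    congr 2
    · rw [show (1 / 2 : ℝ) * (2 : ℕ) = 1 by norm_num, Real.rpow_one]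
    · norm_num
    · push_cast; ring
  have hη' : η = R / √(√T ^ 2 * L) * (σ * bias q d / (2 * √2 * R) * (√T * m) +
      6 * (1 + √2) ^ 2 * L * E) ^ (-(1 / 2) : ℝ) := by
    rw [hη, noisyStep, hs2, ← hm2, Real.sqrt_mul hT0.le (m ^ 2), Real.sqrt_sq hm0.le]
  have hη0 : 0 < η := by rw [hη']; positivity
  obtain ⟨hint, hle⟩ := integral_regret_le hd hp hq hL.le hη0 hh0 hΘcompact hVlsc hVstrong hVrange
    hfconvex hfLip hζmeas hζindep hlaw hξ'meas hξ''meas hξ' hξ'' hξindep hX hx T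
  refine ⟨hint, hle.trans ?_⟩
  have p1 : (d : ℝ) ^ (2 * (1 - recip p)) * (d : ℝ) ^ (2 * recip (min q 2) - 1) = E := by
    rw [← Real.rpow_add hd0, hE]; congr 1; ring
  have p2 : (d : ℝ) ^ (2 * (1 - recip p)) * (d : ℝ) ^ 2 = m ^ 2 := by
    rw [hm2, ← Real.rpow_natCast, ← Real.rpow_add hd0]; congr 1; push_cast; ring
  have tuned := tuned_bound hR hL hσ hb hm0 hs0 hE0 hh0 hh2 hη'
  rw [hs2] at tuned
  have e1 : R ^ 2 / η + η / 2 * (d : ℝ) ^ (2 * (1 - recip p)) *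
      (T * (12 * (1 + √2) ^ 2 * L ^ 2 * (d : ℝ) ^ (2 * recip (min q 2) - 1) +
        d ^ 2 * σ ^ 2 / h ^ 2)) + T * (L * h * bias q d) =
      R ^ 2 / η + η * T * (6 * (1 + √2) ^ 2 * L ^ 2 * E + m ^ 2 * σ ^ 2 / (2 * h ^ 2)) +
        T * (L * h * bias q d) := by
    rw [← p1, ← p2]; ring
  rw [e1]
  refine tuned.trans (add_le_add (le_of_eq ?_) ?_)
  · rw [Real.sqrt_mul hT0.le]
  · have hT34 : √(√(T : ℝ) ^ 3) = (T : ℝ) ^ (3 / 4 : ℝ) := by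
      rw [Real.sqrt_eq_rpow, Real.sqrt_eq_rpow, ← Real.rpow_natCast, ← Real.rpow_mul hT0.le,
        ← Real.rpow_mul hT0.le]
      norm_num
    rw [Real.sqrt_mul (by positivity), Real.sqrt_mul (by positivity), hT34, ← mul_assoc,
      ← mul_assoc, ← apply_ite Real.sqrt]
    gcongr
    exact bias_mul_le hd (recip p)
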